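/- Let $k$ be a field of characteristic zero, with a fixed coordinate $t$ on the formal disc. For a commutative $k$-algebra $A$, the disc and the punctured disc over $A$ are $\operatorname{Spec} A[[t]]$ and $\operatorname{Spec} A((t))$. For $n\ge 0$ let $\mathcal Z^{\le n}$ be the (a priori derived) stack quotient of the derived equalizer of the two maps $$\mathfrak L^+\mathbb A^1\times\mathfrak L^{\le n}\mathbb A^1dt\rightrightarrows\mathfrak L^{\le n}\mathbb A^1dt,\qquad (g,\omega)\mapsto dg,\quad (g,\omega)\mapsto g\omega ,$$ by the gauge action $f\cdot(g,\omega)=(fg,\omega+d\log f)$ of $\mathfrak L^+\mathbb G_m$; here $\mathfrak L^+\mathbb A^1(A)=A[[t]]$, $\mathfrak L^{\le n}\mathbb A^1dt(A)=t^{-n}A[[t]]dt$ and $\mathfrak L^+\mathbb G_m(A)=A[[t]]^\times$. Let $C=\operatorname{Spec}k[x,y]/(xy)$, with $\mathbb G_m$ acting so that $\deg x=1$ and $\deg y=0$; thus $A$-points of $C/\mathbb G_m$ are triples $(M,m,y)$ of a line bundle $M$ on $\operatorname{Spec}A$, a section $m$ of $M$ and $y\in A$, with $ym=0$. (0) For every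 $n\ge0$ the derived equalizer above is classical (no higher $\operatorname{Tor}$s arise in forming it). Hence $\mathcal Z^{\le n}$ is a classical stack. Its $A$-points are triples $(L,\nabla,s)$ of a line bundle $L$ on the disc, a connection $\nabla$ on the restriction of $L$ to the punctured disc with $\nabla L\subset t^{-n}L\,dt$, and a section $s$ of $L$ on the disc with $\nabla s=0$; the pair $(g,\omega)$ corresponds to the trivial line bundle with $\nabla=d-\omega$ and $s=g$. Suppose $n>0$. Let $\mathcal Z^{\le n}\to C/\mathbb G_m$ be the map $(L,\nabla,s)\mapsto(L|_{t=0},s|_{t=0},y)$, where $y$ is the leading coefficient of the connection (the coefficient of $t^{-n}dt$ in $\omega$, if $\nabla=d-\omega$ in a local trivialization of $L$). (1) This map is flat along both axes: $W=\mathcal Z^{\le n}\times_{C/\mathbb G_m}C=\mathcal Z^{\le n}\times_{\mathbb B\mathbb G_m}\operatorname{Spec}k$ is a classical affine scheme, and the derived fiber products of $W\to C$ with the $x$-axis $\{y=0\}$ and with the $y$-axis $\{x=0\}$ are classical, that is, $\operatorname{Tor}_i^{\mathcal O(C)}(\mathcal O(W),\mathcal O(C)/(y))=\operatorname{Tor}_i^{\mathcal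 O(C)}(\mathcal O(W),\mathcal O(C)/(x))=0$ for all $i>0$. (2) The inclusion $\mathcal Z^{\le n-1}\to\mathcal Z^{\le n}$ induces an isomorphism $\mathcal Z^{\le n-1}\simeq\mathcal Z^{\le n}\times_{C/\mathbb G_m}\mathbb A^1/\mathbb G_m$ with the derived fiber product over the $x$-axis $\mathbb A^1/\mathbb G_m=\{y=0\}\subset C/\mathbb G_m$. (3) Let $\iota:\mathcal Z^{\le n}\to\mathcal Z^{\le n}$ be the map $(L,\nabla,s)\mapsto(L(1),\nabla,s)$, where $L(1)=t^{-1}L$. Then $\iota$ fits into a derived Cartesian square $$\begin{array}{ccc}\mathcal Z^{\le n}&\xrightarrow{\ \iota\ }&\mathcal Z^{\le n}\\ \downarrow&&\downarrow\\ \mathbb A^1\times\mathbb B\mathbb G_m&\xrightarrow{(\mathrm{id},0)}&C/\mathbb G_m\end{array}$$ in which the lower map is the inclusion of the $y$-axis $\{x=0\}$. (4) Consequently $\iota$ is an almost finitely presented closed embedding: its base change to every affine scheme over $\mathcal Z^{\le n}$ is (on underlying classical schemes) a closed embedding, and its base change to a faithfully flat affine cover of $\mathcal Z^{\le n}$ is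 a pseudo-coherent morphism. -/

import Mathlib

open CategoryTheory CategoryTheory.Limits
open scoped PowerSeries LaurentSeries TensorProduct

universe u

noncomputable section

namespace FlatAxes

/-! ## Homological notions for classical rings -/

/-- For ring maps `P ← R → Q`, the derived tensor product `P ⊗ᴸ_R Q` is classical, i.e.
`Tor_i^R(P, Q) = 0` for all `i > 0`.  Equivalently the derived fibre product
`Spec P ×_{Spec R} Spec Q` is a classical scheme. -/
def TorIndependent {R P Q : Type u} [CommRing R] [CommRing P] [CommRing Q]
    (f : R →+* P) (g : R →+* Q) : Prop :=
  ∀ i : ℕ, 0 < i → IsZero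
    (((Tor (ModuleCat.{u} R) i).obj ((ModuleCat.restrictScalars f).obj (ModuleCat.of P P))).obj
      ((ModuleCat.restrictScalars g).obj (ModuleCat.of Q Q)))

/-- `M` is a pseudo-coherent `R`-module: it has a resolution
`⋯ → R ^ r 2 → R ^ r 1 → R ^ r 0 → M → 0` by finite free modules. -/
def PseudoCoherentModule (R M : Type*) [CommRing R] [AddCommGroup M] [Module R M] : Prop :=
  ∃ (r : ℕ → ℕ) (d : ∀ i, (Fin (r (i + 1)) → R) →ₗ[R] (Fin (r i) → R))
    (ε : (Fin (r 0) → R) →ₗ[R] M),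
    Function.Surjective ε ∧ Function.Exact (d 0) ε ∧
      ∀ i, Function.Exact (d (i + 1)) (d i)

/-- A homomorphism `f : R → P` of (classical) commutative rings is almost finitely presented, i.e.
pseudo-coherent: there is a surjection `R[x₁, …, x_N] → P` of `R`-algebras that makes `P` a
pseudo-coherent `R[x₁, …, x_N]`-module. -/
def AlmostFinitelyPresented {R P : Type*} [CommRing R] [CommRing P] (f : R →+* P) : Prop :=
  ∃ (N : ℕ) (g : MvPolynomial (Fin N) R →+* P), Function.Surjective g ∧
    g.comp MvPolynomial.C = f ∧
    @PseudoCoherentModule (MvPolynomial (Fin N) R) P _ _ (Module.compHom P g)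

/-! ## Stacks

A (classical) stack over `k` is given by its total category `S` with a functor
`p : S ⥤ CommAlgCat k`: an object `s` with `p s = A` is an `A`-point, and an arrow `s ⟶ s'` over
`A → A'` is an isomorphism of the base change of `s` to `A'` with `s'` (so all the categories below
are cofibred in groupoids over `k`-algebras, that is, fibred in groupoids over affine schemes).

For an `R`-point `v` of `S` and a morphism `F : X ⥤ S`, the fibre product `Spec R ×_S X` is the
category `StructuredArrow v F` of pairs `(x, v ⟶ F x)`.  It is representable by an affine scheme if
and only if it has an initial object `T` (the universal point); it is then `Spec` of the ring over
which `T` lives, and its projection to `Spec R` corresponds to the ring map `p.map T.hom`. -/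

section Stacks

variable {k : Type u} [CommRing k] {W X Y S : Type*}
  [Category* W] [Category* X] [Category* Y] [Category* S]

/-- The ring homomorphism underlying an arrow of a stack. -/
abbrev baseHom (p : S ⥤ CommAlgCat.{u} k) {s s' : S} (f : s ⟶ s') :
    (p.obj s : Type u) →+* (p.obj s' : Type u) :=
  ((p.map f).hom : (p.obj s : Type u) →+* (p.obj s' : Type u))

/-- The `R`-point `v` is an affine flat cover `Spec R → S`: for every affine scheme `Spec A` and
every `s : Spec A → S`, the fibre product `Spec A ×_S Spec R` is representable by an affine scheme
`Spec B`, faithfully flat over `Spec A`.  A map from `Spec B'` to `Spec A ×_S Spec R` is a cospan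
`s ⟶ w' ⟵ v` with `w'` over `B'`; so the representing `w` is the coproduct of `s` and `v`. -/
def IsFlatCover (p : S ⥤ CommAlgCat.{u} k) (v : S) : Prop :=
  ∀ s : S, ∃ (w : S) (i : s ⟶ w) (j : v ⟶ w),
    Nonempty (IsColimit (BinaryCofan.mk i j)) ∧ (baseHom p i).FaithfullyFlat

/-- A 2-commutative square of classical stacks
```
  W --T--> X
  |        |
  L        F
  v        v
  Y --G--> S
```
with `F` and `G` affine, is derived Cartesian: it is Cartesian, and there are no higher `Tor`s in
`X ×_S Y`.  The latter is a flat-local condition on `S`; it is expressed on an affine flat cover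
`v : Spec R → S`, where `X ×_S Spec R = Spec P` and `Y ×_S Spec R = Spec Q` are affine. -/
structure IsDerivedCartesian (p : S ⥤ CommAlgCat.{u} k) (T : W ⥤ X) (L : W ⥤ Y)
    (F : X ⥤ S) (G : Y ⥤ S) (e : T ⋙ F ≅ L ⋙ G) : Prop where
  cartesian : ((CategoricalPullback.CatCommSqOver.toFunctorToCategoricalPullback F G W).obj
    ⟨T, L, e⟩).IsEquivalence
  tor : ∃ v : S, IsFlatCover p v ∧ ∃ (P : StructuredArrow v F) (Q : StructuredArrow v G),
    Nonempty (IsInitial P) ∧ Nonempty (IsInitial Q) ∧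
      TorIndependent (baseHom p P.hom) (baseHom p Q.hom)

/-- `F : X → Y` is a closed embedding: for every affine scheme `Spec A → Y` the fibre product
`Spec A ×_Y X` is representable by a closed subscheme of `Spec A`. -/
def IsClosedEmbedding (p : Y ⥤ CommAlgCat.{u} k) (F : X ⥤ Y) : Prop :=
  ∀ y : Y, ∃ T : StructuredArrow y F, Nonempty (IsInitial T) ∧
    Function.Surjective (baseHom p T.hom)

/-- `F : X → Y` is representable and almost finitely presented: it is so after base change to some affine
flat cover `Spec R → Y` (the condition is flat-local on `Y`).  As the cover is flat, the base change
of a morphism of classical stacks is classical, so that no derived structure arises. -/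
def IsAlmostFinitelyPresented (p : Y ⥤ CommAlgCat.{u} k) (F : X ⥤ Y) : Prop :=
  ∃ u : Y, IsFlatCover p u ∧ ∃ T : StructuredArrow u F, Nonempty (IsInitial T) ∧
    AlmostFinitelyPresented (baseHom p T.hom)

end Stacks

/-! ## Semilinear preliminaries -/

section Semilinear

variable {R R' M M' : Type*} [CommRing R] [CommRing R'] [AddCommGroup M] [AddCommGroup M']
  [Module R M] [Module R' M']

theorem span_image_span (σ : R →+* R') (f : M →+ M')
    (hf : ∀ (r : R) (m : M), f (r • m) = σ r • f m) (s : Set M) :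
    Submodule.span R' (f '' (Submodule.span R s : Set M)) = Submodule.span R' (f '' s) := by
  apply le_antisymm
  · rw [Submodule.span_le]
    rintro _ ⟨x, hx, rfl⟩
    induction hx using Submodule.span_induction with
    | mem x hx => exact Submodule.subset_span ⟨x, hx, rfl⟩
    | zero => simp
    | add x y _ _ hx hy => rw [map_add]; exact Submodule.add_mem _ hx hy
    | smul r x _ hx => rw [hf]; exact Submodule.smul_mem _ _ hx
  · exact Submodule.span_mono (Set.image_mono Submodule.subset_span)

end Semilinear

variable (k : Type u) [Field k]

/-! ## The stack `C / 𝔾_m` with `C = {xy = 0}` -/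

/-- A point of `C / 𝔾_m` over `A`, where `C = Spec k[x,y]/(xy)` and `𝔾_m` acts by horizontal
homothety (`deg x = 1`, `deg y = 0`): a line bundle `M` on `Spec A`, a section `m` of `M`, and a
function `y`, with `y m = 0`. -/
structure AxesModGm where
  A : Type u
  [commRing : CommRing A]
  [algebra : Algebra k A]
  M : Type u
  [addCommGroup : AddCommGroup M]
  [module : Module A M]
  [invertible : Module.Invertible A M]
  m : M
  y : A
  smul_eq_zero : y • m = 0

namespace AxesModGm

attribute [instance] commRing algebra addCommGroup module invertible

variable {k}

/-- Arrows: a semilinear map `M → M'` over `A → A'` inducing an isomorphism `A' ⊗_A M ≅ M'` (a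
surjection of line bundles is an isomorphism), compatible with `m` and `y`. -/
@[ext]
structure Hom (P Q : AxesModGm.{u} k) where
  base : P.A →ₐ[k] Q.A
  map : P.M →+ Q.M
  map_smul : ∀ (a : P.A) (x : P.M), map (a • x) = base a • map x
  span_range : Submodule.span Q.A (Set.range map) = ⊤
  map_m : map P.m = Q.m
  map_y : base P.y = Q.y

instance : Category (AxesModGm.{u} k) where
  Hom := Hom
  id P :=
    { base := AlgHom.id k P.A
      map := AddMonoidHom.id P.M
      map_smul := fun _ _ => rfl
      span_range := by simp
      map_m := rfl
      map_y := rfl }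
  comp {P Q R} f g :=
    { base := g.base.comp f.base
      map := g.map.comp f.map
      map_smul := fun a x => by simp [f.map_smul, g.map_smul]
      span_range := by
        have h := span_image_span (g.base : Q.A →+* R.A) g.map g.map_smul (Set.range f.map)
        rw [f.span_range] at h
        rw [AddMonoidHom.coe_comp, Set.range_comp, ← h, Submodule.top_coe, Set.image_univ,
          g.span_range]
      map_m := by simp [f.map_m, g.map_m]
      map_y := by simp [f.map_y, g.map_y] }

@[ext]
theorem hom_ext {P Q : AxesModGm.{u} k} {f g : P ⟶ Q} (h₁ : f.base = g.base)
    (h₂ : f.map = g.map) : f = g :=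
  Hom.ext h₁ h₂

variable (k) in
/-- The structure morphism to `Spec k`. -/
def toRing : AxesModGm.{u} k ⥤ CommAlgCat.{u} k where
  obj P := CommAlgCat.of k P.A
  map f := CommAlgCat.ofHom f.base

variable (k) in
/-- The coordinate ring `k[x, y]/(xy)` of `C`. -/
def CoordRing : Type u :=
  MvPolynomial (Fin 2) k ⧸
    (Ideal.span {MvPolynomial.X 0 * MvPolynomial.X 1} : Ideal (MvPolynomial (Fin 2) k))

instance : CommRing (CoordRing k) :=
  inferInstanceAs (CommRing (MvPolynomial (Fin 2) k ⧸
    (Ideal.span {MvPolynomial.X 0 * MvPolynomial.X 1} : Ideal (MvPolynomial (Fin 2) k))))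

instance : Algebra k (CoordRing k) :=
  inferInstanceAs (Algebra k (MvPolynomial (Fin 2) k ⧸
    (Ideal.span {MvPolynomial.X 0 * MvPolynomial.X 1} : Ideal (MvPolynomial (Fin 2) k))))

variable (k) in
/-- The function `x` on `C`. -/
def coordX : CoordRing k :=
  (Ideal.Quotient.mk (Ideal.span {MvPolynomial.X 0 * MvPolynomial.X 1}) (MvPolynomial.X 0) :
    MvPolynomial (Fin 2) k ⧸ _)

variable (k) in
/-- The function `y` on `C`. -/
def coordY : CoordRing k :=
  (Ideal.Quotient.mk (Ideal.span {MvPolynomial.X 0 * MvPolynomial.X 1}) (MvPolynomial.X 1) :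
    MvPolynomial (Fin 2) k ⧸ _)

variable (k) in
theorem coordY_mul_coordX : coordY k * coordX k = 0 := by
  rw [mul_comm]
  exact Ideal.Quotient.eq_zero_iff_mem.mpr (Ideal.subset_span rfl)

variable (k) in
/-- The standard cover `C → C / 𝔾_m`, the base change of `Spec k → 𝔹𝔾_m`: the trivial line bundle
with section `x`, and the function `y`. -/
def cover : AxesModGm.{u} k where
  A := CoordRing k
  M := CoordRing k
  m := coordX k
  y := coordY k
  smul_eq_zero := coordY_mul_coordX k

variable (k) in
/-- The `x`-axis `𝔸¹ / 𝔾_m = {y = 0}` in `C / 𝔾_m`: its points are pairs `(M, m)`. -/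
abbrev XAxis := ObjectProperty.FullSubcategory fun P : AxesModGm.{u} k => P.y = 0

variable (k) in
/-- The `y`-axis `𝔸¹ × 𝔹𝔾_m = {x = 0}` in `C / 𝔾_m`: its points are pairs `(y, M)`. -/
abbrev YAxis := ObjectProperty.FullSubcategory fun P : AxesModGm.{u} k => P.m = 0

variable (k) in
/-- The inclusion of the `x`-axis, `𝔸¹ / 𝔾_m → C / 𝔾_m`. -/
abbrev xAxisIncl : XAxis k ⥤ AxesModGm.{u} k := ObjectProperty.ι _

variable (k) in
/-- The inclusion of the `y`-axis, `(id, 0) : 𝔸¹ × 𝔹𝔾_m → C / 𝔾_m`. -/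
abbrev yAxisIncl : YAxis k ⥤ AxesModGm.{u} k := ObjectProperty.ι _

end AxesModGm

open AxesModGm in
/-- A map `Spec P → C` of affine schemes is flat along the axes: the derived fibre products with the
`x`-axis `{y = 0}` and with the `y`-axis `{x = 0}` are classical. -/
def FlatAlongAxes {k : Type u} [Field k] {P : Type u} [CommRing P] (f : CoordRing k →+* P) : Prop :=
  TorIndependent f (Ideal.Quotient.mk (Ideal.span {coordY k})) ∧
    TorIndependent f (Ideal.Quotient.mk (Ideal.span {coordX k}))

/-- A morphism `F : Z → C / 𝔾_m` is flat along the axes: the pullback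
`Z ×_{C / 𝔾_m} C = Z ×_{𝔹𝔾_m} Spec k` is an affine scheme, and its map to `C` is flat along the
axes. -/
def StackFlatAlongAxes {k : Type u} [Field k] {Z : Type*} [Category* Z]
    (F : Z ⥤ AxesModGm.{u} k) : Prop :=
  ∃ T : StructuredArrow (AxesModGm.cover k) F, Nonempty (IsInitial T) ∧
    FlatAlongAxes (k := k) (P := ((AxesModGm.toRing k).obj (F.obj T.right) : Type u))
      (baseHom (AxesModGm.toRing k) T.hom)

/-! ## Line bundles on the disc -/

/-- A point of `𝔹 𝔏⁺𝔾_m = 𝔏⁺ 𝔹𝔾_m` over `A`: a line bundle on the disc `Spec A[[t]]`. -/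
structure DiscLine where
  A : Type u
  [commRing : CommRing A]
  [algebra : Algebra k A]
  N : Type u
  [addCommGroup : AddCommGroup N]
  [module : Module A⟦X⟧ N]
  [invertible : Module.Invertible A⟦X⟧ N]

namespace DiscLine

attribute [instance] commRing algebra addCommGroup module invertible

variable {k}

/-- Arrows: a semilinear map `N → N'` over `A[[t]] → A'[[t]]` that induces an isomorphism
`A'[[t]] ⊗_{A[[t]]} N ≅ N'`. -/
@[ext]
structure Hom (P Q : DiscLine.{u} k) where
  base : P.A →ₐ[k] Q.A
  map : P.N →+ Q.N
  map_smul : ∀ (g : P.A⟦X⟧) (x : P.N),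
    map (g • x) = PowerSeries.map (base : P.A →+* Q.A) g • map x
  span_range : Submodule.span Q.A⟦X⟧ (Set.range map) = ⊤

instance : Category (DiscLine.{u} k) where
  Hom := Hom
  id P :=
    { base := AlgHom.id k P.A
      map := AddMonoidHom.id P.N
      map_smul := fun g x => by
        have : PowerSeries.map ((AlgHom.id k P.A : P.A →ₐ[k] P.A) : P.A →+* P.A) g = g := by
          ext; simp
        rw [this]; rfl
      span_range := by simp }
  comp {P Q R} f g :=
    { base := g.base.comp f.base
      map := g.map.comp f.map
      map_smul := fun a x => by
        have : PowerSeries.map ((g.base.comp f.base : P.A →ₐ[k] R.A) : P.A →+* R.A) a =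
          PowerSeries.map (g.base : Q.A →+* R.A) (PowerSeries.map (f.base : P.A →+* Q.A) a) := by
          ext; simp
        simp [f.map_smul, g.map_smul, this]
      span_range := by
        have h := span_image_span (PowerSeries.map (g.base : Q.A →+* R.A)) g.map g.map_smul
          (Set.range f.map)
        rw [f.span_range] at h
        rw [AddMonoidHom.coe_comp, Set.range_comp, ← h, Submodule.top_coe, Set.image_univ,
          g.span_range] }

variable (k) in
/-- The base point `Spec k → 𝔹 𝔏⁺𝔾_m`: the trivial line bundle on the disc. -/
def trivial : DiscLine.{u} k where
  A := k
  N := k⟦X⟧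

end DiscLine

/-! ## The stacks `𝒵` and `𝒵^{≤ n}` -/

/-- A point of `𝒵` over `A`: a line bundle on the disc `Spec A[[t]]`, a connection on the punctured
disc `Spec A((t))` (relative to `A`), and a flat section that is regular on the disc.

Here `V` is the line bundle on the punctured disc, an `A((t))`-module, and the line bundle on the
disc is a lattice `L ⊆ V`, i.e. an invertible `A[[t]]`-submodule with `L[t⁻¹] = V`.  With the
coordinate `t` fixed, the connection is `v ↦ nabla v ⊗ dt`. -/
structure FlatSection where
  A : Type u
  [commRing : CommRing A]
  [algebra : Algebra k A]
  V : Type u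
  [addCommGroup : AddCommGroup V]
  [moduleLaurent : Module A⸨X⸩ V]
  [modulePower : Module A⟦X⟧ V]
  [moduleBase : Module A V]
  [towerLaurent : IsScalarTower A⟦X⟧ A⸨X⸩ V]
  [towerBase : IsScalarTower A A⟦X⟧ V]
  L : Submodule A⟦X⟧ V
  [invertible : Module.Invertible A⟦X⟧ L]
  exists_pow_smul_mem : ∀ v : V, ∃ i : ℕ, (PowerSeries.X ^ i : A⟦X⟧) • v ∈ L
  nabla : V →+ V
  leibniz : ∀ (f : A⸨X⸩) (v : V), nabla (f • v) = LaurentSeries.derivative A f • v + f • nabla v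
  s : V
  s_mem : s ∈ L
  nabla_s : nabla s = 0

namespace FlatSection

attribute [instance] commRing algebra addCommGroup moduleLaurent modulePower moduleBase
  towerLaurent towerBase invertible

variable {k}

/-- Arrows: a semilinear map `V → V'` over `A[[t]] → A'[[t]]` that induces an isomorphism
`A'[[t]] ⊗_{A[[t]]} L ≅ L'`, compatible with the connections and the sections.  (It is then
semilinear over `A((t)) → A'((t))`.) -/
@[ext]
structure Hom (P Q : FlatSection.{u} k) where
  base : P.A →ₐ[k] Q.A
  map : P.V →+ Q.V
  map_smul : ∀ (g : P.A⟦X⟧) (v : P.V),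
    map (g • v) = PowerSeries.map (base : P.A →+* Q.A) g • map v
  span_map : Submodule.span Q.A⟦X⟧ (map '' (P.L : Set P.V)) = Q.L
  map_nabla : ∀ v : P.V, map (P.nabla v) = Q.nabla (map v)
  map_s : map P.s = Q.s

instance : Category (FlatSection.{u} k) where
  Hom := Hom
  id P :=
    { base := AlgHom.id k P.A
      map := AddMonoidHom.id P.V
      map_smul := fun g x => by
        have : PowerSeries.map ((AlgHom.id k P.A : P.A →ₐ[k] P.A) : P.A →+* P.A) g = g := by
          ext; simp
        rw [this]; rfl
      span_map := by simp
      map_nabla := fun _ => rfl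
      map_s := rfl }
  comp {P Q R} f g :=
    { base := g.base.comp f.base
      map := g.map.comp f.map
      map_smul := fun a x => by
        have : PowerSeries.map ((g.base.comp f.base : P.A →ₐ[k] R.A) : P.A →+* R.A) a =
          PowerSeries.map (g.base : Q.A →+* R.A) (PowerSeries.map (f.base : P.A →+* Q.A) a) := by
          ext; simp
        simp [f.map_smul, g.map_smul, this]
      span_map := by
        have h := span_image_span (PowerSeries.map (g.base : Q.A →+* R.A)) g.map g.map_smul
          (f.map '' (P.L : Set P.V))
        rw [f.span_map] at h
        rw [AddMonoidHom.coe_comp, Set.image_comp, ← h, g.span_map]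
      map_nabla := fun v => by simp [f.map_nabla, g.map_nabla]
      map_s := by simp [f.map_s, g.map_s] }

@[ext]
theorem hom_ext {P Q : FlatSection.{u} k} {f g : P ⟶ Q} (h₁ : f.base = g.base)
    (h₂ : f.map = g.map) : f = g :=
  Hom.ext h₁ h₂

theorem Hom.map_mem {P Q : FlatSection.{u} k} (f : Hom P Q) {v : P.V} (hv : v ∈ P.L) :
    f.map v ∈ Q.L := by
  rw [← f.span_map]
  exact Submodule.subset_span ⟨v, hv, rfl⟩

/-- The connection has a pole of order at most `n`: `∇ L ⊆ t⁻ⁿ L dt`. -/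
def PoleLE (n : ℕ) : ObjectProperty (FlatSection.{u} k) :=
  fun P => ∀ v ∈ P.L, (PowerSeries.X ^ n : P.A⟦X⟧) • P.nabla v ∈ P.L

/-! ### Multiplication by `t` on `V` -/

theorem coe_smul (P : FlatSection.{u} k) (g : P.A⟦X⟧) (v : P.V) :
    (algebraMap P.A⟦X⟧ P.A⸨X⸩ g) • v = g • v := algebraMap_smul _ _ _

theorem exists_X_smul (P : FlatSection.{u} k) (v : P.V) :
    ∃ w : P.V, (PowerSeries.X : P.A⟦X⟧) • w = v := by
  refine ⟨(HahnSeries.single (-1 : ℤ) (1 : P.A) : P.A⸨X⸩) • v, ?_⟩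
  rw [← coe_smul, smul_smul]
  have : algebraMap P.A⟦X⟧ P.A⸨X⸩ PowerSeries.X = HahnSeries.single (1 : ℤ) (1 : P.A) := by
    rw [LaurentSeries.coe_algebraMap]
    exact HahnSeries.ofPowerSeries_X
  rw [this, HahnSeries.single_mul_single]
  simp

theorem X_smul_injective (P : FlatSection.{u} k) :
    Function.Injective fun v : P.V => (PowerSeries.X : P.A⟦X⟧) • v := by
  intro v w h
  have : algebraMap P.A⟦X⟧ P.A⸨X⸩ PowerSeries.X = HahnSeries.single (1 : ℤ) (1 : P.A) := by
    rw [LaurentSeries.coe_algebraMap]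
    exact HahnSeries.ofPowerSeries_X
  have h2 := congrArg (fun u => (HahnSeries.single (-1 : ℤ) (1 : P.A) : P.A⸨X⸩) • u) h
  simp only [← coe_smul, smul_smul, this, HahnSeries.single_mul_single] at h2
  simpa using h2

theorem derivative_coe {A : Type u} [CommRing A] (g : A⟦X⟧) :
    LaurentSeries.derivative A (algebraMap A⟦X⟧ A⸨X⸩ g) =
      algebraMap A⟦X⟧ A⸨X⸩ (PowerSeries.derivative A g) := by
  ext i
  rw [LaurentSeries.derivative_apply, LaurentSeries.hasseDeriv_coeff, LaurentSeries.coe_algebraMap,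
    PowerSeries.coeff_coe, PowerSeries.coeff_coe]
  rcases lt_trichotomy i (-1) with hi | rfl | hi
  · rw [if_pos (by simp; omega), if_pos (by omega), smul_zero]
  · simp
  · obtain ⟨n, rfl⟩ := Int.eq_ofNat_of_zero_le (show 0 ≤ i by omega)
    rw [if_neg (by simp; omega), if_neg (by omega), PowerSeries.coeff_derivative]
    have : ((n : ℤ) + ((1 : ℕ) : ℤ)).natAbs = n + 1 := by omega
    rw [this]
    simp [mul_comm]

theorem nabla_smul (P : FlatSection.{u} k) (g : P.A⟦X⟧) (v : P.V) :
    P.nabla (g • v) = PowerSeries.derivative P.A g • v + g • P.nabla v := by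
  rw [← coe_smul, P.leibniz, derivative_coe, coe_smul, coe_smul]

/-! ### The map to `𝔹 𝔏⁺𝔾_m` -/

variable (k) in
/-- The morphism `𝒵 → 𝔹 𝔏⁺𝔾_m` that remembers the line bundle on the disc. -/
def toDiscLine : FlatSection.{u} k ⥤ DiscLine.{u} k where
  obj P :=
    { A := P.A
      N := P.L }
  map {P Q} f :=
    { base := f.base
      map := AddMonoidHom.mk' (fun v => (⟨f.map v, f.map_mem v.2⟩ : Q.L)) fun v w => by
        ext; simp
      map_smul := fun g v => by ext; simp [f.map_smul]
      span_range := by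
        apply Submodule.map_injective_of_injective Q.L.injective_subtype
        rw [Submodule.map_span, Submodule.map_top, Submodule.range_subtype, ← Set.range_comp]
        refine Eq.trans ?_ f.span_map
        congr 1
        ext v
        simp }

/-! ### The evaluation map to `C / 𝔾_m` -/

section Fiber

variable (A : Type u) [CommRing A] (N : Type u) [AddCommGroup N] [Module A⟦X⟧ N]

/-- The fibre `N / tN` at the base point `t = 0` of the disc. -/
abbrev Fiber : Type u :=
  N ⧸ (Ideal.span {(PowerSeries.X : A⟦X⟧)} • ⊤ : Submodule A⟦X⟧ N)

instance invertible_fiber [Module A N] [IsScalarTower A A⟦X⟧ N] [Module.Invertible A⟦X⟧ N] :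
    Module.Invertible A (Fiber A N) := by
  let _ : Algebra A⟦X⟧ A := (PowerSeries.constantCoeff (R := A)).toAlgebra
  have hmap : ∀ g : A⟦X⟧, algebraMap A⟦X⟧ A g = PowerSeries.constantCoeff g := fun _ => rfl
  have tower : IsScalarTower A A⟦X⟧ A := IsScalarTower.of_algebraMap_eq fun a => by
    rw [hmap]; simp
  have hker : (Ideal.span {(PowerSeries.X : A⟦X⟧)} : Submodule A⟦X⟧ A⟦X⟧) =
      LinearMap.ker (Algebra.linearMap A⟦X⟧ A) := by
    ext g
    rw [Ideal.mem_span_singleton, PowerSeries.X_dvd_iff, LinearMap.mem_ker]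
    rfl
  let q : (A⟦X⟧ ⧸ Ideal.span {(PowerSeries.X : A⟦X⟧)}) ≃ₗ[A⟦X⟧] A :=
    (Submodule.quotEquivOfEq _ _ hker).trans
      ((Algebra.linearMap A⟦X⟧ A).quotKerEquivOfSurjective fun a =>
        ⟨PowerSeries.C a, by simp [hmap]⟩)
  let e₀ : Fiber A N ≃ₗ[A⟦X⟧] A ⊗[A⟦X⟧] N :=
    (TensorProduct.quotTensorEquivQuotSMul N _).symm ≪≫ₗ TensorProduct.congr q (.refl _ _)
  exact Module.Invertible.congr (e₀.restrictScalars A).symm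

theorem fiber_mk_eq_zero {x : N} :
    (Submodule.Quotient.mk x : Fiber A N) = 0 ↔ ∃ w : N, (PowerSeries.X : A⟦X⟧) • w = x := by
  rw [Submodule.Quotient.mk_eq_zero, Submodule.ideal_span_singleton_smul,
    Submodule.mem_smul_pointwise_iff_exists]
  simp

/-- A linear endomorphism of the line `N / tN` is multiplication by a unique scalar. -/
theorem existsUnique_scalar [Module A N] [IsScalarTower A A⟦X⟧ N] [Module.Invertible A⟦X⟧ N]
    (D : N →ₗ[A] N)
    (hD : ∀ w : N, ∃ w' : N, (PowerSeries.X : A⟦X⟧) • w' = D ((PowerSeries.X : A⟦X⟧) • w)) :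
    ∃! y : A, ∀ v : N, ∃ w : N, D v = y • v + (PowerSeries.X : A⟦X⟧) • w := by
  let p : Submodule A⟦X⟧ N := Ideal.span {(PowerSeries.X : A⟦X⟧)} • ⊤
  have mem_p : ∀ x : N, x ∈ p ↔ ∃ w : N, (PowerSeries.X : A⟦X⟧) • w = x := fun x =>
    (Submodule.Quotient.mk_eq_zero p).symm.trans (fiber_mk_eq_zero A N)
  have hD' : p.restrictScalars A ≤ (p.restrictScalars A).comap D := by
    intro x hx
    obtain ⟨w, rfl⟩ := (mem_p x).1 hx
    exact (mem_p _).2 (hD w)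
  let E₀ := Submodule.mapQ _ _ D hD'
  let eq := Submodule.Quotient.restrictScalarsEquiv A p
  let E : Module.End A (Fiber A N) := eq.toLinearMap ∘ₗ E₀ ∘ₗ eq.symm.toLinearMap
  have hE : ∀ v : N, E (Submodule.Quotient.mk v) = Submodule.Quotient.mk (D v) := fun v => rfl
  have key : ∀ y : A, (∀ v : N, ∃ w : N, D v = y • v + (PowerSeries.X : A⟦X⟧) • w) ↔
      Module.toModuleEnd A (S := A) (Fiber A N) y = E := by
    intro y
    have h1 : ∀ v : N, Module.toModuleEnd A (S := A) (Fiber A N) y (Submodule.Quotient.mk v) =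
      Submodule.Quotient.mk (y • v) := fun v => rfl
    constructor
    · intro h
      refine LinearMap.ext fun x => ?_
      obtain ⟨v, rfl⟩ := Submodule.Quotient.mk_surjective _ x
      obtain ⟨w, h⟩ := h v
      rw [hE, h1, eq_comm, ← sub_eq_zero, ← Submodule.Quotient.mk_sub, fiber_mk_eq_zero]
      exact ⟨w, by rw [h]; simp⟩
    · intro h v
      have h2 := hE v
      rw [← h, h1, eq_comm, ← sub_eq_zero, ← Submodule.Quotient.mk_sub, fiber_mk_eq_zero] at h2
      obtain ⟨w, hw⟩ := h2
      exact ⟨w, by rw [hw]; simp⟩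
  obtain ⟨y, hy⟩ := (Module.Invertible.toModuleEnd_bijective A (Fiber A N)).2 E
  exact ⟨y, (key y).2 hy, fun z hz =>
    (Module.Invertible.toModuleEnd_bijective A (Fiber A N)).1 (((key z).1 hz).trans hy.symm)⟩

end Fiber

theorem C_smul (P : FlatSection.{u} k) (a : P.A) (v : P.V) :
    (PowerSeries.C a : P.A⟦X⟧) • v = a • v :=
  algebraMap_smul (R := P.A) P.A⟦X⟧ a v

theorem nabla_base_smul (P : FlatSection.{u} k) (a : P.A) (v : P.V) :
    P.nabla (a • v) = a • P.nabla v := by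
  rw [← C_smul, nabla_smul, PowerSeries.derivative_C, zero_smul, zero_add, C_smul]

theorem Hom.map_base_smul {P Q : FlatSection.{u} k} (f : Hom P Q) (a : P.A) (v : P.V) :
    f.map (a • v) = f.base a • f.map v := by
  rw [← C_smul, f.map_smul, PowerSeries.map_C, ← C_smul]
  rfl

/-- `y` is the leading coefficient of the connection `∇ = d - ω`, i.e. the coefficient of
`t⁻ⁿ dt` in `ω`: the map `- tⁿ ∇` acts on the fibre `L / tL` as multiplication by `y`. -/
def IsLeadingCoeff (n : ℕ) (P : FlatSection.{u} k) (y : P.A) : Prop :=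
  ∀ v ∈ P.L, ∃ w ∈ P.L,
    -((PowerSeries.X ^ n : P.A⟦X⟧) • P.nabla v) = y • v + (PowerSeries.X : P.A⟦X⟧) • w

theorem existsUnique_isLeadingCoeff {n : ℕ} (hn : 0 < n) (P : FlatSection.{u} k)
    (hP : PoleLE n P) : ∃! y : P.A, IsLeadingCoeff n P y := by
  have hsm : ∀ (a : P.A) (x : P.V), (PowerSeries.X ^ n : P.A⟦X⟧) • a • x =
      a • (PowerSeries.X ^ n : P.A⟦X⟧) • x := fun a x => by
    rw [← C_smul, smul_comm, C_smul]
  let D : P.L →ₗ[P.A] P.L :=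
    { toFun := fun v => ⟨-((PowerSeries.X ^ n : P.A⟦X⟧) • P.nabla v), P.L.neg_mem (hP v v.2)⟩
      map_add' := fun v w => by ext; simp [add_comm]
      map_smul' := fun a v => by
        ext
        change -((PowerSeries.X ^ n : P.A⟦X⟧) • P.nabla (a • (v : P.V))) =
          a • -((PowerSeries.X ^ n : P.A⟦X⟧) • P.nabla v)
        rw [nabla_base_smul, hsm, smul_neg] }
  obtain ⟨y, hy, huniq⟩ := existsUnique_scalar P.A P.L D fun w => by
    obtain ⟨m, rfl⟩ : ∃ m, n = m + 1 := ⟨n - 1, by omega⟩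
    refine ⟨-((PowerSeries.X ^ m : P.A⟦X⟧) • w) + D w, ?_⟩
    ext
    change (PowerSeries.X : P.A⟦X⟧) • (-((PowerSeries.X ^ m : P.A⟦X⟧) • (w : P.V)) +
      -((PowerSeries.X ^ (m + 1) : P.A⟦X⟧) • P.nabla w)) =
      -((PowerSeries.X ^ (m + 1) : P.A⟦X⟧) • P.nabla ((PowerSeries.X : P.A⟦X⟧) • (w : P.V)))
    rw [nabla_smul, PowerSeries.derivative_X, one_smul, smul_add, smul_add, smul_neg, smul_neg,
      neg_add, smul_smul, smul_smul, smul_smul, ← pow_succ', ← pow_succ, ← pow_succ']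
  refine ⟨y, fun v hv => ?_, fun z hz => huniq z fun v => ?_⟩
  · obtain ⟨w, hw⟩ := hy ⟨v, hv⟩
    exact ⟨w, w.2, congrArg Subtype.val hw⟩
  · obtain ⟨w, hw, h⟩ := hz v v.2
    exact ⟨⟨w, hw⟩, Subtype.ext h⟩

/-- The leading coefficient (of degree `-n`) of the connection. -/
def leadingCoeff {n : ℕ} (hn : 0 < n) (P : FlatSection.{u} k) (hP : PoleLE n P) : P.A :=
  (existsUnique_isLeadingCoeff hn P hP).choose

theorem isLeadingCoeff_leadingCoeff {n : ℕ} (hn : 0 < n) (P : FlatSection.{u} k)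
    (hP : PoleLE n P) : IsLeadingCoeff n P (leadingCoeff hn P hP) :=
  (existsUnique_isLeadingCoeff hn P hP).choose_spec.1

theorem leadingCoeff_eq {n : ℕ} (hn : 0 < n) (P : FlatSection.{u} k) (hP : PoleLE n P) {y : P.A}
    (hy : IsLeadingCoeff n P y) : leadingCoeff hn P hP = y :=
  ((existsUnique_isLeadingCoeff hn P hP).choose_spec.2 y hy).symm

theorem leadingCoeff_smul_s {n : ℕ} (hn : 0 < n) (P : FlatSection.{u} k) (hP : PoleLE n P) :
    leadingCoeff hn P hP • (Submodule.Quotient.mk ⟨P.s, P.s_mem⟩ : Fiber P.A P.L) = 0 := by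
  obtain ⟨w, hw, h⟩ := isLeadingCoeff_leadingCoeff hn P hP P.s P.s_mem
  change (Submodule.Quotient.mk (leadingCoeff hn P hP • ⟨P.s, P.s_mem⟩) : Fiber P.A P.L) = 0
  rw [fiber_mk_eq_zero]
  refine ⟨⟨-w, P.L.neg_mem hw⟩, ?_⟩
  ext
  change (PowerSeries.X : P.A⟦X⟧) • (-w) = leadingCoeff hn P hP • P.s
  rw [P.nabla_s, smul_zero, neg_zero] at h
  rw [smul_neg, eq_comm, ← add_eq_zero_iff_eq_neg]
  exact h.symm

theorem base_leadingCoeff {n : ℕ} (hn : 0 < n) {P Q : FlatSection.{u} k} (hP : PoleLE n P)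
    (hQ : PoleLE n Q) (f : Hom P Q) : f.base (leadingCoeff hn P hP) = leadingCoeff hn Q hQ := by
  refine (leadingCoeff_eq hn Q hQ fun v hv => ?_).symm
  rw [← f.span_map] at hv
  induction hv using Submodule.span_induction with
  | mem x hx =>
    obtain ⟨v, hv, rfl⟩ := hx
    obtain ⟨w, hw, h⟩ := isLeadingCoeff_leadingCoeff hn P hP v hv
    refine ⟨f.map w, f.map_mem hw, ?_⟩
    have h2 := congrArg f.map h
    simpa [f.map_smul, f.map_nabla, f.map_base_smul] using h2
  | zero => exact ⟨0, Q.L.zero_mem, by simp⟩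
  | add x y _ _ hx hy =>
    obtain ⟨a, ha, hx⟩ := hx
    obtain ⟨b, hb, hy⟩ := hy
    refine ⟨a + b, Q.L.add_mem ha hb, ?_⟩
    rw [map_add, smul_add, neg_add, hx, hy, smul_add, smul_add]
    abel
  | smul g x hx' hx =>
    obtain ⟨a, ha, hx⟩ := hx
    obtain ⟨m, rfl⟩ : ∃ m, n = m + 1 := ⟨n - 1, by omega⟩
    rw [f.span_map] at hx'
    refine ⟨g • a - (PowerSeries.X ^ m * PowerSeries.derivative Q.A g) • x,
      Q.L.sub_mem (Q.L.smul_mem _ ha) (Q.L.smul_mem _ hx'), ?_⟩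
    rw [nabla_smul, smul_add, smul_comm _ g, neg_add, ← smul_neg g, hx, smul_add, smul_sub,
      smul_comm g, ← C_smul, smul_comm g, C_smul]
    simp only [smul_smul, ← mul_assoc, ← pow_succ']
    abel

/-- The map `L / tL → L' / tL'` induced by an arrow. -/
def fiberMap {P Q : FlatSection.{u} k} (f : Hom P Q) : Fiber P.A P.L →+ Fiber Q.A Q.L :=
  (Submodule.liftQ _
    ({ toFun := fun v => Submodule.Quotient.mk ⟨f.map v, f.map_mem v.2⟩
       map_add' := fun v w => by
        rw [← Submodule.Quotient.mk_add]
        congr 1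
        ext
        simp
       map_smul' := fun g v => by
        rw [← Submodule.Quotient.mk_smul]
        congr 1
        ext
        simp [f.map_smul] } :
      P.L →ₛₗ[PowerSeries.map (f.base : P.A →+* Q.A)] Fiber Q.A Q.L) (by
    intro v hv
    rw [← Submodule.Quotient.mk_eq_zero, fiber_mk_eq_zero] at hv
    obtain ⟨w, rfl⟩ := hv
    refine (fiber_mk_eq_zero _ _).2 ⟨⟨f.map w, f.map_mem w.2⟩, ?_⟩
    ext
    simp [f.map_smul])).toAddMonoidHom

theorem fiberMap_mk {P Q : FlatSection.{u} k} (f : Hom P Q) (v : P.L) :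
    fiberMap f (Submodule.Quotient.mk v) = Submodule.Quotient.mk ⟨f.map v, f.map_mem v.2⟩ := rfl

theorem fiberMap_smul {P Q : FlatSection.{u} k} (f : Hom P Q) (a : P.A) (x : Fiber P.A P.L) :
    fiberMap f (a • x) = f.base a • fiberMap f x := by
  obtain ⟨v, rfl⟩ := Submodule.Quotient.mk_surjective _ x
  rw [← Submodule.Quotient.mk_smul, fiberMap_mk, fiberMap_mk, ← Submodule.Quotient.mk_smul]
  exact congrArg _ (Subtype.ext (f.map_base_smul a v))

theorem fiberMap_s {P Q : FlatSection.{u} k} (f : Hom P Q) :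
    fiberMap f (Submodule.Quotient.mk ⟨P.s, P.s_mem⟩) = Submodule.Quotient.mk ⟨Q.s, Q.s_mem⟩ := by
  rw [fiberMap_mk]
  exact congrArg _ (Subtype.ext f.map_s)

theorem span_range_fiberMap {P Q : FlatSection.{u} k} (f : Hom P Q) :
    Submodule.span Q.A (Set.range (fiberMap f)) = ⊤ := by
  rw [eq_top_iff]
  rintro x -
  obtain ⟨⟨v, hv⟩, rfl⟩ := Submodule.Quotient.mk_surjective _ x
  have hv' := hv
  rw [← f.span_map] at hv'
  induction hv' using Submodule.span_induction with
  | mem y hy =>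
    obtain ⟨w, hw, rfl⟩ := hy
    exact Submodule.subset_span ⟨Submodule.Quotient.mk ⟨w, hw⟩, rfl⟩
  | zero => exact Submodule.zero_mem _
  | add y z hy hz ihy ihz =>
    rw [f.span_map] at hy hz
    exact Submodule.add_mem _ (ihy hy) (ihz hz)
  | smul g y hy ih =>
    rw [f.span_map] at hy
    have h := Submodule.smul_mem _ (PowerSeries.constantCoeff g) (ih hy)
    convert h using 1
    rw [← sub_eq_zero]
    change (Submodule.Quotient.mk ((⟨g • y, hv⟩ : Q.L) -
      PowerSeries.constantCoeff g • (⟨y, hy⟩ : Q.L)) : Fiber Q.A Q.L) = 0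
    rw [fiber_mk_eq_zero]
    refine ⟨(PowerSeries.mk fun p => PowerSeries.coeff (p + 1) g : Q.A⟦X⟧) • ⟨y, hy⟩, ?_⟩
    ext
    change (PowerSeries.X : Q.A⟦X⟧) • (PowerSeries.mk fun p => PowerSeries.coeff (p + 1) g) • y =
      g • y - PowerSeries.constantCoeff g • y
    rw [smul_smul, ← C_smul, ← sub_smul, ← PowerSeries.sub_const_eq_X_mul_shift]

/-! ### Twisting by the base point -/

/-- The line bundle `L(1) = t⁻¹ L` of sections of `L` with a pole of order at most one at `t = 0`. -/
def twistLattice (P : FlatSection.{u} k) : Submodule P.A⟦X⟧ P.V :=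
  P.L.comap (LinearMap.lsmul P.A⟦X⟧ P.V PowerSeries.X)

theorem mem_twistLattice {P : FlatSection.{u} k} {v : P.V} :
    v ∈ P.twistLattice ↔ (PowerSeries.X : P.A⟦X⟧) • v ∈ P.L := Iff.rfl

theorem le_twistLattice (P : FlatSection.{u} k) : P.L ≤ P.twistLattice :=
  fun _ hv => P.L.smul_mem _ hv

instance (P : FlatSection.{u} k) : Module.Invertible P.A⟦X⟧ P.twistLattice :=
  Module.Invertible.congr (LinearEquiv.ofBijective
    ((LinearMap.lsmul P.A⟦X⟧ P.V PowerSeries.X).restrict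
      (p := P.twistLattice) (q := P.L) fun _ hv => hv)
    ⟨fun v w h => Subtype.ext (P.X_smul_injective (congrArg Subtype.val h)), fun v => by
      obtain ⟨w, hw⟩ := P.exists_X_smul v
      exact ⟨⟨w, by rw [mem_twistLattice, hw]; exact v.2⟩, Subtype.ext hw⟩⟩).symm

/-- `(L, ∇, s) ↦ (L(1), ∇, s)`. -/
abbrev twistObj (P : FlatSection.{u} k) : FlatSection.{u} k where
  A := P.A
  V := P.V
  L := P.twistLattice
  exists_pow_smul_mem v := (P.exists_pow_smul_mem v).imp fun _ h => P.le_twistLattice h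
  nabla := P.nabla
  leibniz := P.leibniz
  s := P.s
  s_mem := P.le_twistLattice P.s_mem
  nabla_s := P.nabla_s

variable (k) in
/-- The morphism `𝒵 → 𝒵`, `(L, ∇, s) ↦ (L(1), ∇, s)`. -/
def twist : FlatSection.{u} k ⥤ FlatSection.{u} k where
  obj P := P.twistObj
  map {P Q} f :=
    { base := f.base
      map := f.map
      map_smul := f.map_smul
      span_map := by
        apply le_antisymm
        · rw [Submodule.span_le]
          rintro _ ⟨v, hv, rfl⟩
          change (PowerSeries.X : Q.A⟦X⟧) • f.map v ∈ Q.L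
          have := f.map_mem hv
          rw [LinearMap.lsmul_apply, f.map_smul, PowerSeries.map_X] at this
          exact this
        · intro v hv
          have hv' : (PowerSeries.X : Q.A⟦X⟧) • v ∈
              Submodule.span Q.A⟦X⟧ (f.map '' (P.L : Set P.V)) := by
            rw [f.span_map]
            exact hv
          have hle : Submodule.span Q.A⟦X⟧ (f.map '' (P.L : Set P.V)) ≤
              (Submodule.span Q.A⟦X⟧ (f.map '' (P.twistLattice : Set P.V))).map
                (LinearMap.lsmul Q.A⟦X⟧ Q.V PowerSeries.X) := by
            rw [Submodule.span_le]
            rintro _ ⟨w, hw, rfl⟩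
            obtain ⟨w, rfl⟩ := P.exists_X_smul w
            refine ⟨f.map w, Submodule.subset_span ⟨w, hw, rfl⟩, ?_⟩
            rw [f.map_smul, PowerSeries.map_X]
            rfl
          obtain ⟨w, hw, h⟩ := hle hv'
          rwa [← Q.X_smul_injective h]
      map_nabla := f.map_nabla
      map_s := f.map_s }

theorem twist_poleLE {n : ℕ} (hn : 0 < n) (P : FlatSection.{u} k) (hP : PoleLE n P) :
    PoleLE n P.twistObj := by
  intro v hv
  have h := hP _ hv
  rw [LinearMap.lsmul_apply] at h
  rw [nabla_smul, PowerSeries.derivative_X, one_smul, smul_add] at h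
  obtain ⟨m, rfl⟩ : ∃ m, n = m + 1 := ⟨n - 1, by omega⟩
  have h1 : (PowerSeries.X ^ (m + 1) : P.A⟦X⟧) • v ∈ P.L := by
    rw [pow_succ, ← smul_smul]
    exact P.L.smul_mem _ hv
  have h2 := P.L.sub_mem h h1
  rw [add_sub_cancel_left, smul_comm] at h2
  exact h2

end FlatSection

open FlatSection

/-- The stack `𝒵^{≤ n}` of triples `(L, ∇, s)` such that `∇` has a pole of order at most `n`. -/
abbrev ZLE (n : ℕ) := (PoleLE (k := k) n).FullSubcategory

namespace ZLE

variable {n : ℕ}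

/-- The structure morphism `𝒵^{≤ n} → Spec k`. -/
def toRing (n : ℕ) : ZLE.{u} k n ⥤ CommAlgCat.{u} k where
  obj P := CommAlgCat.of k P.obj.A
  map f := CommAlgCat.ofHom f.hom.base

/-- For `n > 0`, the morphism `𝒵^{≤ n} → C / 𝔾_m` that sends `(L, ∇, s)` to the fibre `L / tL` with
the value of `s`, and the leading coefficient of `∇`. -/
def evalAxes (hn : 0 < n) : ZLE.{u} k n ⥤ AxesModGm.{u} k where
  obj P :=
    { A := P.obj.A
      M := Fiber P.obj.A P.obj.L
      m := Submodule.Quotient.mk ⟨P.obj.s, P.obj.s_mem⟩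
      y := leadingCoeff hn P.obj P.property
      smul_eq_zero := leadingCoeff_smul_s hn P.obj P.property }
  map {P Q} f :=
    { base := f.hom.base
      map := fiberMap f.hom
      map_smul := fiberMap_smul f.hom
      span_range := span_range_fiberMap f.hom
      map_m := fiberMap_s f.hom
      map_y := base_leadingCoeff hn P.property Q.property f.hom }
  map_id P := by
    refine AxesModGm.hom_ext rfl (AddMonoidHom.ext fun x => ?_)
    obtain ⟨v, rfl⟩ := Submodule.Quotient.mk_surjective _ x
    rfl
  map_comp f g := by
    refine AxesModGm.hom_ext rfl (AddMonoidHom.ext fun x => ?_)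
    obtain ⟨v, rfl⟩ := Submodule.Quotient.mk_surjective _ x
    rfl

/-- The inclusion `𝒵^{≤ n - 1} → 𝒵^{≤ n}`, for `n > 0`. -/
def incl (n : ℕ) : ZLE.{u} k (n - 1) ⥤ ZLE.{u} k n :=
  ObjectProperty.ιOfLE fun P hP v hv => by
    have h := P.L.smul_mem (PowerSeries.X ^ (n - (n - 1))) (hP v hv)
    rwa [smul_smul, ← pow_add, Nat.sub_add_cancel (Nat.sub_le n 1)] at h

/-- On `𝒵^{≤ n - 1}` the coefficient of degree `-n` vanishes: the composition
`𝒵^{≤ n - 1} → 𝒵^{≤ n} → C / 𝔾_m` factors through the `x`-axis. -/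
theorem eval_incl_y (hn : 0 < n) (P : ZLE.{u} k (n - 1)) :
    ((incl k n ⋙ evalAxes k hn).obj P).y = 0 := by
  obtain ⟨m, rfl⟩ : ∃ m, n = m + 1 := ⟨n - 1, by omega⟩
  refine leadingCoeff_eq hn P.obj ((incl k (m + 1)).obj P).property fun v hv => ⟨-((PowerSeries.X ^ m : P.obj.A⟦X⟧) • P.obj.nabla v),
    P.obj.L.neg_mem (P.property v hv), ?_⟩
  change -((PowerSeries.X ^ (m + 1) : P.obj.A⟦X⟧) • P.obj.nabla v) =
    (0 : P.obj.A) • v + (PowerSeries.X : P.obj.A⟦X⟧) • -((PowerSeries.X ^ m : P.obj.A⟦X⟧) •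
      P.obj.nabla v)
  rw [zero_smul, zero_add, smul_neg, smul_smul, ← pow_succ']

/-- For `n > 0`, the morphism `𝒵^{≤ n - 1} → 𝔸¹ / 𝔾_m` to the `x`-axis. -/
def toXAxis (hn : 0 < n) : ZLE.{u} k (n - 1) ⥤ AxesModGm.XAxis.{u} k :=
  ObjectProperty.lift _ (incl k n ⋙ evalAxes k hn) (eval_incl_y k hn)

/-- For `n > 0`, the morphism `ι : 𝒵^{≤ n} → 𝒵^{≤ n}`, `(L, ∇, s) ↦ (L(1), ∇, s)`. -/
def shift (hn : 0 < n) : ZLE.{u} k n ⥤ ZLE.{u} k n :=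
  (PoleLE n).lift ((PoleLE n).ι ⋙ twist k) fun P => twist_poleLE hn P.obj P.property

/-- As `s ∈ L = t L(1)`, the composition `𝒵^{≤ n} → 𝒵^{≤ n} → C / 𝔾_m` of `ι` with the evaluation map
factors through the `y`-axis. -/
theorem eval_shift_m (hn : 0 < n) (P : ZLE.{u} k n) :
    ((shift k hn ⋙ evalAxes k hn).obj P).m = 0 := by
  obtain ⟨w, hw⟩ := P.obj.exists_X_smul P.obj.s
  refine (fiber_mk_eq_zero P.obj.A P.obj.twistLattice).2 ⟨⟨w, ?_⟩, Subtype.ext hw⟩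
  rw [mem_twistLattice, hw]
  exact P.obj.s_mem

/-- For `n > 0`, the morphism `𝒵^{≤ n} → 𝔸¹ × 𝔹𝔾_m` to the `y`-axis, by which the composition
`𝒵^{≤ n} → 𝒵^{≤ n} → C / 𝔾_m` of `ι` with the evaluation map factors: it sends `(L, ∇, s)` to the
leading coefficient of `∇` with respect to `L(1)`, and the fibre of `L(1)`. -/
def toYAxis (hn : 0 < n) : ZLE.{u} k n ⥤ AxesModGm.YAxis.{u} k :=
  ObjectProperty.lift _ (shift k hn ⋙ evalAxes k hn) (eval_shift_m k hn)

/-- The morphism `𝒵^{≤ n} → 𝔹 𝔏⁺𝔾_m`. -/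
def toDiscLine (n : ℕ) : ZLE.{u} k n ⥤ DiscLine.{u} k :=
  (PoleLE n).ι ⋙ FlatSection.toDiscLine k

end ZLE

/-! ## The derived equalizer that defines `𝒵^{≤ n}` -/

namespace DerivedEqualizer

/-- Functions on `𝔏⁺𝔸¹ × 𝔏^{≤ n}𝔸¹dt`: `inl i` is the coefficient `a i` of `g = ∑ a i tⁱ`, and `inr i`
is the coefficient `b i` of `ω = ∑ b i tⁱ⁻ⁿ dt`. -/
abbrev Source : Type u := MvPolynomial (ℕ ⊕ ℕ) k

/-- Functions on `𝔏^{≤ n}𝔸¹dt`: the `i`-th variable is the coefficient of `tⁱ⁻ⁿ dt`. -/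
abbrev Target : Type u := MvPolynomial ℕ k

/-- The map `(g, ω) ↦ dg`. -/
def dMap (n : ℕ) : Target k →ₐ[k] Source k :=
  MvPolynomial.aeval fun i =>
    if n ≤ i then (i - n + 1) • MvPolynomial.X (Sum.inl (i - n + 1)) else 0

/-- The map `(g, ω) ↦ gω`. -/
def mulMap : Target k →ₐ[k] Source k :=
  MvPolynomial.aeval fun i => ∑ p ∈ Finset.HasAntidiagonal.antidiagonal i,
    MvPolynomial.X (Sum.inl p.1) * MvPolynomial.X (Sum.inr p.2)

/-- The derived equalizer of the maps `(g, ω) ↦ dg` and `(g, ω) ↦ gω` from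
`X = 𝔏⁺𝔸¹ × 𝔏^{≤ n}𝔸¹dt` to `Y = 𝔏^{≤ n}𝔸¹dt`, i.e. the derived fibre product of `X` and the diagonal
`Y` over `Y × Y`, is classical. -/
def IsClassical (n : ℕ) : Prop :=
  TorIndependent
    ((Algebra.TensorProduct.productMap (dMap k n) (mulMap k) :
      Target k ⊗[k] Target k →ₐ[k] Source k) : Target k ⊗[k] Target k →+* Source k)
    ((Algebra.TensorProduct.lmul' k : Target k ⊗[k] Target k →ₐ[k] Target k) :
      Target k ⊗[k] Target k →+* Target k)

/-- The stack `𝒵^{≤ n}` of triples `(L, ∇, s)` is the quotient by `𝔏⁺𝔾_m` of the equalizer of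
`(g, ω) ↦ dg` and `(g, ω) ↦ gω`.  Namely, the universal `𝔏⁺𝔾_m`-torsor
`𝒵^{≤ n} ×_{𝔹 𝔏⁺𝔾_m} Spec k` is the affine scheme whose functions are those on
`𝔏⁺𝔸¹ × 𝔏^{≤ n}𝔸¹dt` modulo the equations `dg = gω`, in such a way that `(g, ω)` corresponds to the
trivial line bundle `A[[t]] e` with `∇ = d - ω` and `s = g e`. -/
def IsTorsor (n : ℕ) : Prop :=
  ∃ T : StructuredArrow (DiscLine.trivial.{u} k) (ZLE.toDiscLine k n), Nonempty (IsInitial T) ∧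
    ∃ α : Source k →ₐ[k] T.right.obj.A, Function.Surjective α ∧
      RingHom.ker α = Ideal.span (Set.range fun i : ℕ =>
        dMap k n (MvPolynomial.X i) - mulMap k (MvPolynomial.X i)) ∧
      ∃ e : T.right.obj.L, T.hom.map (1 : k⟦X⟧) = e ∧
        T.right.obj.s = (PowerSeries.mk fun i => α (MvPolynomial.X (Sum.inl i))) • (e : T.right.obj.V) ∧
        (PowerSeries.X ^ n : T.right.obj.A⟦X⟧) • T.right.obj.nabla e =
          -((PowerSeries.mk fun i => α (MvPolynomial.X (Sum.inr i))) • (e : T.right.obj.V))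

end DerivedEqualizer

end FlatAxes

end

/-!
# The stack of flat sections and its flatness along the axes

Write `g = ∑ aᵢ tⁱ` and `ω = t⁻ⁿ ∑ bᵢ tⁱ dt`.  Everything rests on the coefficients of
`tⁿ g' - g ∑ bᵢ tⁱ`, the equations of the derived equalizer.  They form a regular sequence in the
polynomial ring on all `aᵢ` and `bᵢ` (`weaklyRegularMod_relation`).  For `n > 0` the first of them
is `-a₀ b₀`.  On the locus `a₀ = 0` the substitution `g = t g₁`, `ω = ω₁ + dt/t` turns the remaining
ones into the same equations for `(g₁, ω₁)`; on the locus `b₀ = 0` they are the equations for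
`n - 1`.
Since `R ⧸ (a₀ b₀)` is an extension of `R ⧸ (a₀)` by `R ⧸ (b₀)`, an induction on the length of the
sequence reduces the claim to `n = 0`, where the gauge transformation by `exp (∫ ω)`, available in
characteristic zero, makes the equation into `dg = 0`.  Hence the derived equalizer is classical
(`isClassical`).  The same argument shows that in the quotient by these equations, and by the `bᵢ`
with `i ≥ N` for some `N ≥ n`, the annihilators of `a₀` and `b₀` are generated by `b₀` and `a₀`
(`isExactPair_universal`).

A module over `R` on which the kernels of `x` and `y` are the images of `y` and `x` has syzygies of
the same kind, if this also holds on `R`; so it has no higher `Tor` with `R ⧸ (x)` and `R ⧸ (y)`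
(`torIndependent_of_isExactPair`).  This applies over the coordinate ring of `C`.

An object of `𝒵^{≤ n}` with a generator of the fibre of its line bundle at `t = 0` has a unique
trivialization that extends the generator and makes `ω` a combination of `t⁻ⁿ dt, …, t⁻¹ dt`, by
solving `f' = c f` (`exists_normalized_frame`, `normalized_frame_unique`).  So the base change of
`𝒵^{≤ n}` to `C` is the spectrum of the universal ring with `bᵢ = 0` for `i ≥ n`, and its map to `C`
is `(a₀, b₀)` (`exists_initial_evalAxes`).  This gives flatness along the axes
(`stackFlatAlongAxes`).

The inclusion of `𝒵^{≤ n - 1}` and the twist `ι` are fully faithful. Their images are the loci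
where the leading coefficient vanishes and where the section vanishes at `t = 0`; on the latter
the section lies in `tL`, and `L` can be replaced by `tL`. Hence the two squares are Cartesian,
and they are derived Cartesian by the vanishing of `Tor` over the cover `C → C / 𝔾_m`. That this
is a flat cover, and stays one over `𝒵^{≤ n}`, follows from the faithful flatness of the universal
trivialization of a line bundle (`exists_trivialization`). Finally, the base change of `ι` is the
vanishing locus of the section at `t = 0` (`exists_initial_shift`), a closed subscheme; over the
cover it is `{a₀ = 0}`, with the periodic resolution with differentials `a₀, b₀, a₀, …`, and
therefore `ι` is almost finitely presented.
-/

noncomputable section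

namespace FlatAxes

/-! ### Weakly regular sequences modulo an ideal -/

section WeaklyRegular

variable {R R' : Type*} [CommRing R] [CommRing R']

/-- The first `len` members of the sequence `f` form a weakly regular sequence on `R ⧸ J`: each
`f m` is a non-zero-divisor modulo `J` and its predecessors. -/
def WeaklyRegularMod (J : Ideal R) (f : ℕ → R) (len : ℕ) : Prop :=
  ∀ m < len, ∀ c, f m * c ∈ J ⊔ Ideal.span (f '' Set.Iio m) → c ∈ J ⊔ Ideal.span (f '' Set.Iio m)

theorem sup_span_image_Iio_succ (J : Ideal R) (f : ℕ → R) (m : ℕ) :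
    J ⊔ Ideal.span (f '' Set.Iio (m + 1)) =
      J ⊔ Ideal.span (f '' Set.Iio m) ⊔ Ideal.span {f m} := by
  have : Set.Iio (m + 1) = insert m (Set.Iio m) := by
    ext i
    simp only [Set.mem_Iio, Set.mem_insert_iff]
    omega
  rw [this, Set.image_insert_eq, Ideal.span_insert, sup_comm (Ideal.span {f m}), sup_assoc]

theorem sup_span_image_Iio_succ' (J : Ideal R) (f : ℕ → R) (m : ℕ) :
    J ⊔ Ideal.span (f '' Set.Iio (m + 1)) =
      J ⊔ Ideal.span {f 0} ⊔ Ideal.span ((fun i => f (i + 1)) '' Set.Iio m) := by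
  have : f '' Set.Iio (m + 1) = insert (f 0) ((fun i => f (i + 1)) '' Set.Iio m) := by
    ext x
    simp only [Set.mem_image, Set.mem_Iio, Set.mem_insert_iff]
    constructor
    · rintro ⟨i, hi, rfl⟩
      cases i with
      | zero => exact Or.inl rfl
      | succ i => exact Or.inr ⟨i, by omega, rfl⟩
    · rintro (rfl | ⟨i, hi, rfl⟩)
      · exact ⟨0, by omega, rfl⟩
      · exact ⟨i + 1, by omega, rfl⟩
  rw [this, Ideal.span_insert, sup_assoc]

theorem mem_sup_span_singleton' {J : Ideal R} {x c : R} :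
    c ∈ J ⊔ Ideal.span {x} ↔ ∃ d, c - x * d ∈ J := by
  rw [Submodule.mem_sup]
  constructor
  · rintro ⟨a, ha, b, hb, rfl⟩
    obtain ⟨d, rfl⟩ := Ideal.mem_span_singleton'.1 hb
    exact ⟨d, by rwa [mul_comm d, add_sub_cancel_right]⟩
  · rintro ⟨d, hd⟩
    exact ⟨_, hd, x * d, Ideal.mul_mem_right _ _ (Ideal.mem_span_singleton_self x), by ring⟩

/-- If `f` is weakly regular modulo `(J, x)` and `x` is a non-zero-divisor modulo `J`, then
multiplication by `x` embeds `R ⧸ (J, y, f₀, …, fₘ₋₁)` into `R ⧸ (J, xy, f₀, …, fₘ₋₁)`. -/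
theorem WeaklyRegularMod.mem_of_mul_mem {J : Ideal R} {f : ℕ → R} {len : ℕ} {x : R} (y : R)
    (hx : ∀ c, x * c ∈ J → c ∈ J) (h : WeaklyRegularMod (J ⊔ Ideal.span {x}) f len) {m : ℕ}
    (hm : m ≤ len) {c : R} (hc : x * c ∈ J ⊔ Ideal.span {x * y} ⊔ Ideal.span (f '' Set.Iio m)) :
    c ∈ J ⊔ Ideal.span {y} ⊔ Ideal.span (f '' Set.Iio m) := by
  induction m generalizing c with
  | zero =>
    simp only [Set.Iio_zero_eq_empty, Set.image_empty, Ideal.span_empty, sup_bot_eq] at hc ⊢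
    rw [mem_sup_span_singleton'] at hc ⊢
    obtain ⟨d, hd⟩ := hc
    exact ⟨d, hx _ (by convert hd using 1; ring)⟩
  | succ m ih =>
    rw [sup_span_image_Iio_succ, mem_sup_span_singleton'] at hc ⊢
    obtain ⟨d, hd⟩ := hc
    -- modulo `x` the coefficient `d` of `f m` is killed by `f m`
    have hd' : d ∈ J ⊔ Ideal.span {x} ⊔ Ideal.span (f '' Set.Iio m) := by
      refine h m (by omega) d ?_
      have h1 : J ⊔ Ideal.span {x * y} ⊔ Ideal.span (f '' Set.Iio m) ≤
          J ⊔ Ideal.span {x} ⊔ Ideal.span (f '' Set.Iio m) := by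
        gcongr J ⊔ ?_ ⊔ _
        exact Ideal.span_singleton_le_span_singleton.2 (dvd_mul_right x y)
      have h2 : x * c ∈ J ⊔ Ideal.span {x} ⊔ Ideal.span (f '' Set.Iio m) :=
        Ideal.mul_mem_right _ _ (le_sup_left (a := J ⊔ Ideal.span {x})
          (le_sup_right (a := J) (Ideal.mem_span_singleton_self x)))
      convert sub_mem h2 (h1 hd) using 1
      ring
    rw [sup_right_comm, mem_sup_span_singleton'] at hd'
    obtain ⟨e, he⟩ := hd'
    refine ⟨e, ih (by omega) ?_⟩
    have h3 : J ⊔ Ideal.span (f '' Set.Iio m) ≤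
      J ⊔ Ideal.span {x * y} ⊔ Ideal.span (f '' Set.Iio m) := sup_le_sup_right le_sup_left _
    convert add_mem hd (Ideal.mul_mem_left _ (f m) (h3 he)) using 1
    ring

/-- If `f` is weakly regular modulo `x` and modulo `y`, then it is so modulo `xy`, because
`R ⧸ (xy)` is an extension of `R ⧸ (x)` by `R ⧸ (y)`. -/
theorem WeaklyRegularMod.sup_span_mul {J : Ideal R} {f : ℕ → R} {len : ℕ} {x y : R}
    (hx : ∀ c, x * c ∈ J → c ∈ J) (h₁ : WeaklyRegularMod (J ⊔ Ideal.span {x}) f len)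
    (h₂ : WeaklyRegularMod (J ⊔ Ideal.span {y}) f len) :
    WeaklyRegularMod (J ⊔ Ideal.span {x * y}) f len := by
  intro m hm c hc
  have hle : J ⊔ Ideal.span {x * y} ⊔ Ideal.span (f '' Set.Iio m) ≤
      J ⊔ Ideal.span {x} ⊔ Ideal.span (f '' Set.Iio m) := by
    gcongr J ⊔ ?_ ⊔ _
    exact Ideal.span_singleton_le_span_singleton.2 (dvd_mul_right x y)
  have h3 : J ⊔ Ideal.span (f '' Set.Iio m) ≤
    J ⊔ Ideal.span {x * y} ⊔ Ideal.span (f '' Set.Iio m) := sup_le_sup_right le_sup_left _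
  have hc' := h₁ m hm c (hle hc)
  rw [sup_right_comm, mem_sup_span_singleton'] at hc'
  obtain ⟨d, hd⟩ := hc'
  have hd2 : x * (f m * d) ∈ J ⊔ Ideal.span {x * y} ⊔ Ideal.span (f '' Set.Iio m) := by
    convert sub_mem hc (Ideal.mul_mem_left _ (f m) (h3 hd)) using 1
    ring
  have hd3 := h₂ m hm d (h₁.mem_of_mul_mem y hx hm.le hd2)
  rw [sup_right_comm, mem_sup_span_singleton'] at hd3
  obtain ⟨e, he⟩ := hd3
  have h4 := add_mem (h3 hd) (Ideal.mul_mem_left _ x (h3 he))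
  have h5 : x * y * e ∈ J ⊔ Ideal.span {x * y} ⊔ Ideal.span (f '' Set.Iio m) :=
    Ideal.mul_mem_right _ _ (le_sup_left (a := J ⊔ Ideal.span {x * y})
          (le_sup_right (a := J) (Ideal.mem_span_singleton_self _)))
  convert add_mem h4 h5 using 1
  ring

theorem WeaklyRegularMod.cons {J : Ideal R} {f : ℕ → R} {len : ℕ}
    (h0 : ∀ c, f 0 * c ∈ J → c ∈ J)
    (h : WeaklyRegularMod (J ⊔ Ideal.span {f 0}) (fun i => f (i + 1)) len) :
    WeaklyRegularMod J f (len + 1) := by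
  intro m hm c hc
  cases m with
  | zero =>
    simp only [Set.Iio_zero_eq_empty, Set.image_empty, Ideal.span_empty, sup_bot_eq] at hc ⊢
    exact h0 c hc
  | succ m =>
    rw [sup_span_image_Iio_succ'] at hc ⊢
    exact h m (by omega) c hc

theorem mem_sup_ker_iff {φ : R →+* R'} (hφ : Function.Surjective φ) {I : Ideal R} {x : R} :
    x ∈ I ⊔ RingHom.ker φ ↔ φ x ∈ I.map φ := by
  rw [← Ideal.mem_comap, Ideal.comap_map_of_surjective φ hφ]
  rfl

theorem WeaklyRegularMod.of_surjective {φ : R →+* R'} (hφ : Function.Surjective φ) {J : Ideal R}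
    {f : ℕ → R} {len : ℕ} (h : WeaklyRegularMod (J.map φ) (fun i => φ (f i)) len) :
    WeaklyRegularMod (J ⊔ RingHom.ker φ) f len := by
  have key : ∀ m c, c ∈ J ⊔ RingHom.ker φ ⊔ Ideal.span (f '' Set.Iio m) ↔
      φ c ∈ J.map φ ⊔ Ideal.span ((fun i => φ (f i)) '' Set.Iio m) := by
    intro m c
    rw [sup_right_comm, mem_sup_ker_iff hφ, Ideal.map_sup, Ideal.map_span, Set.image_image]
  intro m hm c hc
  rw [key] at hc ⊢
  rw [map_mul] at hc
  exact h m hm _ hc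

theorem exists_mem_sup_span_Iio {J : Ideal R} {f : ℕ → R} {c : R}
    (hc : c ∈ J ⊔ Ideal.span (Set.range f)) : ∃ m, c ∈ J ⊔ Ideal.span (f '' Set.Iio m) := by
  have hsup : J ⊔ Ideal.span (Set.range f) = ⨆ m, (J ⊔ Ideal.span (f '' Set.Iio m)) := by
    apply le_antisymm
    · refine sup_le (le_trans le_sup_left (le_iSup (fun m => J ⊔ Ideal.span (f '' Set.Iio m)) 0)) ?_
      rw [Ideal.span_le]
      rintro _ ⟨i, rfl⟩
      exact (le_trans le_sup_right (le_iSup (fun m => J ⊔ Ideal.span (f '' Set.Iio m)) (i + 1)))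
        (Ideal.subset_span ⟨i, by simp, rfl⟩)
    · exact iSup_le fun m => sup_le_sup_left (Ideal.span_mono (Set.image_subset_range _ _)) _
  rw [hsup, Submodule.mem_iSup_of_directed] at hc
  · exact hc
  · refine Monotone.directed_le fun a b hab => ?_
    exact sup_le_sup_left (Ideal.span_mono (Set.image_mono (Set.Iio_subset_Iio hab))) _

/-- The annihilator of `x` modulo `(J, f)` is generated by `y`, if `f` begins with `± xy` and its
tail is regular modulo `(J, x)`. -/
theorem WeaklyRegularMod.mem_of_mul_mem_range {J : Ideal R} {f : ℕ → R} {x y : R}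
    (hx : ∀ c, x * c ∈ J → c ∈ J) (h0 : f 0 = -(x * y))
    (h : ∀ len, WeaklyRegularMod (J ⊔ Ideal.span {x}) (fun i => f (i + 1)) len) {c : R}
    (hc : x * c ∈ J ⊔ Ideal.span (Set.range f)) :
    c ∈ J ⊔ Ideal.span (Set.range f) ⊔ Ideal.span {y} := by
  obtain ⟨m, hm⟩ := exists_mem_sup_span_Iio hc
  have hm' : x * c ∈ J ⊔ Ideal.span (f '' Set.Iio (m + 1)) :=
    (sup_le_sup_left (Ideal.span_mono (Set.image_mono (Set.Iio_subset_Iio (by omega)))) _ :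
      J ⊔ Ideal.span (f '' Set.Iio m) ≤ J ⊔ Ideal.span (f '' Set.Iio (m + 1))) hm
  rw [sup_span_image_Iio_succ', h0, Ideal.span_singleton_neg] at hm'
  have h1 := (h m).mem_of_mul_mem y hx le_rfl hm'
  refine (?_ : J ⊔ Ideal.span {y} ⊔ Ideal.span ((fun i => f (i + 1)) '' Set.Iio m) ≤ _) h1
  rw [sup_right_comm]
  refine sup_le_sup_right (sup_le_sup_left (Ideal.span_mono ?_) _) _
  rintro _ ⟨i, -, rfl⟩
  exact ⟨i + 1, rfl⟩

end WeaklyRegular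

/-! ### The equation `f' = c f` for power series -/

section ODE

variable {A : Type*} [CommRing A] [Algebra ℚ A]

/-- The coefficients of the solution of `f' = c f`, `f(0) = 1`. -/
def expIntegralCoeff (c : A⟦X⟧) : ℕ → A
  | 0 => 1
  | n + 1 => ((n + 1 : ℚ)⁻¹) • ∑ i : Fin (n + 1),
      PowerSeries.coeff (n - i) c * expIntegralCoeff c i

/-- The solution `exp (∫ c)` of `f' = c f`, `f(0) = 1`. -/
def expIntegral (c : A⟦X⟧) : A⟦X⟧ := PowerSeries.mk (expIntegralCoeff c)

@[simp]
theorem constantCoeff_expIntegral (c : A⟦X⟧) :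
    PowerSeries.constantCoeff (expIntegral c) = 1 := by
  rw [← PowerSeries.coeff_zero_eq_constantCoeff_apply, expIntegral, PowerSeries.coeff_mk,
    expIntegralCoeff]

theorem derivative_expIntegral (c : A⟦X⟧) :
    PowerSeries.derivative A (expIntegral c) = c * expIntegral c := by
  ext n
  rw [PowerSeries.coeff_derivative, mul_comm c, PowerSeries.coeff_mul,
    Finset.Nat.sum_antidiagonal_eq_sum_range_succ (fun i j => PowerSeries.coeff i (expIntegral c) *
      PowerSeries.coeff j c), Finset.sum_range, expIntegral, PowerSeries.coeff_mk,
    expIntegralCoeff, smul_mul_assoc, mul_comm, ← smul_mul_assoc]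
  have : ((n + 1 : ℚ)⁻¹ • ((n : A) + 1)) = 1 := by
    have h : ((n : A) + 1) = algebraMap ℚ A (n + 1) := by simp
    rw [h, Algebra.smul_def, ← map_mul, inv_mul_cancel₀ (by positivity), map_one]
  rw [this, one_mul]
  exact Finset.sum_congr rfl fun i _ => by rw [PowerSeries.coeff_mk, mul_comm]

/-- A solution of `f' = c f` is determined by its value at `t = 0`. -/
theorem eq_zero_of_derivative_eq_mul {c f : A⟦X⟧} (h : PowerSeries.derivative A f = c * f)
    (h0 : PowerSeries.constantCoeff f = 0) : f = 0 := by
  ext n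
  rw [map_zero]
  induction n using Nat.strong_induction_on with
  | _ n ih =>
    cases n with
    | zero => simpa using h0
    | succ n =>
      have h1 := congrArg (PowerSeries.coeff n) h
      rw [PowerSeries.coeff_derivative, PowerSeries.coeff_mul, Finset.sum_eq_zero] at h1
      · have h2 : ((n : A) + 1) = algebraMap ℚ A (n + 1) := by simp
        have h3 : (n + 1 : ℚ)⁻¹ • (algebraMap ℚ A (n + 1) * PowerSeries.coeff (n + 1) f) = 0 := by
          rw [← h2, mul_comm, h1, smul_zero]
        rwa [Algebra.smul_def, ← mul_assoc, ← map_mul, inv_mul_cancel₀ (by positivity), map_one,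
          one_mul] at h3
      · intro p hp
        rw [ih p.2 (by have := Finset.HasAntidiagonal.mem_antidiagonal.1 hp; omega), mul_zero]

theorem eq_of_derivative_eq_mul {c f g : A⟦X⟧} (hf : PowerSeries.derivative A f = c * f)
    (hg : PowerSeries.derivative A g = c * g)
    (h0 : PowerSeries.constantCoeff f = PowerSeries.constantCoeff g) : f = g :=
  sub_eq_zero.1 (eq_zero_of_derivative_eq_mul (c := c) (by rw [map_sub, hf, hg, mul_sub])
    (by rw [map_sub, h0, sub_self]))

theorem isUnit_expIntegral (c : A⟦X⟧) : IsUnit (expIntegral c) := by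
  rw [PowerSeries.isUnit_iff_constantCoeff, constantCoeff_expIntegral]
  exact isUnit_one

theorem map_derivative {A A' : Type*} [CommRing A] [CommRing A'] (φ : A →+* A') (f : A⟦X⟧) :
    PowerSeries.map φ (PowerSeries.derivative A f) =
      PowerSeries.derivative A' (PowerSeries.map φ f) := by
  ext n
  simp [PowerSeries.coeff_derivative]

theorem map_expIntegral {A' : Type*} [CommRing A'] [Algebra ℚ A'] (φ : A →+* A') (c : A⟦X⟧) :
    PowerSeries.map φ (expIntegral c) = expIntegral (PowerSeries.map φ c) := by
  refine eq_of_derivative_eq_mul (c := PowerSeries.map φ c) ?_ (derivative_expIntegral _) ?_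
  · rw [← map_derivative, derivative_expIntegral, map_mul]
  · rw [constantCoeff_expIntegral, ← PowerSeries.coeff_zero_eq_constantCoeff_apply,
      PowerSeries.coeff_map, PowerSeries.coeff_zero_eq_constantCoeff_apply,
      constantCoeff_expIntegral, map_one]

end ODE

end FlatAxes

end

noncomputable section

namespace FlatAxes

open DerivedEqualizer

/-! ### The equation `dg = gω` and its truncations -/

section Relations

variable (k : Type u) [Field k]

/-- The universal power series `g = ∑ aᵢ tⁱ`. -/
def aSeries : (Source k)⟦X⟧ := PowerSeries.mk fun i => MvPolynomial.X (Sum.inl i)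

/-- The universal power series `∑ bᵢ tⁱ`, so that `ω = t⁻ⁿ (∑ bᵢ tⁱ) dt`. -/
def bSeries : (Source k)⟦X⟧ := PowerSeries.mk fun i => MvPolynomial.X (Sum.inr i)

/-- The coefficients of `dg - gω`. -/
def relation (n i : ℕ) : Source k :=
  dMap k n (MvPolynomial.X i) - mulMap k (MvPolynomial.X i)

theorem mk_relation (n : ℕ) :
    PowerSeries.mk (relation k n) =
      PowerSeries.X ^ n * PowerSeries.derivative (Source k) (aSeries k) -
        aSeries k * bSeries k := by
  ext1 i
  rw [PowerSeries.coeff_mk, relation, map_sub, PowerSeries.coeff_X_pow_mul', PowerSeries.coeff_mul,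
    dMap, mulMap, MvPolynomial.aeval_X, MvPolynomial.aeval_X]
  congr 1
  · split_ifs
    · rw [PowerSeries.coeff_derivative, aSeries, PowerSeries.coeff_mk, nsmul_eq_mul, mul_comm]
      push_cast
      rfl
    · rfl
  · simp [aSeries, bSeries]

variable {k}

theorem map_aeval_aSeries {A : Type*} [CommRing A] [Algebra k A] (x : ℕ ⊕ ℕ → A) :
    PowerSeries.map (MvPolynomial.aeval x : Source k →ₐ[k] A).toRingHom (aSeries k) =
      PowerSeries.mk fun i => x (Sum.inl i) := by
  ext i
  simp [aSeries]

theorem map_aeval_bSeries {A : Type*} [CommRing A] [Algebra k A] (x : ℕ ⊕ ℕ → A) :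
    PowerSeries.map (MvPolynomial.aeval x : Source k →ₐ[k] A).toRingHom (bSeries k) =
      PowerSeries.mk fun i => x (Sum.inr i) := by
  ext i
  simp [bSeries]

/-- Two ring homomorphisms from the ring of functions agree when they agree on constants and on
the two universal series. -/
theorem source_hom_ext {A : Type*} [CommRing A] [Algebra k A] {φ ψ : Source k →ₐ[k] A}
    (ha : PowerSeries.map φ.toRingHom (aSeries k) = PowerSeries.map ψ.toRingHom (aSeries k))
    (hb : PowerSeries.map φ.toRingHom (bSeries k) = PowerSeries.map ψ.toRingHom (bSeries k)) :
    φ = ψ := by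
  ext (i | i)
  · simpa [aSeries] using congrArg (PowerSeries.coeff i) ha
  · simpa [bSeries] using congrArg (PowerSeries.coeff i) hb

variable (k)

/-- The ideal of the locus where `bᵢ = 0` for all `i ≥ N`. -/
def tailIdeal (N : ℕ∞) : Ideal (Source k) :=
  Ideal.span (MvPolynomial.X '' (Sum.inr '' {i : ℕ | N ≤ i}))

variable {k}

theorem X_mul_mem_span {σ : Type*} {s : Set σ} {j : σ} (hj : j ∉ s) {c : MvPolynomial σ k}
    (hc : MvPolynomial.X j * c ∈ Ideal.span (MvPolynomial.X '' s : Set (MvPolynomial σ k))) :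
    c ∈ Ideal.span (MvPolynomial.X '' s : Set (MvPolynomial σ k)) := by
  rw [MvPolynomial.mem_ideal_span_X_image] at hc ⊢
  intro m hm
  obtain ⟨i, hi, h⟩ := hc (Finsupp.single j 1 + m) (by
    rw [MvPolynomial.mem_support_iff] at hm ⊢
    rwa [MvPolynomial.coeff_X_mul])
  refine ⟨i, hi, ?_⟩
  have : j ≠ i := by rintro rfl; exact hj hi
  simpa [Finsupp.single_apply, this] using h

theorem X_mul_mem_tailIdeal {N : ℕ∞} {j : ℕ ⊕ ℕ} (hj : ∀ i : ℕ, N ≤ i → j ≠ Sum.inr i)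
    (c : Source k) (hc : MvPolynomial.X j * c ∈ tailIdeal k N) : c ∈ tailIdeal k N :=
  X_mul_mem_span (by rintro ⟨i, hi, rfl⟩; exact hj i hi rfl) hc

/-- An algebra endomorphism `φ` of a polynomial ring has its kernel in `I` if there is an
endomorphism `τ` such that `X j - τ (φ (X j))` lies in `I` for every variable. -/
theorem ker_le_of_section {σ : Type*} {φ τ : MvPolynomial σ k →ₐ[k] MvPolynomial σ k}
    {I : Ideal (MvPolynomial σ k)}
    (h : ∀ j, MvPolynomial.X j - τ (φ (MvPolynomial.X j)) ∈ I) :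
    RingHom.ker φ.toRingHom ≤ I := by
  intro x hx
  have key : (Ideal.Quotient.mkₐ k I) = (Ideal.Quotient.mkₐ k I).comp (τ.comp φ) := by
    ext j
    exact Ideal.Quotient.eq.2 (h j)
  have h1 := DFunLike.congr_fun key x
  have h2 : φ x = 0 := hx
  simp only [AlgHom.comp_apply, h2, map_zero] at h1
  exact Ideal.Quotient.eq_zero_iff_mem.1 h1

variable (k)

/-- Restriction to the locus `a₀ = 0`, parametrized by `(g, ω) ↦ (tg, ω + dt/t)`. -/
def restrictA (n : ℕ) : Source k →ₐ[k] Source k :=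
  MvPolynomial.aeval (Sum.elim
    (fun i => PowerSeries.coeff i (PowerSeries.X * aSeries k))
    (fun i => PowerSeries.coeff i (bSeries k + PowerSeries.X ^ (n - 1))))

/-- Restriction to the locus `b₀ = 0`, parametrized by `(g, β) ↦ (g, tβ)` where `ω = t⁻ⁿ β dt`. -/
def restrictB : Source k →ₐ[k] Source k :=
  MvPolynomial.aeval (Sum.elim
    (fun i => PowerSeries.coeff i (aSeries k))
    (fun i => PowerSeries.coeff i (PowerSeries.X * bSeries k)))

theorem map_restrictA_aSeries (n : ℕ) :
    PowerSeries.map (restrictA k n).toRingHom (aSeries k) = PowerSeries.X * aSeries k := by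
  rw [restrictA, map_aeval_aSeries]
  ext i
  simp

theorem map_restrictA_bSeries (n : ℕ) :
    PowerSeries.map (restrictA k n).toRingHom (bSeries k) =
      bSeries k + PowerSeries.X ^ (n - 1) := by
  rw [restrictA, map_aeval_bSeries]
  ext i
  simp

theorem map_restrictB_aSeries :
    PowerSeries.map (restrictB k).toRingHom (aSeries k) = aSeries k := by
  rw [restrictB, map_aeval_aSeries]
  ext i
  simp

theorem map_restrictB_bSeries :
    PowerSeries.map (restrictB k).toRingHom (bSeries k) = PowerSeries.X * bSeries k := by
  rw [restrictB, map_aeval_bSeries]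
  ext i
  simp

theorem restrictA_relation {n : ℕ} (hn : 0 < n) (i : ℕ) :
    restrictA k n (relation k n (i + 1)) = relation k n i := by
  obtain ⟨m, rfl⟩ : ∃ m, n = m + 1 := ⟨n - 1, by omega⟩
  have h : PowerSeries.map (restrictA k (m + 1)).toRingHom (PowerSeries.mk (relation k (m + 1))) =
      PowerSeries.X * PowerSeries.mk (relation k (m + 1)) := by
    rw [mk_relation, map_sub, map_mul, map_mul, map_derivative, map_restrictA_aSeries,
      map_restrictA_bSeries, map_pow, PowerSeries.map_X, Derivation.leibniz,
      PowerSeries.derivative_X, Nat.add_sub_cancel]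
    simp only [smul_eq_mul]
    ring
  have := congrArg (PowerSeries.coeff (i + 1)) h
  rw [PowerSeries.coeff_map, PowerSeries.coeff_mk, PowerSeries.coeff_succ_X_mul,
    PowerSeries.coeff_mk] at this
  exact this

theorem restrictB_relation {n : ℕ} (i : ℕ) :
    restrictB k (relation k (n + 1) (i + 1)) = relation k n i := by
  have h : PowerSeries.map (restrictB k).toRingHom (PowerSeries.mk (relation k (n + 1))) =
      PowerSeries.X * PowerSeries.mk (relation k n) := by
    rw [mk_relation, mk_relation, map_sub, map_mul, map_mul, map_derivative, map_restrictB_aSeries,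
      map_restrictB_bSeries, map_pow, PowerSeries.map_X]
    ring
  have := congrArg (PowerSeries.coeff (i + 1)) h
  rw [PowerSeries.coeff_map, PowerSeries.coeff_mk, PowerSeries.coeff_succ_X_mul,
    PowerSeries.coeff_mk] at this
  exact this

theorem relation_zero {n : ℕ} (hn : 0 < n) :
    relation k n 0 = -(MvPolynomial.X (Sum.inl 0) * MvPolynomial.X (Sum.inr 0)) := by
  simp [relation, dMap, mulMap, hn.ne']

/-- A section of `restrictA`. -/
def sectionA (n : ℕ) : Source k →ₐ[k] Source k :=
  MvPolynomial.aeval (Sum.elim (fun i => MvPolynomial.X (Sum.inl (i + 1)))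
    (fun i => PowerSeries.coeff i (bSeries k - PowerSeries.X ^ (n - 1))))

/-- A section of `restrictB`. -/
def sectionB : Source k →ₐ[k] Source k :=
  MvPolynomial.aeval (Sum.elim (fun i => MvPolynomial.X (Sum.inl i))
    (fun i => MvPolynomial.X (Sum.inr (i + 1))))

theorem restrictA_inr (n i : ℕ) : restrictA k n (MvPolynomial.X (Sum.inr i)) =
    MvPolynomial.X (Sum.inr i) + MvPolynomial.C (if i = n - 1 then 1 else 0) := by
  rw [restrictA, MvPolynomial.aeval_X, Sum.elim_inr, map_add, bSeries, PowerSeries.coeff_mk,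
    PowerSeries.coeff_X_pow]
  split_ifs <;> simp

theorem sectionA_inr (n i : ℕ) : sectionA k n (MvPolynomial.X (Sum.inr i)) =
    MvPolynomial.X (Sum.inr i) - MvPolynomial.C (if i = n - 1 then 1 else 0) := by
  rw [sectionA, MvPolynomial.aeval_X, Sum.elim_inr, map_sub, bSeries, PowerSeries.coeff_mk,
    PowerSeries.coeff_X_pow]
  split_ifs <;> simp

theorem restrictA_surjective (n : ℕ) : Function.Surjective (restrictA k n) := by
  refine Function.LeftInverse.surjective (g := sectionA k n) fun x => ?_
  have : (restrictA k n).comp (sectionA k n) = AlgHom.id k _ := by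
    ext (i | i)
    · simp [restrictA, sectionA, PowerSeries.coeff_succ_X_mul, aSeries]
    · rw [AlgHom.comp_apply, sectionA_inr, map_sub, restrictA_inr,
        ← MvPolynomial.algebraMap_eq, AlgHom.commutes, add_sub_cancel_right]
      rfl
  exact DFunLike.congr_fun this x

theorem restrictB_surjective : Function.Surjective (restrictB k) := by
  refine Function.LeftInverse.surjective (g := sectionB k) fun x => ?_
  have : (restrictB k).comp (sectionB k) = AlgHom.id k _ := by
    ext (i | i)
    · simp [restrictB, sectionB, aSeries]
    · simp [restrictB, sectionB, bSeries, PowerSeries.coeff_succ_X_mul]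
  exact DFunLike.congr_fun this x

theorem ker_restrictA (n : ℕ) :
    RingHom.ker (restrictA k n).toRingHom = Ideal.span {MvPolynomial.X (Sum.inl 0)} := by
  apply le_antisymm
  · refine ker_le_of_section (τ := sectionA k n) ?_
    rintro (i | i)
    · cases i with
      | zero => simp [restrictA]
      | succ i =>
        simp [restrictA, sectionA, PowerSeries.coeff_succ_X_mul, aSeries]
    · rw [restrictA_inr, map_add, sectionA_inr, ← MvPolynomial.algebraMap_eq, AlgHom.commutes,
        sub_add_cancel, sub_self]
      exact zero_mem _
  · rw [Ideal.span_singleton_le_iff_mem]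
    simp [RingHom.mem_ker, restrictA]

theorem ker_restrictB :
    RingHom.ker (restrictB k).toRingHom = Ideal.span {MvPolynomial.X (Sum.inr 0)} := by
  apply le_antisymm
  · refine ker_le_of_section (τ := sectionB k) ?_
    rintro (i | i)
    · simp [restrictB, sectionB, aSeries]
    · cases i with
      | zero => simp [restrictB]
      | succ i =>
        simp [restrictB, sectionB, PowerSeries.coeff_succ_X_mul, bSeries]
  · rw [Ideal.span_singleton_le_iff_mem]
    simp [RingHom.mem_ker, restrictB]

theorem map_restrictA_tailIdeal {n : ℕ} (hn : 0 < n) {N : ℕ∞} (hN : n ≤ N) :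
    (tailIdeal k N).map (restrictA k n).toRingHom = tailIdeal k N := by
  rw [tailIdeal, Ideal.map_span, Set.image_image, Set.image_image, Set.image_image]
  congr 1
  refine Set.image_congr fun i hi => ?_
  have hi' : n ≤ i := by exact_mod_cast hN.trans hi
  have : i ≠ n - 1 := by omega
  simp [restrictA, bSeries, PowerSeries.coeff_X_pow, this]

theorem map_restrictB_tailIdeal (N : ℕ∞) :
    (tailIdeal k (N + 1)).map (restrictB k).toRingHom = tailIdeal k N := by
  rw [tailIdeal, tailIdeal, Ideal.map_span, Set.image_image, Set.image_image, Set.image_image]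
  congr 1
  ext x
  constructor
  · rintro ⟨i, hi, rfl⟩
    cases i with
    | zero => simp at hi
    | succ i =>
      refine ⟨i, ?_, ?_⟩
      · have : N + 1 ≤ (i : ℕ∞) + 1 := by exact_mod_cast hi
        exact (ENat.add_le_add_iff_right (by simp)).1 this
      · simp [restrictB, bSeries, PowerSeries.coeff_succ_X_mul]
  · rintro ⟨i, hi, rfl⟩
    refine ⟨i + 1, ?_, ?_⟩
    · have hi' : N ≤ i := hi
      have : N + 1 ≤ (i : ℕ∞) + 1 := by gcongr
      exact_mod_cast this
    · simp [restrictB, bSeries, PowerSeries.coeff_succ_X_mul]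

section CharZero

variable [CharZero k]

/-- The automorphism `(g, ω) ↦ (exp (∫ ω) g, ω)`, for `ω` without a pole, or its inverse.  It takes
the equation `dg = gω` to `dg = 0`. -/
def gauge (ε : ℤ) : Source k →ₐ[k] Source k :=
  MvPolynomial.aeval (Sum.elim
    (fun i => PowerSeries.coeff i (expIntegral (ε • bSeries k) * aSeries k))
    (fun i => PowerSeries.coeff i (bSeries k)))

theorem map_gauge_aSeries (ε : ℤ) :
    PowerSeries.map (gauge k ε).toRingHom (aSeries k) =
      expIntegral (ε • bSeries k) * aSeries k := by
  rw [gauge, map_aeval_aSeries]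
  ext i
  simp

theorem map_gauge_bSeries (ε : ℤ) :
    PowerSeries.map (gauge k ε).toRingHom (bSeries k) = bSeries k := by
  rw [gauge, map_aeval_bSeries]
  ext i
  simp

theorem expIntegral_neg_mul {A : Type*} [CommRing A] [Algebra ℚ A] (c : A⟦X⟧) :
    expIntegral (-c) * expIntegral c = 1 := by
  refine eq_of_derivative_eq_mul (c := 0) ?_ (by simp) (by simp)
  rw [Derivation.leibniz, derivative_expIntegral, derivative_expIntegral]
  simp only [smul_eq_mul]
  ring

theorem gauge_gauge {ε : ℤ} (x : Source k) : gauge k (-ε) (gauge k ε x) = x := by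
  have : (gauge k (-ε)).comp (gauge k ε) = AlgHom.id k _ := by
    have hcomp : ∀ f : (Source k)⟦X⟧,
        PowerSeries.map ((gauge k (-ε)).comp (gauge k ε)).toRingHom f =
        PowerSeries.map (gauge k (-ε)).toRingHom (PowerSeries.map (gauge k ε).toRingHom f) := by
      intro f; ext; simp
    have hid : ∀ f : (Source k)⟦X⟧, PowerSeries.map (AlgHom.id k (Source k)).toRingHom f = f := by
      intro f; ext; simp
    refine source_hom_ext ?_ ?_
    · rw [hcomp, map_gauge_aSeries, map_mul, map_expIntegral, map_zsmul, map_gauge_bSeries,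
        map_gauge_aSeries, hid, ← mul_assoc, mul_comm (expIntegral _), neg_smul,
        expIntegral_neg_mul, one_mul]
    · rw [hcomp, map_gauge_bSeries, map_gauge_bSeries, hid]
  exact DFunLike.congr_fun this x

theorem gauge_surjective (ε : ℤ) : Function.Surjective (gauge k ε) := fun x =>
  ⟨gauge k (-ε) x, by simpa using gauge_gauge k (ε := -ε) x⟩

theorem ker_gauge (ε : ℤ) : RingHom.ker (gauge k ε).toRingHom = ⊥ :=
  (RingHom.injective_iff_ker_eq_bot _).1
    (Function.LeftInverse.injective (gauge_gauge k (ε := ε)))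

theorem map_gauge_tailIdeal (ε : ℤ) (N : ℕ∞) :
    (tailIdeal k N).map (gauge k ε).toRingHom = tailIdeal k N := by
  rw [tailIdeal, Ideal.map_span, Set.image_image, Set.image_image, Set.image_image]
  congr 1
  refine Set.image_congr fun i hi => ?_
  simp [gauge, bSeries]

theorem gauge_relation (i : ℕ) : gauge k 1 (relation k 0 i) =
    PowerSeries.coeff i (expIntegral (bSeries k) *
      PowerSeries.derivative (Source k) (aSeries k)) := by
  have h : PowerSeries.map (gauge k 1).toRingHom (PowerSeries.mk (relation k 0)) =
      expIntegral (bSeries k) * PowerSeries.derivative (Source k) (aSeries k) := by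
    rw [mk_relation, map_sub, map_mul, map_mul, map_derivative, map_gauge_aSeries,
      map_gauge_bSeries, map_pow, PowerSeries.map_X, Derivation.leibniz, one_smul,
      derivative_expIntegral]
    simp only [smul_eq_mul]
    ring
  rw [← h, PowerSeries.coeff_map, PowerSeries.coeff_mk]
  rfl

end CharZero

theorem span_coeff_mul_le {R : Type*} [CommRing R] (e f : R⟦X⟧) (m : ℕ) :
    Ideal.span ((fun i => PowerSeries.coeff i (e * f)) '' Set.Iio m) ≤
      Ideal.span ((fun i => PowerSeries.coeff i f) '' Set.Iio m) := by
  rw [Ideal.span_le]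
  rintro _ ⟨i, hi, rfl⟩
  change PowerSeries.coeff i (e * f) ∈ _
  rw [PowerSeries.coeff_mul]
  refine Ideal.sum_mem _ fun p hp => Ideal.mul_mem_left _ _ (Ideal.subset_span ⟨p.2, ?_, rfl⟩)
  have := Finset.HasAntidiagonal.mem_antidiagonal.1 hp
  simp only [Set.mem_Iio] at hi ⊢
  omega

theorem span_coeff_unit_mul {R : Type*} [CommRing R] {e e' : R⟦X⟧} (h : e' * e = 1) (f : R⟦X⟧)
    (m : ℕ) :
    Ideal.span ((fun i => PowerSeries.coeff i (e * f)) '' Set.Iio m) =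
      Ideal.span ((fun i => PowerSeries.coeff i f) '' Set.Iio m) := by
  refine le_antisymm (span_coeff_mul_le e f m) ?_
  conv_lhs => rw [← one_mul f, ← h, mul_assoc]
  exact span_coeff_mul_le e' (e * f) m

theorem tailIdeal_sup_span_X (N : ℕ∞) (m : ℕ) :
    tailIdeal k N ⊔ Ideal.span
      ((fun i => (MvPolynomial.X (Sum.inl (i + 1)) : Source k)) '' Set.Iio m) =
    Ideal.span (MvPolynomial.X '' (Sum.inr '' {i : ℕ | N ≤ i} ∪
      (fun i => Sum.inl (i + 1)) '' Set.Iio m)) := by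
  rw [Set.image_union, Ideal.span_union, tailIdeal, Set.image_image _ _ (Set.Iio m)]

variable [CharZero k]

theorem span_derivative_aSeries (m : ℕ) :
    Ideal.span ((fun i => PowerSeries.coeff i
        (PowerSeries.derivative (Source k) (aSeries k))) '' Set.Iio m) =
      Ideal.span ((fun i => (MvPolynomial.X (Sum.inl (i + 1)) : Source k)) '' Set.Iio m) := by
  have hu : ∀ i : ℕ, IsUnit ((i : Source k) + 1) := fun i => by
    have h : IsUnit ((i : k) + 1) := (Nat.cast_add_one_ne_zero i).isUnit
    simpa using h.map (algebraMap k (Source k))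
  have hc : ∀ i, PowerSeries.coeff i (PowerSeries.derivative (Source k) (aSeries k)) =
      MvPolynomial.X (Sum.inl (i + 1)) * ((i : Source k) + 1) := fun i => by
    rw [PowerSeries.coeff_derivative, aSeries, PowerSeries.coeff_mk]
  apply le_antisymm <;> rw [Ideal.span_le] <;> rintro _ ⟨i, hi, rfl⟩
  · change PowerSeries.coeff i _ ∈ _
    rw [hc]
    exact Ideal.mul_mem_right _ _ (Ideal.subset_span ⟨i, hi, rfl⟩)
  · have : PowerSeries.coeff i (PowerSeries.derivative (Source k) (aSeries k)) ∈
      Ideal.span ((fun i => PowerSeries.coeff i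
        (PowerSeries.derivative (Source k) (aSeries k))) '' Set.Iio m) :=
      Ideal.subset_span ⟨i, hi, rfl⟩
    rw [hc] at this
    exact (Ideal.mul_unit_mem_iff_mem _ (hu i)).1 this

/-- Without poles, the gauge transformation makes the equation `dg = gω` into `dg = 0`, whose
coefficients are multiples of the variables. -/
theorem weaklyRegularMod_relation_zero (N : ℕ∞) (len : ℕ) :
    WeaklyRegularMod (tailIdeal k N) (relation k 0) len := by
  have h := WeaklyRegularMod.of_surjective (φ := (gauge k 1).toRingHom) (gauge_surjective k 1)
    (J := tailIdeal k N) (f := relation k 0) (len := len) ?_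
  · rwa [ker_gauge, sup_bot_eq] at h
  rw [map_gauge_tailIdeal]
  have hfun : (fun i => (gauge k 1).toRingHom (relation k 0 i)) = fun i => PowerSeries.coeff i
      (expIntegral (bSeries k) * PowerSeries.derivative (Source k) (aSeries k)) :=
    funext (gauge_relation k)
  rw [hfun]
  have hspan : ∀ m, tailIdeal k N ⊔ Ideal.span ((fun i => PowerSeries.coeff i
      (expIntegral (bSeries k) * PowerSeries.derivative (Source k) (aSeries k))) '' Set.Iio m) =
      Ideal.span (MvPolynomial.X '' (Sum.inr '' {i : ℕ | N ≤ i} ∪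
      (fun i => Sum.inl (i + 1)) '' Set.Iio m)) := fun m => by
    rw [span_coeff_unit_mul (expIntegral_neg_mul (bSeries k)), span_derivative_aSeries,
      tailIdeal_sup_span_X]
  intro m hm c hc
  -- modulo its predecessors, the `m`-th coefficient is a unit times the variable `a (m + 1)`
  have hX : MvPolynomial.X (Sum.inl (m + 1)) * c ∈ tailIdeal k N ⊔ Ideal.span
      ((fun i => PowerSeries.coeff i (expIntegral (bSeries k) *
        PowerSeries.derivative (Source k) (aSeries k))) '' Set.Iio m) := by
    have h1 : MvPolynomial.X (Sum.inl (m + 1)) ∈ tailIdeal k N ⊔ Ideal.span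
      ((fun i => PowerSeries.coeff i (expIntegral (bSeries k) *
        PowerSeries.derivative (Source k) (aSeries k))) '' Set.Iio (m + 1)) := by
      rw [hspan]
      exact Ideal.subset_span ⟨_, Or.inr ⟨m, by simp, rfl⟩, rfl⟩
    rw [sup_span_image_Iio_succ, mem_sup_span_singleton'] at h1
    obtain ⟨d, hd⟩ := h1
    convert add_mem (Ideal.mul_mem_left _ c hd) (Ideal.mul_mem_left _ d hc) using 1
    ring
  rw [hspan] at hX ⊢
  refine X_mul_mem_span ?_ hX
  rintro (⟨_, -, h⟩ | ⟨i, hi, h⟩)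
  · simp at h
  · simp only [Sum.inl.injEq, Set.mem_Iio] at h hi
    omega

/-- The coefficients of `dg - gω` form a regular sequence.  The first one is `- a₀ b₀`; on the locus
`a₀ = 0` (respectively `b₀ = 0`) the others are the coefficients of the same equation for
`(t⁻¹ g, ω - dt/t)` (respectively for a pole of smaller order). -/
theorem weaklyRegularMod_relation (len n : ℕ) {N : ℕ∞} (hN : n ≤ N) :
    WeaklyRegularMod (tailIdeal k N) (relation k n) len := by
  induction len generalizing n N with
  | zero => exact fun m hm => absurd hm (Nat.not_lt_zero m)
  | succ len ih =>
    cases n with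
    | zero => exact weaklyRegularMod_relation_zero k N _
    | succ n =>
      obtain ⟨N, rfl⟩ : ∃ N' : ℕ∞, N = N' + 1 :=
        ⟨N - 1, (tsub_add_cancel_of_le (le_trans (by simp) hN)).symm⟩
      have hN' : (n : ℕ∞) ≤ N := by
        rw [Nat.cast_add, Nat.cast_one] at hN
        exact (ENat.add_le_add_iff_right (by simp)).1 hN
      have ha := X_mul_mem_tailIdeal (k := k) (N := N + 1) (j := Sum.inl 0) (by simp)
      have hb := X_mul_mem_tailIdeal (k := k) (N := N + 1) (j := Sum.inr 0) (by
        rintro i hi h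
        obtain rfl := Sum.inr_injective h
        simp at hi)
      refine WeaklyRegularMod.cons (fun c hc => ?_) ?_
      · rw [relation_zero k n.succ_pos, neg_mul, neg_mem_iff, mul_assoc] at hc
        exact hb c (ha _ hc)
      · rw [relation_zero k n.succ_pos, Ideal.span_singleton_neg]
        refine WeaklyRegularMod.sup_span_mul ha ?_ ?_
        · -- on `a₀ = 0` the orders of the poles do not change
          rw [← ker_restrictA k (n + 1)]
          refine WeaklyRegularMod.of_surjective (restrictA_surjective k _) ?_
          rw [map_restrictA_tailIdeal k n.succ_pos hN]
          have := ih (n + 1) hN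
          rwa [← funext (restrictA_relation k n.succ_pos)] at this
        · -- on `b₀ = 0` both `n` and the bound `N` drop by one
          rw [← ker_restrictB k]
          refine WeaklyRegularMod.of_surjective (restrictB_surjective k) ?_
          rw [map_restrictB_tailIdeal]
          have := ih n hN'
          rwa [← funext (restrictB_relation k)] at this

end Relations

end FlatAxes

end

noncomputable section

namespace FlatAxes

/-! ### Vanishing of `Tor` by dimension shifting in the first variable -/

section Tor

/-- One step of dimension shifting: let `0 → K → G → M → 0` be exact and let `F` be a flat
resolution of `Q`.  Exactness of `K ⊗ F` in degree `i > 0` (for `i = 0`: injectivity of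
`K ⊗ Q → G ⊗ Q`) and of `G ⊗ F` in degree `i + 1` imply exactness of `M ⊗ F` in degree `i + 1`.
Here `F₃ → F₂ → F₁ → F₀` are the terms of degrees `i + 2, …, i - 1`, with `F₀ = Q` if `i = 0`. -/
theorem exact_lTensor_of_shortExact {R K G M F₀ F₁ F₂ F₃ : Type*} [CommRing R]
    [AddCommGroup K] [AddCommGroup G] [AddCommGroup M] [AddCommGroup F₀] [AddCommGroup F₁]
    [AddCommGroup F₂] [AddCommGroup F₃] [Module R K] [Module R G] [Module R M] [Module R F₀]
    [Module R F₁] [Module R F₂] [Module R F₃] [Module.Flat R F₁]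
    {j : K →ₗ[R] G} {p : G →ₗ[R] M} {d₂ : F₃ →ₗ[R] F₂} {d₁ : F₂ →ₗ[R] F₁} {d₀ : F₁ →ₗ[R] F₀}
    (hjp : Function.Exact j p) (hp : Function.Surjective p)
    (hd₁ : d₀ ∘ₗ d₁ = 0) (hd₂ : d₁ ∘ₗ d₂ = 0)
    (hK : Function.Exact (d₁.lTensor K) (d₀.lTensor K))
    (hG : Function.Exact (d₂.lTensor G) (d₁.lTensor G))
    (hinj : Function.Injective (j.rTensor F₀)) :
    Function.Exact (d₂.lTensor M) (d₁.lTensor M) := by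
  intro x
  constructor
  · intro hx
    obtain ⟨x, rfl⟩ := LinearMap.rTensor_surjective F₂ hp x
    have h1 : p.rTensor F₁ (d₁.lTensor G x) = 0 := by
      rw [← hx, ← LinearMap.comp_apply, ← LinearMap.comp_apply, LinearMap.rTensor_comp_lTensor,
        LinearMap.lTensor_comp_rTensor]
    obtain ⟨κ, hκ⟩ := (rTensor_exact F₁ hjp hp _).1 h1
    have h2 : d₀.lTensor K κ = 0 := by
      apply hinj
      rw [map_zero, ← LinearMap.comp_apply, LinearMap.rTensor_comp_lTensor,
        ← LinearMap.lTensor_comp_rTensor, LinearMap.comp_apply, hκ, ← LinearMap.comp_apply,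
        ← LinearMap.lTensor_comp, hd₁, LinearMap.lTensor_zero, LinearMap.zero_apply]
    obtain ⟨κ', rfl⟩ := (hK _).1 h2
    have h3 : d₁.lTensor G (x - j.rTensor F₂ κ') = 0 := by
      rw [map_sub, ← hκ, ← LinearMap.comp_apply, ← LinearMap.comp_apply,
        LinearMap.rTensor_comp_lTensor, LinearMap.lTensor_comp_rTensor, sub_self]
    obtain ⟨y, hy⟩ := (hG _).1 h3
    refine ⟨p.rTensor F₃ y, ?_⟩
    have h4 : p.rTensor F₂ (j.rTensor F₂ κ') = 0 := by
      rw [← LinearMap.comp_apply, ← LinearMap.rTensor_comp, hjp.linearMap_comp_eq_zero,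
        LinearMap.rTensor_zero, LinearMap.zero_apply]
    rw [← LinearMap.comp_apply, LinearMap.lTensor_comp_rTensor, ← LinearMap.rTensor_comp_lTensor,
      LinearMap.comp_apply, hy, map_sub, h4, sub_zero]
  · rintro ⟨y, rfl⟩
    rw [← LinearMap.comp_apply, ← LinearMap.lTensor_comp, hd₂, LinearMap.lTensor_zero,
      LinearMap.zero_apply]

variable {R : Type u} [CommRing R]

/-- The kernel of the canonical surjection onto `M` from the free module on the set `M`. -/
abbrev syzygy (R M : Type u) [CommRing R] [AddCommGroup M] [Module R M] : Submodule R (M →₀ R) :=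
  LinearMap.ker (Finsupp.linearCombination R (id : M → M))

/-- Let `C` be a class of modules each member of which has a presentation `0 → K → G → M → 0` with
`G` flat, `K` in `C`, and `K ⊗ Q → G ⊗ Q` injective.  Then a flat resolution of `Q` remains exact in
positive degrees after tensoring with a member of `C`. -/
theorem exact_lTensor_of_presentations (C : ModuleCat.{u} R → Prop)
    {F : ℕ → Type u} [∀ i, AddCommGroup (F i)] [∀ i, Module R (F i)] [∀ i, Module.Flat R (F i)]
    {Q : Type u} [AddCommGroup Q] [Module R Q] {d : ∀ i, F (i + 1) →ₗ[R] F i} {ε : F 0 →ₗ[R] Q}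
    (hd : ∀ i, Function.Exact (d (i + 1)) (d i)) (hdε : Function.Exact (d 0) ε)
    (hε : Function.Surjective ε)
    (hC : ∀ M : ModuleCat.{u} R, C M → ∃ (K G : ModuleCat.{u} R) (j : K →ₗ[R] G) (p : G →ₗ[R] M),
      C K ∧ Module.Flat R G ∧ Function.Exact j p ∧ Function.Injective j ∧ Function.Surjective p ∧
        Function.Injective (j.rTensor Q))
    (i : ℕ) (M : ModuleCat.{u} R) (hM : C M) :
    Function.Exact ((d (i + 1)).lTensor M) ((d i).lTensor M) := by
  induction i generalizing M with
  | zero =>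
    obtain ⟨K, G, j, p, -, hG, hjp, -, hp, hQ⟩ := hC M hM
    exact exact_lTensor_of_shortExact hjp hp hdε.linearMap_comp_eq_zero
      (hd 0).linearMap_comp_eq_zero (lTensor_exact _ hdε hε) (Module.Flat.lTensor_exact _ (hd 0)) hQ
  | succ i ih =>
    obtain ⟨K, G, j, p, hK, hG, hjp, hj, hp, hQ⟩ := hC M hM
    exact exact_lTensor_of_shortExact hjp hp (hd i).linearMap_comp_eq_zero
      (hd (i + 1)).linearMap_comp_eq_zero (ih _ hK) (Module.Flat.lTensor_exact _ (hd (i + 1)))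
      (Module.Flat.rTensor_preserves_injective_linearMap _ hj)

theorem isZero_tor_of_presentations (C : ModuleCat.{u} R → Prop) (Q : ModuleCat.{u} R)
    (hC : ∀ M : ModuleCat.{u} R, C M → ∃ (K G : ModuleCat.{u} R) (j : K →ₗ[R] G) (p : G →ₗ[R] M),
      C K ∧ Module.Flat R G ∧ Function.Exact j p ∧ Function.Injective j ∧ Function.Surjective p ∧
        Function.Injective (j.rTensor Q))
    (M : ModuleCat.{u} R) (hM : C M) (i : ℕ) (hi : 0 < i) :
    IsZero (((Tor (ModuleCat.{u} R) i).obj M).obj Q) := by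
  obtain ⟨P⟩ := (HasProjectiveResolutions.out (C := ModuleCat.{u} R) Q).out
  have hF : ∀ i, Module.Flat R (P.complex.X i) := fun i => by
    have : Module.Projective R (P.complex.X i) :=
      (IsProjective.iff_projective (R := R) (P.complex.X i)).2 (P.projective i)
    infer_instance
  let e : ((ChainComplex.single₀ (ModuleCat.{u} R)).obj Q).X 0 ≅ Q :=
    HomologicalComplex.singleObjXSelf _ _ _
  have hε : Function.Surjective (P.π.f 0 ≫ e.hom).hom := by
    have : Epi (P.π.f 0 ≫ e.hom) := epi_comp _ _
    exact (ModuleCat.epi_iff_surjective _).1 this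
  have hd : ∀ i, Function.Exact (P.complex.d (i + 1 + 1) (i + 1)).hom (P.complex.d (i + 1) i).hom :=
    fun i => (ShortComplex.ShortExact.moduleCat_exact_iff_function_exact _).1 (P.exact_succ i)
  have hdε : Function.Exact (P.complex.d 1 0).hom (P.π.f 0 ≫ e.hom).hom := by
    have h1 := (ShortComplex.ShortExact.moduleCat_exact_iff_function_exact _).1 P.exact₀
    have h2 : Function.Injective e.hom.hom := (ModuleCat.mono_iff_injective _).1 inferInstance
    intro x
    refine Iff.trans ?_ (h1 x)
    change e.hom.hom ((P.π.f 0).hom x) = 0 ↔ (P.π.f 0).hom x = 0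
    rw [map_eq_zero_iff _ h2]
  obtain ⟨i, rfl⟩ : ∃ j, i = j + 1 := ⟨i - 1, by omega⟩
  refine IsZero.of_iso ?_ (P.isoLeftDerivedObj ((MonoidalCategory.tensoringLeft _).obj M) (i + 1))
  apply HomologicalComplex.ExactAt.isZero_homology
  rw [HomologicalComplex.exactAt_iff' _ (i + 2) (i + 1) i (by simp) (by simp),
    ShortComplex.ShortExact.moduleCat_exact_iff_function_exact]
  exact exact_lTensor_of_presentations C (F := fun i => P.complex.X i)
    (d := fun i => (P.complex.d (i + 1) i).hom) hd hdε hε hC i M hM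

/-- If `IG ∩ K = IK` for a submodule `K ⊆ G`, then `K ⊗ R/I → G ⊗ R/I` is injective. -/
theorem rTensor_subtype_quotient_injective {G : Type*} [AddCommGroup G] [Module R G]
    (K : Submodule R G) (I : Ideal R)
    (h : ∀ x : K, (x : G) ∈ (I • ⊤ : Submodule R G) → x ∈ (I • ⊤ : Submodule R K)) :
    Function.Injective (K.subtype.rTensor (R ⧸ I)) := by
  rw [injective_iff_map_eq_zero]
  intro x hx
  obtain ⟨y, rfl⟩ := (TensorProduct.tensorQuotEquivQuotSMul K I).symm.surjective x
  obtain ⟨y, rfl⟩ := Submodule.Quotient.mk_surjective _ y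
  rw [TensorProduct.tensorQuotEquivQuotSMul_symm_mk, LinearMap.rTensor_tmul] at hx
  have h1 := congrArg (TensorProduct.tensorQuotEquivQuotSMul G I) hx
  rw [map_zero, ← map_one (Ideal.Quotient.mk I), TensorProduct.tensorQuotEquivQuotSMul_tmul_mk,
    one_smul, Submodule.Quotient.mk_eq_zero] at h1
  rw [(Submodule.Quotient.mk_eq_zero _).2 (h y h1), map_zero]

/-- The criterion for vanishing of `Tor` with a quotient of `R` by a class of modules that is closed
under syzygies. -/
theorem torIndependent_of_syzygy {P Q : Type u} [CommRing P] [CommRing Q] {f : R →+* P}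
    {g : R →+* Q} (hg : Function.Surjective g) (C : ModuleCat.{u} R → Prop)
    (hC : ∀ M, C M → C (ModuleCat.of R (syzygy R M)))
    (hI : ∀ M : ModuleCat.{u} R, C M → ∀ x : syzygy R M,
      (x : M →₀ R) ∈ (RingHom.ker g • ⊤ : Submodule R (M →₀ R)) →
        x ∈ (RingHom.ker g • ⊤ : Submodule R (syzygy R M)))
    (hf : C ((ModuleCat.restrictScalars f).obj (ModuleCat.of P P))) :
    TorIndependent f g := by
  intro i hi
  let Q' : ModuleCat.{u} R := (ModuleCat.restrictScalars g).obj (ModuleCat.of Q Q)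
  let l : R →ₗ[R] Q' :=
    { toFun := fun r => (g r : Q)
      map_add' := fun a b => map_add g a b
      map_smul' := fun a b => map_mul g a b }
  have hl : LinearMap.ker l = RingHom.ker g := by
    ext x
    rfl
  let e : (R ⧸ RingHom.ker g) ≃ₗ[R] Q' :=
    (Submodule.quotEquivOfEq _ _ hl.symm).trans (l.quotKerEquivOfSurjective hg)
  refine IsZero.of_iso (isZero_tor_of_presentations C (ModuleCat.of R (R ⧸ RingHom.ker g))
    (fun M hM => ⟨ModuleCat.of R (syzygy R M), ModuleCat.of R (M →₀ R), (syzygy R M).subtype,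
      Finsupp.linearCombination R id, hC M hM, inferInstanceAs (Module.Flat R (M →₀ R)),
      LinearMap.exact_subtype_ker_map _, Submodule.subtype_injective _,
      Finsupp.linearCombination_id_surjective R M,
      rTensor_subtype_quotient_injective _ _ (hI M hM)⟩) _ hf i hi) ?_
  exact ((Tor (ModuleCat.{u} R) i).obj _).mapIso e.symm.toModuleIso

end Tor

end FlatAxes

end

noncomputable section

namespace FlatAxes

/-! ### Criteria for `Tor`-independence -/

section TorCriteria

variable {R : Type u} [CommRing R]

theorem mem_smul_top_finsupp {ι : Type*} {I : Ideal R} {x : ι →₀ R} :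
    x ∈ (I • ⊤ : Submodule R (ι →₀ R)) ↔ ∀ i, x i ∈ I := by
  constructor
  · intro hx i
    induction hx using Submodule.smul_induction_on' with
    | smul r hr n _ => exact I.mul_mem_right _ hr
    | add x _ y _ hx hy => exact I.add_mem hx hy
  · intro hx
    rw [← Finsupp.sum_single x]
    refine Submodule.sum_mem _ fun i _ => ?_
    rw [← mul_one (x i), ← smul_eq_mul, ← Finsupp.smul_single]
    exact Submodule.smul_mem_smul (hx i) trivial

section

variable {G M : Type*} [AddCommGroup G] [Module R G] [AddCommGroup M] [Module R M]

theorem mem_span_insert_smul_top (I : Ideal R) (r : R) (x : M) :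
    x ∈ ((I ⊔ Ideal.span {r}) • ⊤ : Submodule R M) ↔
      ∃ w ∈ (I • ⊤ : Submodule R M), ∃ g, x = w + r • g := by
  rw [Submodule.sup_smul, Submodule.mem_sup]
  refine exists_congr fun w => and_congr_right fun _ => ?_
  rw [Submodule.ideal_span_singleton_smul]
  constructor
  · rintro ⟨y, hy, rfl⟩
    obtain ⟨g, -, rfl⟩ := Submodule.mem_smul_pointwise_iff_exists _ _ _ |>.1 hy
    exact ⟨g, rfl⟩
  · rintro ⟨g, rfl⟩
    exact ⟨_, Submodule.smul_mem_pointwise_smul _ _ _ trivial, rfl⟩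

theorem map_mem_smul_top (p : G →ₗ[R] M) {I : Ideal R} {x : G}
    (hx : x ∈ (I • ⊤ : Submodule R G)) : p x ∈ (I • ⊤ : Submodule R M) := by
  have := Submodule.mem_map_of_mem (f := p) hx
  rw [Submodule.map_smul''] at this
  exact Submodule.smul_mono le_rfl le_top this

theorem exists_mem_smul_top {p : G →ₗ[R] M} (hp : Function.Surjective p) {I : Ideal R} {y : M}
    (hy : y ∈ (I • ⊤ : Submodule R M)) : ∃ x ∈ (I • ⊤ : Submodule R G), p x = y := by
  have : (I • ⊤ : Submodule R M) = (I • ⊤ : Submodule R G).map p := by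
    rw [Submodule.map_smul'', Submodule.map_top, LinearMap.range_eq_top.2 hp]
  rw [this] at hy
  exact hy

end

/-- The ideal generated by the first `m` terms of the sequence `z`. -/
abbrev initialIdeal (z : ℕ → R) (m : ℕ) : Ideal R := Ideal.span (z '' Set.Iio m)

theorem initialIdeal_succ (z : ℕ → R) (m : ℕ) :
    initialIdeal z (m + 1) = initialIdeal z m ⊔ Ideal.span {z m} := by
  simpa using sup_span_image_Iio_succ ⊥ z m

/-- The infinite sequence `z` is weakly regular on the module `M`. -/
def WeaklyRegularOn (z : ℕ → R) (M : Type*) [AddCommGroup M] [Module R M] : Prop :=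
  ∀ m, ∀ x : M, z m • x ∈ (initialIdeal z m • ⊤ : Submodule R M) →
    x ∈ (initialIdeal z m • ⊤ : Submodule R M)

section

variable {G M : Type*} [AddCommGroup G] [Module R G] [AddCommGroup M] [Module R M]

/-- If `z` is weakly regular on the quotient `M` of `G` by `K`, then `K ∩ IG = IK` for the ideals
`I` generated by initial segments of `z`. -/
theorem WeaklyRegularOn.mem_smul_top {z : ℕ → R} {p : G →ₗ[R] M} (hp : Function.Surjective p)
    (hM : WeaklyRegularOn z M) (m : ℕ) (u : LinearMap.ker p)
    (hu : (u : G) ∈ (initialIdeal z m • ⊤ : Submodule R G)) :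
    u ∈ (initialIdeal z m • ⊤ : Submodule R (LinearMap.ker p)) := by
  induction m generalizing u with
  | zero =>
    have h0 : initialIdeal z 0 = ⊥ := by simp [initialIdeal]
    rw [h0, Submodule.bot_smul, Submodule.mem_bot] at hu ⊢
    exact Subtype.ext hu
  | succ m ih =>
    rw [initialIdeal_succ, mem_span_insert_smul_top] at hu ⊢
    obtain ⟨w, hw, g, hg⟩ := hu
    have h1 : z m • p g ∈ (initialIdeal z m • ⊤ : Submodule R M) := by
      have h2 : p (w + z m • g) = 0 := by rw [← hg]; exact u.2
      rw [map_add, map_smul, add_comm, add_eq_zero_iff_eq_neg] at h2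
      rw [h2]
      exact neg_mem (map_mem_smul_top p hw)
    obtain ⟨w', hw', h3⟩ := exists_mem_smul_top hp (hM m _ h1)
    let κ : LinearMap.ker p := ⟨g - w', by rw [LinearMap.mem_ker, map_sub, h3, sub_self]⟩
    refine ⟨u - z m • κ, ih _ ?_, κ, by simp⟩
    have : ((u - z m • κ : LinearMap.ker p) : G) = w + z m • w' := by
      change (u : G) - z m • (g - w') = _
      rw [hg, smul_sub]
      abel
    rw [this]
    exact add_mem hw (Submodule.smul_mem _ _ hw')

theorem WeaklyRegularOn.ker {z : ℕ → R} {p : G →ₗ[R] M} (hp : Function.Surjective p)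
    (hG : WeaklyRegularOn z G) (hM : WeaklyRegularOn z M) :
    WeaklyRegularOn z (LinearMap.ker p) := fun m x hx =>
  hM.mem_smul_top hp m x (hG m x (map_mem_smul_top (LinearMap.ker p).subtype hx))

theorem WeaklyRegularOn.finsupp {z : ℕ → R} (hR : WeaklyRegularOn z R) (ι : Type*) :
    WeaklyRegularOn z (ι →₀ R) := by
  intro m x hx
  rw [mem_smul_top_finsupp] at hx ⊢
  intro i
  have := hR m (x i)
  simp only [smul_eq_mul, Ideal.mul_top] at this
  exact this (hx i)

theorem exists_mem_initialIdeal_smul_top {z : ℕ → R} {x : M}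
    (hx : x ∈ (Ideal.span (Set.range z) • ⊤ : Submodule R M)) :
    ∃ m, x ∈ (initialIdeal z m • ⊤ : Submodule R M) := by
  have hmono : Monotone fun m => (initialIdeal z m • ⊤ : Submodule R M) := fun a b hab =>
    Submodule.smul_mono_left (Ideal.span_mono (Set.image_mono (Set.Iio_subset_Iio hab)))
  induction hx using Submodule.smul_induction_on' with
  | smul r hr n _ =>
    have hr' : r ∈ ⊥ ⊔ Ideal.span (Set.range z) := by rwa [bot_sup_eq]
    obtain ⟨m, hm⟩ := exists_mem_sup_span_Iio hr'
    rw [bot_sup_eq] at hm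
    exact ⟨m, Submodule.smul_mem_smul hm trivial⟩
  | add x _ y _ hx hy =>
    obtain ⟨a, ha⟩ := hx
    obtain ⟨b, hb⟩ := hy
    exact ⟨max a b, add_mem (hmono (le_max_left a b) ha) (hmono (le_max_right a b) hb)⟩

end

/-- If the sequence `z` is weakly regular on `R` and on `P`, then `P` and `R ⧸ (z)` are
`Tor`-independent. -/
theorem torIndependent_of_weaklyRegularOn {P Q : Type u} [CommRing P] [CommRing Q] {f : R →+* P}
    {g : R →+* Q} (hg : Function.Surjective g) {z : ℕ → R}
    (hz : RingHom.ker g = Ideal.span (Set.range z)) (hR : WeaklyRegularOn z R)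
    (hf : @WeaklyRegularOn R _ z P _ (Module.compHom P f)) : TorIndependent f g := by
  refine torIndependent_of_syzygy hg (fun M => WeaklyRegularOn z M)
    (fun M hM => WeaklyRegularOn.ker (Finsupp.linearCombination_id_surjective R M)
      (hR.finsupp M) hM) (fun M hM x hx => ?_) hf
  rw [hz] at hx ⊢
  obtain ⟨m, hm⟩ := exists_mem_initialIdeal_smul_top hx
  exact Submodule.smul_mono_left (Ideal.span_mono (Set.image_subset_range _ _))
    (hM.mem_smul_top (Finsupp.linearCombination_id_surjective R M) m x hm)

/-- On `M`, the kernel of `x` is contained in the image of `y`, and the kernel of `y` in the image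
of `x`.  These inclusions are equalities if `xy = 0`. -/
def IsExactPair (x y : R) (M : Type*) [AddCommGroup M] [Module R M] : Prop :=
  (∀ m : M, x • m = 0 → ∃ m', m = y • m') ∧ ∀ m : M, y • m = 0 → ∃ m', m = x • m'

theorem IsExactPair.symm {x y : R} {M : Type*} [AddCommGroup M] [Module R M]
    (h : IsExactPair x y M) : IsExactPair y x M := ⟨h.2, h.1⟩

theorem IsExactPair.finsupp {x y : R} (h : IsExactPair x y R) (ι : Type*) :
    IsExactPair x y (ι →₀ R) := by
  have key : ∀ x y : R, (∀ m : R, x • m = 0 → ∃ m', m = y • m') →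
      ∀ m : ι →₀ R, x • m = 0 → ∃ m', m = y • m' := by
    classical
    intro x y h m hm
    have hm' : ∀ i, ∃ c, m i = y • c := fun i => h _ (DFunLike.congr_fun hm i)
    choose c hc using hm'
    refine ⟨Finsupp.onFinset m.support (fun i => if m i = 0 then 0 else c i) fun i hi => ?_, ?_⟩
    · rw [Finsupp.mem_support_iff]
      rintro h0
      simp [h0] at hi
    · ext i
      by_cases h0 : m i = 0
      · simp [h0]
      · simpa [h0] using hc i
  exact ⟨key x y h.1, key y x h.2⟩

section

variable {G M : Type*} [AddCommGroup G] [Module R G] [AddCommGroup M] [Module R M]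

theorem IsExactPair.exists_eq_smul {x y : R} {p : G →ₗ[R] M} (hp : Function.Surjective p)
    (hM : IsExactPair x y M) (hxy : x * y = 0) (u : LinearMap.ker p) (g : G)
    (hu : (u : G) = x • g) : ∃ κ : LinearMap.ker p, u = x • κ := by
  obtain ⟨m', hm'⟩ := hM.1 (p g) (by rw [← map_smul, ← hu]; exact u.2)
  obtain ⟨g', rfl⟩ := hp m'
  refine ⟨⟨g - y • g', by rw [LinearMap.mem_ker, map_sub, map_smul, hm', sub_self]⟩, ?_⟩
  ext
  change (u : G) = x • (g - y • g')
  rw [smul_sub, smul_smul, hxy, zero_smul, sub_zero, hu]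

theorem IsExactPair.ker {x y : R} {p : G →ₗ[R] M} (hp : Function.Surjective p)
    (hxy : x * y = 0) (hG : IsExactPair x y G) (hM : IsExactPair x y M) :
    IsExactPair x y (LinearMap.ker p) := by
  constructor
  · intro κ hκ
    obtain ⟨g, hg⟩ := hG.1 κ (congrArg Subtype.val hκ)
    exact hM.symm.exists_eq_smul hp (by rwa [mul_comm]) κ g hg
  · intro κ hκ
    obtain ⟨g, hg⟩ := hG.2 κ (congrArg Subtype.val hκ)
    exact hM.exists_eq_smul hp hxy κ g hg

end

/-- Let `(x, y)` be an exact pair on `R` and on `P`, with `xy = 0`.  Then `P` and `R ⧸ (x)` are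
`Tor`-independent: the modules on which `(x, y)` is an exact pair are closed under syzygies. -/
theorem torIndependent_of_isExactPair {P Q : Type u} [CommRing P] [CommRing Q] {f : R →+* P}
    {g : R →+* Q} (hg : Function.Surjective g) {x y : R} (hxy : x * y = 0)
    (hx : RingHom.ker g = Ideal.span {x}) (hR : IsExactPair x y R)
    (hf : IsExactPair (f x) (f y) P) : TorIndependent f g := by
  refine torIndependent_of_syzygy hg (fun M => IsExactPair x y M)
    (fun M hM => IsExactPair.ker (Finsupp.linearCombination_id_surjective R M) hxy
      (hR.finsupp M) hM) (fun M hM u hu => ?_) hf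
  rw [hx, Submodule.ideal_span_singleton_smul] at hu ⊢
  obtain ⟨g, -, hg⟩ := Submodule.mem_smul_pointwise_iff_exists _ _ _ |>.1 hu
  obtain ⟨κ, rfl⟩ := hM.exists_eq_smul (Finsupp.linearCombination_id_surjective R M) hxy u g hg.symm
  exact Submodule.smul_mem_pointwise_smul _ _ _ trivial

end TorCriteria

end FlatAxes

end

noncomputable section

namespace FlatAxes

open DerivedEqualizer

variable (k : Type u) [Field k]

/-! ### The derived equalizer is classical -/

section Classical

/-- The `i`-th coordinate of the difference of two points of `𝔏^{≤ n}𝔸¹dt`. -/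
def diagonalEquation (i : ℕ) : Target k ⊗[k] Target k :=
  MvPolynomial.X i ⊗ₜ 1 - 1 ⊗ₜ MvPolynomial.X i

theorem weaklyRegularOn_of_mod {R P : Type*} [CommRing R] [CommRing P] (f : R →+* P) {z : ℕ → R}
    (h : ∀ len, WeaklyRegularMod ⊥ (fun i => f (z i)) len) :
    @WeaklyRegularOn R _ z P _ (Module.compHom P f) := by
  let _ : Algebra R P := f.toAlgebra
  have key : ∀ (m : ℕ) (x : P), x ∈ (initialIdeal z m • ⊤ : Submodule R P) ↔
      x ∈ ⊥ ⊔ Ideal.span ((fun i => f (z i)) '' Set.Iio m) := fun m x => by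
    rw [Ideal.smul_top_eq_map, Submodule.restrictScalars_mem, Ideal.map_span, Set.image_image,
      bot_sup_eq]
    rfl
  intro m x hx
  have hx' : f (z m) * x ∈ ⊥ ⊔ Ideal.span ((fun i => f (z i)) '' Set.Iio m) := (key m _).1 hx
  exact (key m x).2 (h (m + 1) m (Nat.lt_succ_self m) x hx')

/-- Coordinates on `Y × Y`, for `Y = 𝔏^{≤ n}𝔸¹dt`, that vanish on the diagonal and their
complements. -/
def diagonalCoordinates : Target k ⊗[k] Target k ≃ₐ[k] MvPolynomial (ℕ ⊕ ℕ) k :=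
  AlgEquiv.ofAlgHom
    (Algebra.TensorProduct.productMap
      (MvPolynomial.aeval fun i => MvPolynomial.X (Sum.inl i) + MvPolynomial.X (Sum.inr i))
      (MvPolynomial.aeval fun i => MvPolynomial.X (Sum.inr i)))
    (MvPolynomial.aeval (Sum.elim (diagonalEquation k) fun i => 1 ⊗ₜ MvPolynomial.X i))
    (by ext (i | i) <;> simp [diagonalEquation])
    (by ext i <;> simp [diagonalEquation])

theorem diagonalCoordinates_diagonalEquation (i : ℕ) :
    diagonalCoordinates k (diagonalEquation k i) = MvPolynomial.X (Sum.inl i) := by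
  simp [diagonalCoordinates, diagonalEquation]

theorem weaklyRegularOn_diagonalEquation :
    WeaklyRegularOn (diagonalEquation k) (Target k ⊗[k] Target k) := by
  refine weaklyRegularOn_of_mod (RingHom.id _) fun len => ?_
  let φ : Target k ⊗[k] Target k →+* MvPolynomial (ℕ ⊕ ℕ) k := diagonalCoordinates k
  have h := WeaklyRegularMod.of_surjective (φ := φ) (diagonalCoordinates k).surjective
    (J := ⊥) (f := diagonalEquation k) (len := len) ?_
  · have hker : RingHom.ker φ = ⊥ :=
      (RingHom.injective_iff_ker_eq_bot _).1 (diagonalCoordinates k).injective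
    rwa [hker, sup_bot_eq] at h
  · have hfun : (fun i => φ (diagonalEquation k i)) = fun i => MvPolynomial.X (Sum.inl i) :=
      funext (diagonalCoordinates_diagonalEquation k)
    rw [Ideal.map_bot, hfun]
    intro m _ c hc
    rw [bot_sup_eq, ← Set.image_image MvPolynomial.X] at hc ⊢
    exact X_mul_mem_span (by simp) hc

theorem ker_lmul' : RingHom.ker ((Algebra.TensorProduct.lmul' k :
      Target k ⊗[k] Target k →ₐ[k] Target k) : Target k ⊗[k] Target k →+* Target k) =
    Ideal.span (Set.range (diagonalEquation k)) := by
  apply le_antisymm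
  · intro x hx
    let I := Ideal.span (Set.range (diagonalEquation k))
    have key : Ideal.Quotient.mkₐ k I = (Ideal.Quotient.mkₐ k I).comp
        ((Algebra.TensorProduct.includeRight (R := k) (A := Target k) (B := Target k)).comp
          (Algebra.TensorProduct.lmul' k)) := by
      ext i
      · exact Ideal.Quotient.eq.2 (by
          have := Ideal.subset_span (α := Target k ⊗[k] Target k)
            (Set.mem_range_self (f := diagonalEquation k) i)
          simpa [diagonalEquation, I] using this)
      · simp
    have h1 := DFunLike.congr_fun key x
    have h2 : Algebra.TensorProduct.lmul' k x = 0 := hx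
    simp only [AlgHom.comp_apply, h2, map_zero] at h1
    exact Ideal.Quotient.eq_zero_iff_mem.1 h1
  · rw [Ideal.span_le]
    rintro _ ⟨i, rfl⟩
    simp [diagonalEquation, RingHom.mem_ker]

theorem tailIdeal_top : tailIdeal k ⊤ = ⊥ := by
  rw [tailIdeal]
  convert Ideal.span_empty
  simp

theorem isClassical [CharZero k] (n : ℕ) : IsClassical k n := by
  refine torIndependent_of_weaklyRegularOn ?_ (ker_lmul' k)
    (weaklyRegularOn_diagonalEquation k) (weaklyRegularOn_of_mod _ fun len => ?_)
  · exact fun x => ⟨x ⊗ₜ 1, by simp⟩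
  · have h := weaklyRegularMod_relation k len n (N := ⊤) le_top
    rw [tailIdeal_top] at h
    have hfun : (fun i => ((Algebra.TensorProduct.productMap (dMap k n) (mulMap k) :
      Target k ⊗[k] Target k →ₐ[k] Source k) : Target k ⊗[k] Target k →+* Source k)
        (diagonalEquation k i)) = relation k n := by
      funext i
      simp [diagonalEquation, relation]
    rwa [hfun]

end Classical

/-! ### The universal rings -/

section Universal

/-- The ideal of the equations `dg = gω` and `bᵢ = 0` for `i ≥ N`. -/
def universalIdeal (n : ℕ) (N : ℕ∞) : Ideal (Source k) :=
  tailIdeal k N ⊔ Ideal.span (Set.range (relation k n))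

/-- The ring of functions on the scheme of pairs `(g, ω)` with `dg = gω`, where `ω` has a pole of
order at most `n` and its coefficients of degree at least `N - n` vanish.  For `N = ∞` these are all
points of the equalizer; for `N = n` they are those in normalized gauge. -/
abbrev UniversalRing (n : ℕ) (N : ℕ∞) : Type u := Source k ⧸ universalIdeal k n N

variable {k}

/-- The coefficients of the universal series `g`. -/
def universalA (n : ℕ) (N : ℕ∞) (i : ℕ) : UniversalRing k n N :=
  Ideal.Quotient.mk _ (MvPolynomial.X (Sum.inl i))

/-- The coefficients of the universal form `ω`. -/
def universalB (n : ℕ) (N : ℕ∞) (i : ℕ) : UniversalRing k n N :=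
  Ideal.Quotient.mk _ (MvPolynomial.X (Sum.inr i))

theorem mk_universalA (n : ℕ) (N : ℕ∞) : PowerSeries.mk (universalA (k := k) n N) =
    PowerSeries.map (Ideal.Quotient.mk (universalIdeal k n N)) (aSeries k) := by
  ext i
  simp [universalA, aSeries]

theorem mk_universalB (n : ℕ) (N : ℕ∞) : PowerSeries.mk (universalB (k := k) n N) =
    PowerSeries.map (Ideal.Quotient.mk (universalIdeal k n N)) (bSeries k) := by
  ext i
  simp [universalB, bSeries]

theorem universal_equation (n : ℕ) (N : ℕ∞) :
    PowerSeries.X ^ n * PowerSeries.derivative _ (PowerSeries.mk (universalA (k := k) n N)) =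
      PowerSeries.mk (universalA (k := k) n N) * PowerSeries.mk (universalB n N) := by
  rw [← sub_eq_zero, mk_universalA, mk_universalB, ← map_derivative, ← map_mul]
  have : (PowerSeries.X ^ n : (UniversalRing k n N)⟦X⟧) =
    PowerSeries.map (Ideal.Quotient.mk (universalIdeal k n N)) (PowerSeries.X ^ n) := by simp
  rw [this, ← map_mul, ← map_sub, ← mk_relation]
  ext i
  rw [PowerSeries.coeff_map, PowerSeries.coeff_mk, map_zero]
  exact Ideal.Quotient.eq_zero_iff_mem.2
    (le_sup_right (a := tailIdeal k N) (Ideal.subset_span ⟨i, rfl⟩))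

theorem universalB_eq_zero {n : ℕ} {N : ℕ∞} {i : ℕ} (hi : N ≤ i) :
    universalB (k := k) n N i = 0 :=
  Ideal.Quotient.eq_zero_iff_mem.2 (le_sup_left (b := Ideal.span (Set.range (relation k n)))
    (Ideal.subset_span ⟨_, ⟨i, hi, rfl⟩, rfl⟩))

section Lift

variable {A : Type*} [CommRing A] [Algebra k A] {n : ℕ} {N : ℕ∞} (g β : A⟦X⟧)
  (h : PowerSeries.X ^ n * PowerSeries.derivative A g = g * β)
  (hN : ∀ i : ℕ, N ≤ i → PowerSeries.coeff i β = 0)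

/-- The point of the scheme of pairs `(g, ω)` given by two power series. -/
def universalLift : UniversalRing k n N →ₐ[k] A :=
  Ideal.Quotient.liftₐ _ (MvPolynomial.aeval
    (Sum.elim (fun i => PowerSeries.coeff i g) fun i => PowerSeries.coeff i β)) (by
    suffices H : universalIdeal k n N ≤ RingHom.ker (MvPolynomial.aeval (R := k)
      (Sum.elim (fun i => PowerSeries.coeff i g) fun i => PowerSeries.coeff i β)).toRingHom from
      fun a ha => H ha
    refine sup_le (Ideal.span_le.2 ?_) (Ideal.span_le.2 ?_)
    · rintro _ ⟨_, ⟨i, hi, rfl⟩, rfl⟩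
      change MvPolynomial.aeval _ _ = 0
      simpa using hN i hi
    · rintro _ ⟨i, rfl⟩
      have h1 := congrArg (PowerSeries.coeff i ∘ PowerSeries.map (MvPolynomial.aeval (R := k)
        (Sum.elim (fun i => PowerSeries.coeff i g)
          fun i => PowerSeries.coeff i β)).toRingHom) (mk_relation k n)
      simp only [Function.comp_apply, map_sub (PowerSeries.map _), map_mul (PowerSeries.map _),
        map_derivative, map_aeval_aSeries, map_aeval_bSeries, map_pow, PowerSeries.map_X,
        Sum.elim_inl, Sum.elim_inr] at h1
      have h2 : ∀ f : A⟦X⟧, PowerSeries.mk (fun i => PowerSeries.coeff i f) = f := fun f => by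
        ext; simp
      rw [h2, h2, h, sub_self, map_zero, PowerSeries.coeff_map, PowerSeries.coeff_mk] at h1
      exact h1)

theorem map_universalLift_universalA :
    PowerSeries.map (universalLift (k := k) (n := n) (N := N) g β h hN : UniversalRing k n N →+* A)
      (PowerSeries.mk (universalA n N)) = g := by
  ext i
  rw [PowerSeries.coeff_map, PowerSeries.coeff_mk]
  change MvPolynomial.aeval _ (MvPolynomial.X (Sum.inl i)) = _
  simp

theorem map_universalLift_universalB :
    PowerSeries.map (universalLift (k := k) (n := n) (N := N) g β h hN : UniversalRing k n N →+* A)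
      (PowerSeries.mk (universalB n N)) = β := by
  ext i
  rw [PowerSeries.coeff_map, PowerSeries.coeff_mk]
  change MvPolynomial.aeval _ (MvPolynomial.X (Sum.inr i)) = _
  simp

end Lift

theorem universalRing_hom_ext {A : Type*} [CommRing A] [Algebra k A] {n : ℕ} {N : ℕ∞}
    {φ ψ : UniversalRing k n N →ₐ[k] A}
    (ha : PowerSeries.map (φ : UniversalRing k n N →+* A) (PowerSeries.mk (universalA n N)) =
      PowerSeries.map (ψ : UniversalRing k n N →+* A) (PowerSeries.mk (universalA n N)))
    (hb : PowerSeries.map (φ : UniversalRing k n N →+* A) (PowerSeries.mk (universalB n N)) =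
      PowerSeries.map (ψ : UniversalRing k n N →+* A) (PowerSeries.mk (universalB n N))) :
    φ = ψ := by
  refine Ideal.Quotient.algHom_ext _ (MvPolynomial.algHom_ext ?_)
  rintro (i | i)
  · simpa [universalA] using congrArg (PowerSeries.coeff i) ha
  · simpa [universalB] using congrArg (PowerSeries.coeff i) hb

variable [CharZero k]

/-- For `0 < n ≤ N`, the annihilator of `a₀` is generated by `b₀` and conversely. -/
theorem isExactPair_universal {n : ℕ} (hn : 0 < n) {N : ℕ∞} (hN : n ≤ N) :
    IsExactPair (universalA (k := k) n N 0) (universalB n N 0) (UniversalRing k n N) := by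
  have hN0 : ∀ i : ℕ, N ≤ i → Sum.inr 0 ≠ (Sum.inr i : ℕ ⊕ ℕ) := by
    rintro i hi h
    obtain rfl := Sum.inr_injective h
    have : (n : ℕ∞) ≤ 0 := by exact_mod_cast hN.trans hi
    simp [hn.ne'] at this
  have ha := X_mul_mem_tailIdeal (k := k) (N := N) (j := Sum.inl 0) (by simp)
  have hb := X_mul_mem_tailIdeal (k := k) (N := N) (j := Sum.inr 0) hN0
  have hkerA : ∀ len, WeaklyRegularMod (tailIdeal k N ⊔ Ideal.span {MvPolynomial.X (Sum.inl 0)})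
      (fun i => relation k n (i + 1)) len := fun len => by
    rw [← ker_restrictA k n]
    refine WeaklyRegularMod.of_surjective (restrictA_surjective k _) ?_
    rw [map_restrictA_tailIdeal k hn hN]
    have := weaklyRegularMod_relation k len n hN
    rwa [← funext (restrictA_relation k hn)] at this
  have hkerB : ∀ len, WeaklyRegularMod (tailIdeal k N ⊔ Ideal.span {MvPolynomial.X (Sum.inr 0)})
      (fun i => relation k n (i + 1)) len := fun len => by
    obtain ⟨n, rfl⟩ : ∃ n', n = n' + 1 := ⟨n - 1, by omega⟩
    obtain ⟨N, rfl⟩ : ∃ N' : ℕ∞, N = N' + 1 :=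
      ⟨N - 1, (tsub_add_cancel_of_le (le_trans (by simp) hN)).symm⟩
    have hN' : (n : ℕ∞) ≤ N := by
      rw [Nat.cast_add, Nat.cast_one] at hN
      exact (ENat.add_le_add_iff_right (by simp)).1 hN
    rw [← ker_restrictB k]
    refine WeaklyRegularMod.of_surjective (restrictB_surjective k) ?_
    rw [map_restrictB_tailIdeal]
    have := weaklyRegularMod_relation k len n hN'
    rwa [← funext (restrictB_relation k)] at this
  have key : ∀ x y : Source k, (∀ c, x * c ∈ tailIdeal k N → c ∈ tailIdeal k N) →
      relation k n 0 = -(x * y) →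
      (∀ len, WeaklyRegularMod (tailIdeal k N ⊔ Ideal.span {x})
        (fun i => relation k n (i + 1)) len) →
      ∀ m : UniversalRing k n N, Ideal.Quotient.mk _ x * m = 0 →
        ∃ m', m = Ideal.Quotient.mk (universalIdeal k n N) y * m' := by
    intro x y hx h0 h m hm
    obtain ⟨c, rfl⟩ := Ideal.Quotient.mk_surjective m
    rw [← map_mul, Ideal.Quotient.eq_zero_iff_mem] at hm
    obtain ⟨d, hd⟩ := mem_sup_span_singleton'.1
      (WeaklyRegularMod.mem_of_mul_mem_range hx h0 h hm)
    exact ⟨Ideal.Quotient.mk _ d, by rw [← map_mul]; exact Ideal.Quotient.eq.2 hd⟩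
  exact ⟨key _ _ ha (relation_zero k hn) hkerA,
    key _ _ hb (by rw [relation_zero k hn, mul_comm]) hkerB⟩

end Universal

/-! ### The coordinate ring of the union of the axes -/

section Axes

open AxesModGm

variable {k}

theorem isExactPair_coord : IsExactPair (coordX k) (coordY k) (CoordRing k) := by
  let π : MvPolynomial (Fin 2) k →+* CoordRing k := Ideal.Quotient.mk _
  have key : ∀ x y : MvPolynomial (Fin 2) k, x ≠ 0 →
      Ideal.span {MvPolynomial.X 0 * MvPolynomial.X 1} = Ideal.span {x * y} → ∀ m : CoordRing k,
      π x * m = 0 → ∃ m', m = π y * m' := by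
    intro x y hx hxy m hm
    obtain ⟨c, rfl⟩ := Ideal.Quotient.mk_surjective m
    have hm' : x * c ∈ (Ideal.span {MvPolynomial.X 0 * MvPolynomial.X 1} :
      Ideal (MvPolynomial (Fin 2) k)) :=
      Ideal.Quotient.eq_zero_iff_mem.1 ((map_mul π x c).trans hm)
    rw [hxy, Ideal.mem_span_singleton'] at hm'
    obtain ⟨d, hd⟩ := hm'
    refine ⟨π d, ?_⟩
    have : c = y * d := mul_left_cancel₀ hx (by rw [← hd]; ring)
    rw [← map_mul, ← this]
    rfl
  exact ⟨key _ _ (MvPolynomial.X_ne_zero _) rfl,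
    key _ _ (MvPolynomial.X_ne_zero _) (by rw [mul_comm])⟩

/-- The morphism `Spec A → C` given by two functions with product zero. -/
def coordLift {A : Type*} [CommRing A] [Algebra k A] (x y : A) (h : y * x = 0) :
    CoordRing k →ₐ[k] A :=
  Ideal.Quotient.liftₐ (Ideal.span {MvPolynomial.X 0 * MvPolynomial.X 1})
    (MvPolynomial.aeval ![x, y]) (by
    suffices H : Ideal.span {MvPolynomial.X 0 * MvPolynomial.X 1} ≤
      RingHom.ker (MvPolynomial.aeval (R := k) ![x, y]).toRingHom from fun a ha => H ha
    rw [Ideal.span_singleton_le_iff_mem]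
    change MvPolynomial.aeval _ _ = 0
    simp [mul_comm x, h])

@[simp]
theorem coordLift_coordX {A : Type*} [CommRing A] [Algebra k A] (x y : A) (h : y * x = 0) :
    coordLift x y h (coordX k) = x := by
  change MvPolynomial.aeval ![x, y] _ = _
  simp

@[simp]
theorem coordLift_coordY {A : Type*} [CommRing A] [Algebra k A] (x y : A) (h : y * x = 0) :
    coordLift x y h (coordY k) = y := by
  change MvPolynomial.aeval ![x, y] _ = _
  simp

theorem coordRing_hom_ext {A : Type*} [CommRing A] [Algebra k A] {φ ψ : CoordRing k →ₐ[k] A}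
    (hx : φ (coordX k) = ψ (coordX k)) (hy : φ (coordY k) = ψ (coordY k)) : φ = ψ := by
  refine Ideal.Quotient.algHom_ext (A := MvPolynomial (Fin 2) k)
    (I := Ideal.span {MvPolynomial.X 0 * MvPolynomial.X 1}) k (MvPolynomial.algHom_ext fun i => ?_)
  fin_cases i
  exacts [hx, hy]

/-- A map to `C` is flat along the axes if the two coordinates form an exact pair on its source. -/
theorem flatAlongAxes_of_isExactPair {P : Type u} [CommRing P] (f : CoordRing k →+* P)
    (h : IsExactPair (f (coordX k)) (f (coordY k)) P) : FlatAlongAxes f :=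
  ⟨torIndependent_of_isExactPair Ideal.Quotient.mk_surjective (coordY_mul_coordX k)
      Ideal.mk_ker isExactPair_coord.symm h.symm,
    torIndependent_of_isExactPair Ideal.Quotient.mk_surjective
      (by rw [mul_comm]; exact coordY_mul_coordX k) Ideal.mk_ker isExactPair_coord h⟩

end Axes

end FlatAxes

end

noncomputable section

namespace FlatAxes

/-! ### Semilinear maps of invertible modules -/

section SemilinearLift

variable {R R' R'' N N' N'' : Type*} [CommRing R] [CommRing R'] [CommRing R'']
  [AddCommGroup N'] [AddCommGroup N''] [Module R' N'] [Module R'' N'']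

/-- A semilinear map `f : N → N'` of invertible modules whose image spans `N'` exhibits `N'` as the
base change of `N`, because a surjection of invertible modules is bijective: semilinear maps out of
`N` factor through `f`. -/
theorem exists_semilinear_lift [AddCommGroup N] [Module R N] [Module.Invertible R N]
    [Module.Invertible R' N'] (σ : R →+* R')
    (ρ : R' →+* R'') (f : N →+ N') (hf : ∀ r x, f (r • x) = σ r • f x)
    (hspan : Submodule.span R' (Set.range f) = ⊤) (g : N →+ N'')
    (hg : ∀ r x, g (r • x) = ρ (σ r) • g x) :
    ∃ h : N' →+ N'', (∀ r x, h (r • x) = ρ r • h x) ∧ ∀ x, h (f x) = g x := by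
  let _ : Algebra R R' := σ.toAlgebra
  let _ : Module R N' := Module.compHom N' σ
  let _ : Module R' N'' := Module.compHom N'' ρ
  let _ : Module R N'' := Module.compHom N'' (ρ.comp σ)
  have : IsScalarTower R R' N' := IsScalarTower.of_algebraMap_smul fun r x => rfl
  have : IsScalarTower R R' N'' := IsScalarTower.of_algebraMap_smul fun r x => rfl
  let fl : N →ₗ[R] N' := { f with map_smul' := hf }
  let gl : N →ₗ[R] N'' := { g with map_smul' := hg }
  have hsurj : Function.Surjective (fl.liftBaseChange R') := by
    rw [← LinearMap.range_eq_top, eq_top_iff, ← hspan, Submodule.span_le]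
    rintro _ ⟨x, rfl⟩
    exact ⟨1 ⊗ₜ x, by simp [fl]⟩
  let e := LinearEquiv.ofBijective _ (Module.Invertible.bijective_of_surjective hsurj)
  refine ⟨((gl.liftBaseChange R').comp e.symm.toLinearMap).toAddMonoidHom, fun r x => ?_,
    fun x => ?_⟩
  · exact map_smul ((gl.liftBaseChange R').comp e.symm.toLinearMap) r x
  · have : e (1 ⊗ₜ x) = f x := by simp [e, fl]
    change (gl.liftBaseChange R') (e.symm (f x)) = g x
    rw [← this, e.symm_apply_apply]
    simp [gl]

theorem semilinear_ext (ρ : R' →+* R'') {f : N → N'}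
    (hspan : Submodule.span R' (Set.range f) = ⊤) {h₁ h₂ : N' →+ N''}
    (hh₁ : ∀ r x, h₁ (r • x) = ρ r • h₁ x) (hh₂ : ∀ r x, h₂ (r • x) = ρ r • h₂ x)
    (h : ∀ x, h₁ (f x) = h₂ (f x)) : h₁ = h₂ := by
  ext x
  have hx : x ∈ Submodule.span R' (Set.range f) := hspan ▸ trivial
  induction hx using Submodule.span_induction with
  | mem x hx => obtain ⟨y, rfl⟩ := hx; exact h y
  | zero => simp
  | add x y _ _ hx hy => rw [map_add, map_add, hx, hy]
  | smul r x _ hx => rw [hh₁, hh₂, hx]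

/-- An element that generates an invertible module is a basis of it. -/
theorem bijective_smul_of_span [AddCommGroup N] [Module R N] [Module.Invertible R N] {e : N}
    (he : Submodule.span R {e} = ⊤) :
    Function.Bijective fun r : R => r • e := by
  have hs : Function.Surjective (LinearMap.toSpanSingleton R N e) := by
    rw [← LinearMap.range_eq_top, ← LinearMap.span_singleton_eq_range, he]
  exact Module.Invertible.bijective_of_surjective hs

end SemilinearLift

/-! ### Laurent series -/

section Laurent

variable {A : Type u} [CommRing A]

theorem derivative_single_mul (a : ℤ) (f : A⸨X⸩) :
    LaurentSeries.derivative A (HahnSeries.single a (1 : A) * f) =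
      a • (HahnSeries.single (a - 1) (1 : A) * f) +
        HahnSeries.single a (1 : A) * LaurentSeries.derivative A f := by
  ext i
  have h1 : ∀ (c : ℤ) (g : A⸨X⸩) (j : ℤ),
      (HahnSeries.single c (1 : A) * g).coeff j = g.coeff (j - c) := fun c g j => by
    have := HahnSeries.coeff_single_mul_add (r := (1 : A)) (x := g) (a := j - c) (b := c)
    rwa [sub_add_cancel, one_mul] at this
  rw [HahnSeries.coeff_add, HahnSeries.coeff_smul, h1, h1, LaurentSeries.derivative_apply,
    LaurentSeries.derivative_apply, LaurentSeries.hasseDeriv_coeff, LaurentSeries.hasseDeriv_coeff,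
    h1]
  have e1 : i + ((1 : ℕ) : ℤ) - a = i - a + ((1 : ℕ) : ℤ) := by ring
  have e2 : i - (a - 1) = i - a + ((1 : ℕ) : ℤ) := by push_cast; ring
  rw [e1, e2, ← add_smul]
  congr 1
  simp only [Ring.choose_one_right]
  push_cast
  ring

theorem exists_single_mul_coe (f : A⸨X⸩) : ∃ (a : ℤ) (p : A⟦X⟧),
    f = HahnSeries.single a (1 : A) * algebraMap A⟦X⟧ A⸨X⸩ p :=
  ⟨_, _, (LaurentSeries.single_order_mul_powerSeriesPart f).symm⟩

theorem derivative_mul (f g : A⸨X⸩) : LaurentSeries.derivative A (f * g) =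
    LaurentSeries.derivative A f * g + f * LaurentSeries.derivative A g := by
  obtain ⟨a, p, rfl⟩ := exists_single_mul_coe f
  obtain ⟨b, q, rfl⟩ := exists_single_mul_coe g
  have h1 : HahnSeries.single a (1 : A) * algebraMap A⟦X⟧ A⸨X⸩ p *
      (HahnSeries.single b (1 : A) * algebraMap A⟦X⟧ A⸨X⸩ q) =
      HahnSeries.single (a + b) (1 : A) * algebraMap A⟦X⟧ A⸨X⸩ (p * q) := by
    have : HahnSeries.single (a + b) (1 : A) =
      HahnSeries.single a (1 : A) * HahnSeries.single b (1 : A) := by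
      rw [HahnSeries.single_mul_single, one_mul]
    rw [this, map_mul]
    ring
  have h2 : HahnSeries.single (a + b - 1) (1 : A) =
      HahnSeries.single (a - 1) (1 : A) * HahnSeries.single b (1 : A) := by
    rw [HahnSeries.single_mul_single, one_mul]
    congr 1
    ring_nf
  have h3 : HahnSeries.single (a - 1) (1 : A) * HahnSeries.single b (1 : A) =
      HahnSeries.single a (1 : A) * HahnSeries.single (b - 1) (1 : A) := by
    rw [HahnSeries.single_mul_single, HahnSeries.single_mul_single]
    congr 1
    ring_nf
  have h4 : HahnSeries.single (a + b) (1 : A) =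
      HahnSeries.single a (1 : A) * HahnSeries.single b (1 : A) := by
    rw [HahnSeries.single_mul_single, one_mul]
  rw [h1, derivative_single_mul, derivative_single_mul, derivative_single_mul,
    FlatSection.derivative_coe, FlatSection.derivative_coe, FlatSection.derivative_coe,
    Derivation.leibniz, h2, h4, add_smul]
  nth_rewrite 2 [h3]
  simp only [map_add, map_mul, smul_eq_mul, zsmul_eq_mul]
  ring

theorem exists_X_pow_mul (f : A⸨X⸩) : ∃ (i : ℕ) (p : A⟦X⟧),
    algebraMap A⟦X⟧ A⸨X⸩ (PowerSeries.X ^ i) * f = algebraMap A⟦X⟧ A⸨X⸩ p := by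
  obtain ⟨⟨p, s⟩, h⟩ := IsLocalization.surj (Submonoid.powers (PowerSeries.X : A⟦X⟧)) f
  obtain ⟨i, hi⟩ := s.2
  exact ⟨i, p, by rw [mul_comm, ← h]; exact congrArg _ (congrArg _ hi)⟩

/-- `t ^ n` is invertible in the ring of Laurent series. -/
theorem X_pow_mul_single (n : ℕ) : algebraMap A⟦X⟧ A⸨X⸩ (PowerSeries.X ^ n) *
    HahnSeries.single (-(n : ℤ)) (1 : A) = 1 := by
  rw [LaurentSeries.coe_algebraMap, HahnSeries.ofPowerSeries_X_pow, HahnSeries.single_mul_single]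
  simp

end Laurent

/-! ### Points of `𝒵^{≤ n}` in terms of the lattice -/

namespace FlatSection

variable {k : Type u} [Field k]

theorem X_pow_smul_injective (P : FlatSection.{u} k) (i : ℕ) :
    Function.Injective fun v : P.V => (PowerSeries.X ^ i : P.A⟦X⟧) • v := by
  induction i with
  | zero => exact fun v w h => by simpa using h
  | succ i ih =>
    have : (fun v : P.V => (PowerSeries.X ^ (i + 1) : P.A⟦X⟧) • v) =
      (fun v : P.V => (PowerSeries.X ^ i : P.A⟦X⟧) • v) ∘
        fun v => (PowerSeries.X : P.A⟦X⟧) • v := by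
      funext v
      simp [pow_succ, mul_smul]
    rw [this]
    exact ih.comp P.X_smul_injective

theorem exists_X_pow_smul (P : FlatSection.{u} k) (i : ℕ) (v : P.V) :
    ∃ w : P.V, (PowerSeries.X ^ i : P.A⟦X⟧) • w = v := by
  induction i generalizing v with
  | zero => exact ⟨v, by simp⟩
  | succ i ih =>
    obtain ⟨w, rfl⟩ := ih v
    obtain ⟨w, rfl⟩ := P.exists_X_smul w
    exact ⟨w, by rw [pow_succ, mul_smul]⟩

theorem Hom.map_X_pow_smul {P Q : FlatSection.{u} k} (f : Hom P Q) (i : ℕ) (v : P.V) :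
    f.map ((PowerSeries.X ^ i : P.A⟦X⟧) • v) = (PowerSeries.X ^ i : Q.A⟦X⟧) • f.map v := by
  rw [f.map_smul, map_pow, PowerSeries.map_X]

/-- An arrow is determined by its restriction to the lattice. -/
theorem hom_ext_lattice {P Q : FlatSection.{u} k} {f g : P ⟶ Q} (h₁ : f.base = g.base)
    (h₂ : ∀ v ∈ P.L, f.map v = g.map v) : f = g := by
  refine hom_ext h₁ (AddMonoidHom.ext fun v => ?_)
  obtain ⟨i, hi⟩ := P.exists_pow_smul_mem v
  apply Q.X_pow_smul_injective i
  change (PowerSeries.X ^ i : Q.A⟦X⟧) • f.map v = (PowerSeries.X ^ i : Q.A⟦X⟧) • g.map v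
  rw [← f.map_X_pow_smul, ← g.map_X_pow_smul, h₂ _ hi]

section OfLattice

variable {P Q : FlatSection.{u} k} (φ : P.A →ₐ[k] Q.A) (f : P.L →+ Q.V)

/-- A semilinear map on the lattice extends to the line bundle on the punctured disc. -/
theorem exists_extension
    (hf : ∀ (g : P.A⟦X⟧) (v : P.L), f (g • v) = PowerSeries.map (φ : P.A →+* Q.A) g • f v) :
    ∃ F : P.V →+ Q.V, (∀ v : P.L, F v = f v) ∧
    ∀ (g : P.A⟦X⟧) (v : P.V), F (g • v) = PowerSeries.map (φ : P.A →+* Q.A) g • F v := by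
  choose i hi using P.exists_pow_smul_mem
  choose F hF using fun v => Q.exists_X_pow_smul (i v) (f ⟨_, hi v⟩)
  have hX : ∀ (j : ℕ) (v : P.L), f ((PowerSeries.X ^ j : P.A⟦X⟧) • v) =
      (PowerSeries.X ^ j : Q.A⟦X⟧) • f v := fun j v => by
    rw [hf, map_pow, PowerSeries.map_X]
  have key : ∀ (v : P.V) (j : ℕ) (hj : (PowerSeries.X ^ j : P.A⟦X⟧) • v ∈ P.L),
      (PowerSeries.X ^ j : Q.A⟦X⟧) • F v = f ⟨_, hj⟩ := by
    intro v j hj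
    apply Q.X_pow_smul_injective (i v)
    change (PowerSeries.X ^ i v : Q.A⟦X⟧) • (PowerSeries.X ^ j : Q.A⟦X⟧) • F v =
      (PowerSeries.X ^ i v : Q.A⟦X⟧) • f ⟨_, hj⟩
    rw [smul_comm, hF, ← hX, ← hX]
    congr 1
    ext
    exact smul_comm _ _ _
  have hsmul : ∀ (g : P.A⟦X⟧) (v : P.V),
      F (g • v) = PowerSeries.map (φ : P.A →+* Q.A) g • F v := by
    intro g v
    have hv : (PowerSeries.X ^ i v : P.A⟦X⟧) • g • v ∈ P.L := by
      rw [smul_comm]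
      exact P.L.smul_mem _ (hi v)
    apply Q.X_pow_smul_injective (i v)
    change (PowerSeries.X ^ i v : Q.A⟦X⟧) • F (g • v) = (PowerSeries.X ^ i v : Q.A⟦X⟧) • _ • F v
    rw [key _ _ hv, smul_comm (PowerSeries.X ^ i v : Q.A⟦X⟧), hF, ← hf]
    congr 1
    ext
    exact smul_comm _ _ _
  refine ⟨AddMonoidHom.mk' F fun v w => ?_, fun v => ?_, hsmul⟩
  · have hv : (PowerSeries.X ^ (i v + i w) : P.A⟦X⟧) • v ∈ P.L := by
      rw [add_comm, pow_add, mul_smul]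
      exact P.L.smul_mem _ (hi v)
    have hw : (PowerSeries.X ^ (i v + i w) : P.A⟦X⟧) • w ∈ P.L := by
      rw [pow_add, mul_smul]
      exact P.L.smul_mem _ (hi w)
    have hvw : (PowerSeries.X ^ (i v + i w) : P.A⟦X⟧) • (v + w) ∈ P.L := by
      rw [smul_add]
      exact P.L.add_mem hv hw
    apply Q.X_pow_smul_injective (i v + i w)
    change (PowerSeries.X ^ (i v + i w) : Q.A⟦X⟧) • F (v + w) =
      (PowerSeries.X ^ (i v + i w) : Q.A⟦X⟧) • (F v + F w)
    rw [smul_add, key _ _ hv, key _ _ hw, key _ _ hvw, ← map_add]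
    congr 1
    ext
    exact smul_add _ _ _
  · have hv : (PowerSeries.X ^ 0 : P.A⟦X⟧) • (v : P.V) ∈ P.L := by simp
    have := key v 0 hv
    rw [pow_zero, one_smul] at this
    rw [AddMonoidHom.mk'_apply, this]
    congr 1
    ext
    simp

/-- A semilinear map of lattices that is compatible with the connections and the sections extends to
an arrow of `𝒵`. -/
theorem exists_hom {n : ℕ}
    (hf : ∀ (g : P.A⟦X⟧) (v : P.L), f (g • v) = PowerSeries.map (φ : P.A →+* Q.A) g • f v)
    (hspan : Submodule.span Q.A⟦X⟧ (Set.range f) = Q.L)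
    (hnabla : ∀ (v : P.L) (hv : (PowerSeries.X ^ n : P.A⟦X⟧) • P.nabla v ∈ P.L),
      f ⟨_, hv⟩ = (PowerSeries.X ^ n : Q.A⟦X⟧) • Q.nabla (f v))
    (hP : PoleLE n P) (hs : f ⟨P.s, P.s_mem⟩ = Q.s) :
    ∃ F : P ⟶ Q, F.base = φ ∧ ∀ v : P.L, F.map v = f v := by
  obtain ⟨F, hF, hFs⟩ := exists_extension φ f hf
  have hX : ∀ (j : ℕ) (v : P.V), F ((PowerSeries.X ^ j : P.A⟦X⟧) • v) =
      (PowerSeries.X ^ j : Q.A⟦X⟧) • F v := fun j v => by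
    rw [hFs, map_pow, PowerSeries.map_X]
  have hL : ∀ v ∈ P.L, F (P.nabla v) = Q.nabla (F v) := by
    intro v hv
    apply Q.X_pow_smul_injective n
    change (PowerSeries.X ^ n : Q.A⟦X⟧) • F (P.nabla v) =
      (PowerSeries.X ^ n : Q.A⟦X⟧) • Q.nabla (F v)
    rw [← hX, hF ⟨v, hv⟩, ← hnabla ⟨v, hv⟩ (hP v hv)]
    exact hF ⟨_, hP v hv⟩
  refine ⟨{ base := φ, map := F, map_smul := hFs, span_map := ?_, map_nabla := fun v => ?_,
            map_s := (hF ⟨P.s, P.s_mem⟩).trans hs }, rfl, hF⟩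
  · rw [← hspan]
    congr 1
    ext x
    exact ⟨fun ⟨v, hv, h⟩ => ⟨⟨v, hv⟩, (hF ⟨v, hv⟩).symm.trans h⟩,
      fun ⟨v, h⟩ => ⟨v, v.2, (hF v).trans h⟩⟩
  · obtain ⟨i, hi⟩ := P.exists_pow_smul_mem v
    have h1 := hL _ hi
    rw [nabla_smul, map_add, hX, hX, nabla_smul, hFs, map_derivative, map_pow, PowerSeries.map_X,
      add_right_inj] at h1
    exact Q.X_pow_smul_injective i h1

end OfLattice

section Construction

variable (n : ℕ) (A : Type u) [CommRing A] [Algebra k A] (N : Type u) [AddCommGroup N]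
  [Module A⟦X⟧ N]

/-- The inclusion of a line bundle on the disc into its restriction to the punctured disc. -/
def latticeIncl : N →ₗ[A⟦X⟧] A⸨X⸩ ⊗[A⟦X⟧] N :=
  TensorProduct.mk A⟦X⟧ A⸨X⸩ N 1

theorem latticeIncl_injective [Module.Invertible A⟦X⟧ N] :
    Function.Injective (latticeIncl A N) := by
  have h := Module.Flat.rTensor_preserves_injective_linearMap (M := N)
    (Algebra.linearMap A⟦X⟧ A⸨X⸩) (by
      rw [Algebra.coe_linearMap, LaurentSeries.coe_algebraMap]
      exact HahnSeries.ofPowerSeries_injective)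
  have : latticeIncl A N = (Algebra.linearMap A⟦X⟧ A⸨X⸩).rTensor N ∘ₗ
      (TensorProduct.lid A⟦X⟧ N).symm.toLinearMap := by
    ext v
    simp [latticeIncl]
  rw [this]
  exact h.comp (TensorProduct.lid A⟦X⟧ N).symm.injective

variable {n A N} (D : N →+ N)

theorem tensorNabla_balanced
    (hD : ∀ (g : A⟦X⟧) (v : N),
      D (g • v) = (PowerSeries.X ^ n * PowerSeries.derivative A g) • v + g • D v)
    (r : A⟦X⟧) (f : A⸨X⸩) (v : N) :
    LaurentSeries.derivative A (r • f) ⊗ₜ[A⟦X⟧] v +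
        (HahnSeries.single (-(n : ℤ)) (1 : A) * r • f) ⊗ₜ[A⟦X⟧] D v =
      LaurentSeries.derivative A f ⊗ₜ[A⟦X⟧] (r • v) +
        (HahnSeries.single (-(n : ℤ)) (1 : A) * f) ⊗ₜ[A⟦X⟧] D (r • v) := by
  have h1 : (HahnSeries.single (-(n : ℤ)) (1 : A) * f) ⊗ₜ[A⟦X⟧]
      ((PowerSeries.X ^ n * PowerSeries.derivative A r) • v) =
      (algebraMap A⟦X⟧ A⸨X⸩ (PowerSeries.derivative A r) * f) ⊗ₜ[A⟦X⟧] v := by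
    rw [← TensorProduct.smul_tmul, Algebra.smul_def, map_mul]
    congr 1
    linear_combination (algebraMap A⟦X⟧ A⸨X⸩ (PowerSeries.derivative A r) * f) *
      X_pow_mul_single (A := A) n
  rw [hD, TensorProduct.tmul_add, h1, Algebra.smul_def, derivative_mul, derivative_coe,
    TensorProduct.add_tmul, ← TensorProduct.smul_tmul, ← TensorProduct.smul_tmul, Algebra.smul_def,
    Algebra.smul_def, mul_left_comm (algebraMap A⟦X⟧ A⸨X⸩ r)]
  abel

variable (hD : ∀ (g : A⟦X⟧) (v : N),
    D (g • v) = (PowerSeries.X ^ n * PowerSeries.derivative A g) • v + g • D v)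

/-- The connection on `A((t)) ⊗ N` such that `tⁿ ∇` restricts to `D` on `N`. -/
def tensorNabla : A⸨X⸩ ⊗[A⟦X⟧] N →+ A⸨X⸩ ⊗[A⟦X⟧] N :=
  TensorProduct.liftAddHom
    { toFun := fun f =>
        { toFun := fun v => LaurentSeries.derivative A f ⊗ₜ v +
            (HahnSeries.single (-(n : ℤ)) (1 : A) * f) ⊗ₜ D v
          map_zero' := by simp
          map_add' := fun v w => by
            simp only [map_add, TensorProduct.tmul_add]
            abel }
      map_zero' := by ext; simp
      map_add' := fun f g => by
        ext v
        simp only [map_add, TensorProduct.add_tmul, mul_add, AddMonoidHom.coe_mk, ZeroHom.coe_mk,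
          AddMonoidHom.add_apply]
        abel }
    fun r f v => tensorNabla_balanced D hD r f v

theorem tensorNabla_tmul (f : A⸨X⸩) (v : N) :
    tensorNabla D hD (f ⊗ₜ v) = LaurentSeries.derivative A f ⊗ₜ v +
      (HahnSeries.single (-(n : ℤ)) (1 : A) * f) ⊗ₜ D v := rfl

theorem tensorNabla_leibniz (f : A⸨X⸩) (x : A⸨X⸩ ⊗[A⟦X⟧] N) :
    tensorNabla D hD (f • x) =
      LaurentSeries.derivative A f • x + f • tensorNabla D hD x := by
  induction x with
  | zero => simp
  | add x y hx hy =>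
    rw [smul_add, map_add, hx, hy, map_add, smul_add, smul_add]
    abel
  | tmul g v =>
    rw [TensorProduct.smul_tmul', tensorNabla_tmul, tensorNabla_tmul, smul_add,
      TensorProduct.smul_tmul', TensorProduct.smul_tmul', TensorProduct.smul_tmul', smul_eq_mul,
      smul_eq_mul, smul_eq_mul, smul_eq_mul, derivative_mul, TensorProduct.add_tmul,
      mul_left_comm f, add_assoc]

theorem X_pow_smul_tensorNabla (v : N) :
    (PowerSeries.X ^ n : A⟦X⟧) • tensorNabla D hD (latticeIncl A N v) = latticeIncl A N (D v) := by
  have h1 : LaurentSeries.derivative A (1 : A⸨X⸩) = 0 := by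
    have := derivative_coe (A := A) 1
    rwa [map_one, PowerSeries.derivative_one, map_zero] at this
  change _ • tensorNabla D hD (1 ⊗ₜ v) = (1 : A⸨X⸩) ⊗ₜ D v
  rw [tensorNabla_tmul, h1, TensorProduct.zero_tmul, zero_add, mul_one, TensorProduct.smul_tmul',
    Algebra.smul_def, X_pow_mul_single]

end Construction

end FlatSection

end FlatAxes

end

noncomputable section

namespace FlatAxes

namespace FlatSection

variable {k : Type u} [Field k]

section Construction

variable {n : ℕ} {A : Type u} [CommRing A] [Algebra k A] {N : Type u} [AddCommGroup N]
  [Module A⟦X⟧ N] [Module.Invertible A⟦X⟧ N] (D : N →+ N)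
  (hD : ∀ (g : A⟦X⟧) (v : N),
    D (g • v) = (PowerSeries.X ^ n * PowerSeries.derivative A g) • v + g • D v)
  (s : N) (hs : D s = 0)

variable (k) in
/-- The point of `𝒵` given by a line bundle `N` on the disc, the operator `D = tⁿ ∇` on it, and a
flat section. -/
abbrev ofLattice : FlatSection.{u} k where
  A := A
  V := A⸨X⸩ ⊗[A⟦X⟧] N
  moduleBase := Module.compHom _ (PowerSeries.C (R := A))
  towerBase := by
    let _ : Module A (A⸨X⸩ ⊗[A⟦X⟧] N) := Module.compHom _ (PowerSeries.C (R := A))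
    exact IsScalarTower.of_algebraMap_smul fun r x => by
      rw [PowerSeries.algebraMap_apply, Algebra.algebraMap_self, RingHom.id_apply]
      rfl
  L := LinearMap.range (latticeIncl A N)
  invertible := Module.Invertible.congr
    (LinearEquiv.ofInjective (latticeIncl A N) (latticeIncl_injective A N))
  exists_pow_smul_mem v := by
    induction v with
    | zero => exact ⟨0, by simp⟩
    | tmul f v =>
      obtain ⟨i, p, hp⟩ := exists_X_pow_mul f
      refine ⟨i, p • v, ?_⟩
      rw [TensorProduct.smul_tmul', Algebra.smul_def, hp, latticeIncl, TensorProduct.mk_apply,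
        ← TensorProduct.smul_tmul, Algebra.smul_def, mul_one]
    | add x y hx hy =>
      obtain ⟨i, hi⟩ := hx
      obtain ⟨j, hj⟩ := hy
      refine ⟨i + j, ?_⟩
      rw [smul_add]
      refine add_mem ?_ ?_
      · rw [add_comm, pow_add, mul_smul]
        exact Submodule.smul_mem _ _ hi
      · rw [pow_add, mul_smul]
        exact Submodule.smul_mem _ _ hj
  nabla := tensorNabla D hD
  leibniz := tensorNabla_leibniz D hD
  s := latticeIncl A N s
  s_mem := ⟨s, rfl⟩
  nabla_s := by
    have h := X_pow_smul_tensorNabla D hD s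
    rw [hs, map_zero, ← algebraMap_smul A⸨X⸩] at h
    have h2 := congrArg (fun x => (HahnSeries.single (-(n : ℤ)) (1 : A) : A⸨X⸩) • x) h
    simp only [smul_smul, smul_zero] at h2
    rwa [mul_comm, X_pow_mul_single, one_smul] at h2

/-- The lattice of `ofLattice` is the given line bundle. -/
def ofLatticeEquiv : N ≃ₗ[A⟦X⟧] (ofLattice k D hD s hs).L :=
  LinearEquiv.ofInjective (latticeIncl A N) (latticeIncl_injective A N)

theorem ofLattice_poleLE : PoleLE n (ofLattice k D hD s hs) := by
  rintro _ ⟨v, rfl⟩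
  exact ⟨D v, (X_pow_smul_tensorNabla D hD v).symm⟩

/-- Arrows out of `ofLattice`. -/
theorem exists_hom_ofLattice {Q : FlatSection.{u} k} (φ : A →ₐ[k] Q.A) (f : N →+ Q.V)
    (hf : ∀ (g : A⟦X⟧) (v : N), f (g • v) = PowerSeries.map (φ : A →+* Q.A) g • f v)
    (hspan : Submodule.span Q.A⟦X⟧ (Set.range f) = Q.L)
    (hnabla : ∀ v, f (D v) = (PowerSeries.X ^ n : Q.A⟦X⟧) • Q.nabla (f v)) (hfs : f s = Q.s) :
    ∃ F : ofLattice k D hD s hs ⟶ Q, F.base = φ ∧ ∀ v : N, F.map (latticeIncl A N v) = f v := by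
  let e : N ≃ₗ[A⟦X⟧] (ofLattice k D hD s hs).L := ofLatticeEquiv D hD s hs
  obtain ⟨F, hF, hF'⟩ := exists_hom (P := ofLattice k D hD s hs) (Q := Q) (n := n) φ
    (f.comp e.symm.toLinearMap.toAddMonoidHom) (fun g v => by
      change f (e.symm (g • v)) = _
      rw [map_smul, hf]
      rfl) (by
      rw [← hspan]
      congr 1
      ext x
      constructor
      · rintro ⟨v, rfl⟩
        exact ⟨e.symm v, rfl⟩
      · rintro ⟨v, rfl⟩
        exact ⟨e v, congrArg f (e.symm_apply_apply v)⟩) (fun v hv => by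
      obtain ⟨v, rfl⟩ := e.surjective v
      change f (e.symm _) = _ • Q.nabla (f (e.symm (e v)))
      rw [e.symm_apply_apply, ← hnabla]
      congr 1
      rw [LinearEquiv.symm_apply_eq]
      exact Subtype.ext (X_pow_smul_tensorNabla D hD v)) (ofLattice_poleLE D hD s hs) (by
      change f (e.symm _) = _
      rw [← hfs]
      congr 1
      rw [LinearEquiv.symm_apply_eq]
      rfl)
  refine ⟨F, hF, fun v => (hF' (e v)).trans ?_⟩
  exact congrArg f (e.symm_apply_apply v)

end Construction

/-! ### Arrows of `𝒵^{≤ n}` are cocartesian, and base changes exist -/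

/-- The operator `tⁿ ∇` on the lattice. -/
def logNabla {n : ℕ} (P : FlatSection.{u} k) (hP : PoleLE n P) : P.L →+ P.L :=
  AddMonoidHom.mk' (fun v => ⟨(PowerSeries.X ^ n : P.A⟦X⟧) • P.nabla v, hP v v.2⟩) fun v w => by
    ext
    simp

theorem logNabla_smul {n : ℕ} (P : FlatSection.{u} k) (hP : PoleLE n P) (g : P.A⟦X⟧) (v : P.L) :
    P.logNabla hP (g • v) =
      (PowerSeries.X ^ n * PowerSeries.derivative P.A g) • v + g • P.logNabla hP v := by
  ext
  change (PowerSeries.X ^ n : P.A⟦X⟧) • P.nabla (g • (v : P.V)) =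
    (PowerSeries.X ^ n * PowerSeries.derivative P.A g) • (v : P.V) +
      g • (PowerSeries.X ^ n : P.A⟦X⟧) • P.nabla v
  rw [nabla_smul, smul_add, smul_smul, smul_comm g]

/-- Every arrow of `𝒵^{≤ n}` is cocartesian. -/
theorem exists_comp_eq {n : ℕ} {P Q R : FlatSection.{u} k} (hQ : PoleLE n Q) (F : P ⟶ Q)
    (G : P ⟶ R) (ρ : Q.A →ₐ[k] R.A) (h : ρ.comp F.base = G.base) :
    ∃ H : Q ⟶ R, H.base = ρ ∧ F ≫ H = G := by
  have hmap : ∀ g, PowerSeries.map (G.base : P.A →+* R.A) g = PowerSeries.map (ρ : Q.A →+* R.A)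
      (PowerSeries.map (F.base : P.A →+* Q.A) g) := fun g => by
    rw [← h]
    ext
    simp
  let FL : P.L →+ Q.L := ((toDiscLine k).map F).map
  have hFL : ∀ v : P.L, (FL v : Q.V) = F.map v := fun v => rfl
  have hFLspan : Submodule.span Q.A⟦X⟧ (Set.range FL) = ⊤ := ((toDiscLine k).map F).span_range
  obtain ⟨H, hH, hH'⟩ := exists_semilinear_lift (R := P.A⟦X⟧) (R' := Q.A⟦X⟧) (R'' := R.A⟦X⟧)
    (PowerSeries.map (F.base : P.A →+* Q.A)) (PowerSeries.map (ρ : Q.A →+* R.A))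
    FL ((toDiscLine k).map F).map_smul hFLspan
    (G.map.comp P.L.subtype.toAddMonoidHom) (fun g v => by
      rw [← hmap]
      exact G.map_smul g v)
  have hHL : ∀ v : P.L, H (FL v) = G.map v := hH'
  have hspan : Submodule.span R.A⟦X⟧ (Set.range H) = R.L := by
    apply le_antisymm
    · rw [Submodule.span_le]
      rintro _ ⟨v, rfl⟩
      have hv : v ∈ Submodule.span Q.A⟦X⟧ (Set.range FL) := hFLspan ▸ trivial
      induction hv using Submodule.span_induction with
      | mem x hx =>
        obtain ⟨w, rfl⟩ := hx
        rw [hHL]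
        exact G.map_mem w.2
      | zero => simp
      | add x y _ _ hx hy => rw [map_add]; exact R.L.add_mem hx hy
      | smul r x _ hx => rw [hH]; exact R.L.smul_mem _ hx
    · rw [← G.span_map]
      refine Submodule.span_mono ?_
      rintro _ ⟨v, hv, rfl⟩
      exact ⟨FL ⟨v, hv⟩, hHL ⟨v, hv⟩⟩
  have hnabla : ∀ v : Q.L, H (Q.logNabla hQ v) =
      (PowerSeries.X ^ n : R.A⟦X⟧) • R.nabla (H v) := by
    intro v
    have hv : v ∈ Submodule.span Q.A⟦X⟧ (Set.range FL) := hFLspan ▸ trivial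
    have hlog : ∀ w : P.L, ∀ hw : (PowerSeries.X ^ n : P.A⟦X⟧) • P.nabla w ∈ P.L,
        Q.logNabla hQ (FL w) = FL ⟨_, hw⟩ := fun w hw => by
      ext
      rw [hFL]
      change (PowerSeries.X ^ n : Q.A⟦X⟧) • Q.nabla (F.map w) = _
      rw [← F.map_nabla, F.map_X_pow_smul]
    induction hv using Submodule.span_induction with
    | mem x hx =>
      obtain ⟨w, rfl⟩ := hx
      -- `tⁿ ∇` need not preserve the lattice of `P`, but a multiple `tʲ tⁿ ∇` does
      obtain ⟨j, hj⟩ := P.exists_pow_smul_mem ((PowerSeries.X ^ n : P.A⟦X⟧) • P.nabla w)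
      have h1 : (PowerSeries.X ^ j : Q.A⟦X⟧) • Q.logNabla hQ (FL w) = FL ⟨_, hj⟩ := by
        ext
        rw [hFL]
        change (PowerSeries.X ^ j : Q.A⟦X⟧) • (PowerSeries.X ^ n : Q.A⟦X⟧) • Q.nabla (F.map w) = _
        rw [← F.map_nabla, F.map_X_pow_smul, F.map_X_pow_smul]
      apply R.X_pow_smul_injective j
      change (PowerSeries.X ^ j : R.A⟦X⟧) • H _ = (PowerSeries.X ^ j : R.A⟦X⟧) • _
      have h2 := congrArg H h1
      rw [hH, map_pow, PowerSeries.map_X] at h2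
      rw [h2, hHL, hHL, ← G.map_nabla, G.map_X_pow_smul, G.map_X_pow_smul]
    | zero => simp
    | add x y _ _ hx hy => rw [map_add, map_add, hx, hy, map_add, map_add, smul_add]
    | smul r x _ hx =>
      rw [logNabla_smul, map_add, hH, hH, hx, hH, nabla_smul, smul_add, map_mul, map_derivative,
        map_pow, PowerSeries.map_X, mul_smul, smul_comm (PowerSeries.map _ r)]
  obtain ⟨K, hK, hK'⟩ := exists_hom (P := Q) (Q := R) (n := n) ρ H hH hspan
    (fun v hv => hnabla v) hQ (by
      have : (⟨Q.s, Q.s_mem⟩ : Q.L) = FL ⟨P.s, P.s_mem⟩ := Subtype.ext F.map_s.symm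
      rw [this, hHL, G.map_s])
  refine ⟨K, hK, hom_ext_lattice ?_ fun v hv => ?_⟩
  · change K.base.comp F.base = G.base
    rw [hK, h]
  · exact (hK' (FL ⟨v, hv⟩)).trans (hHL ⟨v, hv⟩)

theorem comp_left_cancel {P Q R : FlatSection.{u} k} (F : P ⟶ Q) {H K : Q ⟶ R}
    (hbase : H.base = K.base) (h : F ≫ H = F ≫ K) : H = K := by
  refine hom_ext_lattice hbase fun v hv => ?_
  rw [← F.span_map] at hv
  induction hv using Submodule.span_induction with
  | mem x hx =>
    obtain ⟨w, -, rfl⟩ := hx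
    exact DFunLike.congr_fun (congrArg Hom.map h) w
  | zero => simp
  | add x y _ _ hx hy => rw [map_add, map_add, hx, hy]
  | smul r x _ hx => rw [H.map_smul, K.map_smul, hx, hbase]

section BaseChange

variable {A B : Type u} [CommRing A] [CommRing B] (φ : A →+* B) {n : ℕ} (N : Type u)
  [AddCommGroup N] [Module A⟦X⟧ N] (D : N →+ N)

/-- The base change of the operator `D = tⁿ ∇` along `A → B`.  It is only additive; the Leibniz rule
for `D` makes the formula for it compatible with the tensor product over `A[[t]]`. -/
theorem exists_baseChange_operator [Algebra A⟦X⟧ B⟦X⟧]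
    (hD : ∀ (g : A⟦X⟧) (v : N),
      D (g • v) = (PowerSeries.X ^ n * PowerSeries.derivative A g) • v + g • D v)
    (halg : algebraMap A⟦X⟧ B⟦X⟧ = PowerSeries.map φ) :
    ∃ E : B⟦X⟧ ⊗[A⟦X⟧] N →+ B⟦X⟧ ⊗[A⟦X⟧] N,
      (∀ (f : B⟦X⟧) (v : N), E (f ⊗ₜ v) =
        (PowerSeries.X ^ n * PowerSeries.derivative B f) ⊗ₜ v + f ⊗ₜ D v) ∧
      ∀ (g : B⟦X⟧) (x : B⟦X⟧ ⊗[A⟦X⟧] N),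
        E (g • x) = (PowerSeries.X ^ n * PowerSeries.derivative B g) • x + g • E x := by
  let E : B⟦X⟧ ⊗[A⟦X⟧] N →+ B⟦X⟧ ⊗[A⟦X⟧] N := TensorProduct.liftAddHom
    { toFun := fun f =>
        { toFun := fun v => (PowerSeries.X ^ n * PowerSeries.derivative B f) ⊗ₜ v + f ⊗ₜ D v
          map_zero' := by simp
          map_add' := fun v w => by
            simp only [map_add, TensorProduct.tmul_add]
            abel }
      map_zero' := by ext; simp
      map_add' := fun f g => by
        ext v
        simp only [map_add, TensorProduct.add_tmul, mul_add, AddMonoidHom.coe_mk, ZeroHom.coe_mk,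
          AddMonoidHom.add_apply]
        abel }
    fun r f v => by
      change (PowerSeries.X ^ n * PowerSeries.derivative B (r • f)) ⊗ₜ[A⟦X⟧] v +
        (r • f) ⊗ₜ[A⟦X⟧] D v = (PowerSeries.X ^ n * PowerSeries.derivative B f) ⊗ₜ[A⟦X⟧] (r • v) +
        f ⊗ₜ[A⟦X⟧] D (r • v)
      rw [hD, TensorProduct.tmul_add, ← TensorProduct.smul_tmul, ← TensorProduct.smul_tmul,
        ← TensorProduct.smul_tmul, Algebra.smul_def, Algebra.smul_def, Algebra.smul_def, halg,
        Derivation.leibniz, ← map_derivative, map_mul, map_pow, PowerSeries.map_X, ← add_assoc,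
        ← TensorProduct.add_tmul]
      congr 2
      simp only [smul_eq_mul]
      ring
  have hE : ∀ (f : B⟦X⟧) (v : N), E (f ⊗ₜ v) =
      (PowerSeries.X ^ n * PowerSeries.derivative B f) ⊗ₜ v + f ⊗ₜ D v := fun f v => rfl
  refine ⟨E, hE, fun g x => ?_⟩
  induction x with
  | zero => simp
  | add x y hx hy =>
    rw [smul_add, map_add, hx, hy, map_add, smul_add, smul_add]
    abel
  | tmul f v =>
    rw [TensorProduct.smul_tmul', hE, hE, smul_add, TensorProduct.smul_tmul',
      TensorProduct.smul_tmul', TensorProduct.smul_tmul', ← add_assoc, ← TensorProduct.add_tmul]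
    congr 2
    rw [smul_eq_mul, smul_eq_mul, smul_eq_mul, Derivation.leibniz, smul_eq_mul, smul_eq_mul]
    ring

end BaseChange

/-- Points of `𝒵^{≤ n}` can be base changed. -/
theorem exists_baseChange {n : ℕ} (P : FlatSection.{u} k) (hP : PoleLE n P) {B : Type u}
    [CommRing B] [Algebra k B] (φ : P.A →ₐ[k] B) :
    ∃ (Q : FlatSection.{u} k) (_ : PoleLE n Q) (F : P ⟶ Q) (e : B ≃ₐ[k] Q.A),
      ∀ a, F.base a = e (φ a) := by
  let _ : Algebra P.A⟦X⟧ B⟦X⟧ := (PowerSeries.map (φ : P.A →+* B)).toAlgebra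
  obtain ⟨E, hE, hE'⟩ := exists_baseChange_operator (φ : P.A →+* B) P.L (P.logNabla hP)
    (P.logNabla_smul hP) rfl
  let s : B⟦X⟧ ⊗[P.A⟦X⟧] P.L := 1 ⊗ₜ ⟨P.s, P.s_mem⟩
  have hDs : P.logNabla hP ⟨P.s, P.s_mem⟩ = 0 := by
    ext
    change (PowerSeries.X ^ n : P.A⟦X⟧) • P.nabla P.s = 0
    rw [P.nabla_s, smul_zero]
  have hs : E s = 0 := by
    rw [hE, hDs, PowerSeries.derivative_one, mul_zero, TensorProduct.zero_tmul,
      TensorProduct.tmul_zero, add_zero]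
  let Q : FlatSection.{u} k := ofLattice k E hE' s hs
  let ι : B⟦X⟧ ⊗[P.A⟦X⟧] P.L →ₗ[B⟦X⟧] Q.V := latticeIncl B (B⟦X⟧ ⊗[P.A⟦X⟧] P.L)
  let f : P.L →+ Q.V :=
    ι.toAddMonoidHom.comp (TensorProduct.mk P.A⟦X⟧ B⟦X⟧ P.L 1).toAddMonoidHom
  have hf : ∀ v, f v = ι (1 ⊗ₜ v) := fun v => rfl
  obtain ⟨F, hF, hF'⟩ := exists_hom (P := P) (Q := Q) (n := n) φ f (fun g v => by
      rw [hf, hf, ← TensorProduct.smul_tmul, Algebra.smul_def, mul_one]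
      refine Eq.trans ?_ (map_smul ι (PowerSeries.map (φ : P.A →+* B) g) _)
      rw [TensorProduct.smul_tmul', smul_eq_mul, mul_one]
      rfl) (by
      apply le_antisymm
      · rw [Submodule.span_le]
        rintro _ ⟨v, rfl⟩
        exact ⟨_, rfl⟩
      · rintro _ ⟨x, rfl⟩
        change ι x ∈ _
        induction x with
        | zero => rw [map_zero]; exact zero_mem _
        | add x y hx hy => rw [map_add]; exact add_mem hx hy
        | tmul g v =>
          have : ι (g ⊗ₜ v) = g • f v := by
            rw [hf, ← map_smul, TensorProduct.smul_tmul', smul_eq_mul, mul_one]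
          rw [this]
          exact Submodule.smul_mem _ _ (Submodule.subset_span ⟨v, rfl⟩)) (fun v hv => by
      refine Eq.trans ?_ (X_pow_smul_tensorNabla E hE' (1 ⊗ₜ v)).symm
      rw [hE, PowerSeries.derivative_one, mul_zero, TensorProduct.zero_tmul, zero_add]
      rfl) hP rfl
  exact ⟨Q, ofLattice_poleLE _ _ _ _, F, AlgEquiv.refl, fun a => by rw [hF]; rfl⟩

end FlatSection

end FlatAxes

end

noncomputable section

namespace FlatAxes

namespace FlatSection

variable {k : Type u} [Field k]

/-! ### Frames -/

/-- A trivialization `e` of the line bundle on the disc, such that `tⁿ ∇ e = - β e`. -/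
structure IsFrame (n : ℕ) (P : FlatSection.{u} k) (e : P.V) (β : P.A⟦X⟧) : Prop where
  span_eq : Submodule.span P.A⟦X⟧ {e} = P.L
  nabla_eq : (PowerSeries.X ^ n : P.A⟦X⟧) • P.nabla e = -(β • e)

namespace IsFrame

variable {n : ℕ} {P Q : FlatSection.{u} k} {e e' : P.V} {β β' : P.A⟦X⟧}

theorem mem (h : IsFrame n P e β) : e ∈ P.L := by
  rw [← h.span_eq]
  exact Submodule.mem_span_singleton_self e

theorem span_mk (h : IsFrame n P e β) :
    Submodule.span P.A⟦X⟧ {(⟨e, h.mem⟩ : P.L)} = ⊤ := by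
  apply Submodule.map_injective_of_injective P.L.injective_subtype
  rw [Submodule.map_span, Set.image_singleton, Submodule.map_top, Submodule.range_subtype]
  exact h.span_eq

theorem exists_smul_eq (h : IsFrame n P e β) {v : P.V} (hv : v ∈ P.L) :
    ∃ g : P.A⟦X⟧, g • e = v :=
  Submodule.mem_span_singleton.1 (h.span_eq ▸ hv)

theorem smul_injective (h : IsFrame n P e β) {g g' : P.A⟦X⟧} (hg : g • e = g' • e) : g = g' :=
  (bijective_smul_of_span h.span_mk).1 (Subtype.ext hg)

theorem X_pow_smul_nabla_smul (h : IsFrame n P e β) (g : P.A⟦X⟧) :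
    (PowerSeries.X ^ n : P.A⟦X⟧) • P.nabla (g • e) =
      (PowerSeries.X ^ n * PowerSeries.derivative P.A g - g * β) • e := by
  rw [nabla_smul, smul_add, smul_smul, smul_comm _ g, h.nabla_eq, smul_neg, smul_smul, sub_smul,
    sub_eq_add_neg]

/-- In a frame, the equation `∇ s = 0` for `s = g e` is `dg = gω`. -/
theorem equation (h : IsFrame n P e β) {g : P.A⟦X⟧} (hs : P.s = g • e) :
    PowerSeries.X ^ n * PowerSeries.derivative P.A g = g * β := by
  have h1 := h.X_pow_smul_nabla_smul g
  rw [← hs, P.nabla_s, smul_zero] at h1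
  rw [← sub_eq_zero]
  exact h.smul_injective (h1.symm.trans (zero_smul _ _).symm)

theorem smul (h : IsFrame n P e β) {f : P.A⟦X⟧} (hf : IsUnit f)
    (hβ : PowerSeries.X ^ n * PowerSeries.derivative P.A f = f * (β - β')) :
    IsFrame n P (f • e) β' where
  span_eq := by
    rw [← h.span_eq]
    exact Submodule.span_singleton_smul_eq hf e
  nabla_eq := by
    rw [h.X_pow_smul_nabla_smul, hβ, smul_smul, ← neg_smul]
    congr 1
    ring

theorem change_eq (h : IsFrame n P e β) {f : P.A⟦X⟧} (h' : IsFrame n P (f • e) β') :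
    PowerSeries.X ^ n * PowerSeries.derivative P.A f = f * (β - β') := by
  have h1 := h'.nabla_eq
  rw [h.X_pow_smul_nabla_smul, smul_smul, ← neg_smul] at h1
  linear_combination h.smul_injective h1

theorem map (h : IsFrame n P e β) (F : P ⟶ Q) :
    IsFrame n Q (F.map e) (PowerSeries.map (F.base : P.A →+* Q.A) β) where
  span_eq := by
    rw [← F.span_map, ← h.span_eq, span_image_span _ F.map F.map_smul, Set.image_singleton]
  nabla_eq := by
    rw [← F.map_nabla, ← F.map_X_pow_smul, h.nabla_eq, map_neg, F.map_smul]

theorem base_unique (h : IsFrame n P e β) (h' : IsFrame n P e β') : β = β' := by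
  have := h.nabla_eq.symm.trans h'.nabla_eq
  exact h.smul_injective (neg_injective this)

theorem hom_ext (h : IsFrame n P e β) {F G : P ⟶ Q} (h₁ : F.base = G.base)
    (h₂ : F.map e = G.map e) : F = G := by
  refine hom_ext_lattice h₁ fun v hv => ?_
  obtain ⟨g, rfl⟩ := h.exists_smul_eq hv
  rw [F.map_smul, G.map_smul, h₁, h₂]

theorem fiber_span (h : IsFrame n P e β) : Submodule.span P.A
    {(Submodule.Quotient.mk ⟨e, h.mem⟩ : Fiber P.A P.L)} = ⊤ := by
  rw [eq_top_iff]
  rintro x -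
  obtain ⟨⟨v, hv⟩, rfl⟩ := Submodule.Quotient.mk_surjective _ x
  obtain ⟨g, rfl⟩ := h.exists_smul_eq hv
  rw [Submodule.mem_span_singleton]
  refine ⟨PowerSeries.constantCoeff g, ?_⟩
  rw [← Submodule.Quotient.mk_smul, eq_comm, ← sub_eq_zero, ← Submodule.Quotient.mk_sub,
    fiber_mk_eq_zero]
  refine ⟨(PowerSeries.mk fun p => PowerSeries.coeff (p + 1) g : P.A⟦X⟧) • ⟨e, h.mem⟩, ?_⟩
  ext
  change (PowerSeries.X : P.A⟦X⟧) • (PowerSeries.mk fun p => PowerSeries.coeff (p + 1) g) • e =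
    g • e - PowerSeries.constantCoeff g • e
  rw [smul_smul, ← C_smul, ← sub_smul, ← PowerSeries.sub_const_eq_X_mul_shift]

theorem mk_smul (h : IsFrame n P e β) (g : P.A⟦X⟧) :
    (Submodule.Quotient.mk ⟨g • e, P.L.smul_mem g h.mem⟩ : Fiber P.A P.L) =
      PowerSeries.constantCoeff g • Submodule.Quotient.mk ⟨e, h.mem⟩ := by
  rw [← Submodule.Quotient.mk_smul, ← sub_eq_zero, ← Submodule.Quotient.mk_sub,
    fiber_mk_eq_zero]
  refine ⟨(PowerSeries.mk fun p => PowerSeries.coeff (p + 1) g : P.A⟦X⟧) • ⟨e, h.mem⟩, ?_⟩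
  ext
  change (PowerSeries.X : P.A⟦X⟧) • (PowerSeries.mk fun p => PowerSeries.coeff (p + 1) g) • e =
    g • e - PowerSeries.constantCoeff g • e
  rw [smul_smul, ← C_smul, ← sub_smul, ← PowerSeries.sub_const_eq_X_mul_shift]

theorem leadingCoeff_eq (h : IsFrame n P e β) (hn : 0 < n) (hP : PoleLE n P) :
    leadingCoeff hn P hP = PowerSeries.constantCoeff β := by
  refine FlatSection.leadingCoeff_eq hn P hP fun v hv => ?_
  obtain ⟨g, rfl⟩ := h.exists_smul_eq hv
  obtain ⟨m, rfl⟩ : ∃ m, n = m + 1 := ⟨n - 1, by omega⟩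
  refine ⟨(g * (PowerSeries.mk fun p => PowerSeries.coeff (p + 1) β) -
    PowerSeries.X ^ m * PowerSeries.derivative P.A g) • e, P.L.smul_mem _ h.mem, ?_⟩
  rw [h.X_pow_smul_nabla_smul, ← neg_smul, ← C_smul, smul_smul, smul_smul, ← add_smul]
  congr 1
  have := PowerSeries.sub_const_eq_X_mul_shift β
  linear_combination g * this

end IsFrame

/-- Every trivialization of the line bundle is a frame. -/
theorem exists_isFrame {n : ℕ} {P : FlatSection.{u} k} (hP : PoleLE n P) {e : P.V}
    (he : Submodule.span P.A⟦X⟧ {e} = P.L) : ∃ β : P.A⟦X⟧, IsFrame n P e β := by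
  have hmem : e ∈ P.L := by
    rw [← he]
    exact Submodule.mem_span_singleton_self e
  have h := hP e hmem
  rw [← he, Submodule.mem_span_singleton] at h
  obtain ⟨γ, h⟩ := h
  exact ⟨-γ, he, by rw [neg_smul, neg_neg, h]⟩

/-- A generator of the fibre at `t = 0` lifts to a trivialization of the line bundle on the disc. -/
theorem exists_span_eq {P : FlatSection.{u} k} {x : Fiber P.A P.L}
    (hx : Submodule.span P.A {x} = ⊤) :
    ∃ e : P.L, Submodule.Quotient.mk e = x ∧ Submodule.span P.A⟦X⟧ {(e : P.V)} = P.L := by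
  obtain ⟨e, rfl⟩ := Submodule.Quotient.mk_surjective _ x
  refine ⟨e, rfl, ?_⟩
  have htop : (⊤ : Submodule P.A⟦X⟧ P.L) ≤ Submodule.span P.A⟦X⟧ {e} := by
    refine Submodule.le_of_le_smul_of_le_jacobson_bot (I := Ideal.span {PowerSeries.X})
      Module.Finite.fg_top ?_ ?_
    · rw [Ideal.span_singleton_le_iff_mem, Ideal.mem_jacobson_bot]
      intro y
      rw [PowerSeries.isUnit_iff_constantCoeff]
      simp
    · rintro v -
      have hv : (Submodule.Quotient.mk v : Fiber P.A P.L) ∈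
        Submodule.span P.A {(Submodule.Quotient.mk e : Fiber P.A P.L)} := hx ▸ trivial
      obtain ⟨a, ha⟩ := Submodule.mem_span_singleton.1 hv
      rw [← Submodule.Quotient.mk_smul, eq_comm, ← sub_eq_zero, ← Submodule.Quotient.mk_sub,
        Submodule.Quotient.mk_eq_zero] at ha
      have h2 : v = (PowerSeries.C a : P.A⟦X⟧) • e + (v - a • e) := by
        ext
        change (v : P.V) = (PowerSeries.C a : P.A⟦X⟧) • (e : P.V) + (v - a • (e : P.V))
        rw [C_smul]
        abel
      rw [h2]
      exact add_mem (Submodule.mem_sup_left (Submodule.smul_mem _ _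
        (Submodule.mem_span_singleton_self e))) (Submodule.mem_sup_right ha)
  have h := congrArg (Submodule.map P.L.subtype) (top_le_iff.1 htop)
  rwa [Submodule.map_span, Set.image_singleton, Submodule.map_top, Submodule.range_subtype] at h

/-- The gauge can be normalized: a generator of the fibre at `t = 0` lifts to a trivialization for
which `ω` is a combination of `t⁻ⁿ dt, …, t⁻¹ dt`. -/
theorem exists_normalized_frame [CharZero k] {n : ℕ} {P : FlatSection.{u} k} (hP : PoleLE n P)
    {x : Fiber P.A P.L} (hx : Submodule.span P.A {x} = ⊤) :
    ∃ (e : P.L) (β : P.A⟦X⟧), IsFrame n P e β ∧ Submodule.Quotient.mk e = x ∧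
      ∀ i, n ≤ i → PowerSeries.coeff i β = 0 := by
  let _ : Algebra ℚ P.A := ((algebraMap k P.A).comp (algebraMap ℚ k)).toAlgebra
  obtain ⟨e, rfl, he⟩ := exists_span_eq hx
  obtain ⟨β, h⟩ := exists_isFrame hP he
  -- the gauge transformation `exp (∫ c)` subtracts from `β` its terms `tⁿ c` of degree at least `n`
  let c : P.A⟦X⟧ := PowerSeries.mk fun i => PowerSeries.coeff (i + n) β
  let f := expIntegral c
  have h' : IsFrame n P (f • (e : P.V)) (β - PowerSeries.X ^ n * c) :=
    h.smul (isUnit_expIntegral c) (by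
      rw [derivative_expIntegral]
      ring)
  refine ⟨⟨f • (e : P.V), h'.mem⟩, _, h', ?_, fun i hi => ?_⟩
  · refine (h.mk_smul f).trans ?_
    rw [constantCoeff_expIntegral, one_smul]
  · rw [map_sub, PowerSeries.coeff_X_pow_mul', if_pos hi, PowerSeries.coeff_mk,
      Nat.sub_add_cancel hi, sub_self]

/-- The normalized trivialization is determined by its value at `t = 0`. -/
theorem normalized_frame_unique [CharZero k] {n : ℕ} {P : FlatSection.{u} k}
    {e e' : P.V} {β β' : P.A⟦X⟧} (h : IsFrame n P e β) (h' : IsFrame n P e' β')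
    (hmk : (Submodule.Quotient.mk ⟨e, h.mem⟩ : Fiber P.A P.L) =
      Submodule.Quotient.mk ⟨e', h'.mem⟩)
    (hβ : ∀ i, n ≤ i → PowerSeries.coeff i β = 0)
    (hβ' : ∀ i, n ≤ i → PowerSeries.coeff i β' = 0) : e = e' := by
  obtain ⟨f, rfl⟩ := h.exists_smul_eq h'.mem
  have hf0 : PowerSeries.constantCoeff f = 1 := by
    rw [h.mk_smul] at hmk
    exact (bijective_smul_of_span h.fiber_span).1 (hmk.symm.trans (one_smul _ _).symm)
  have hf : IsUnit f := by
    rw [PowerSeries.isUnit_iff_constantCoeff, hf0]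
    exact isUnit_one
  obtain ⟨u, hu⟩ := hf.exists_left_inv
  have h1 := h.change_eq h'
  -- the two sides of `tⁿ f' f⁻¹ = β - β'` have no common degrees
  have h2 : PowerSeries.X ^ n * (PowerSeries.derivative P.A f * u) = β - β' := by
    linear_combination u * h1 + (β - β') * hu
  have h3 : PowerSeries.derivative P.A f * u = 0 := by
    ext i
    have := congrArg (PowerSeries.coeff (i + n)) h2
    rwa [PowerSeries.coeff_X_pow_mul, map_sub, hβ _ (by omega), hβ' _ (by omega), sub_zero] at this
  have h4 : PowerSeries.derivative P.A f = 0 := by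
    linear_combination f * h3 - PowerSeries.derivative P.A f * hu
  let _ : Algebra ℚ P.A := ((algebraMap k P.A).comp (algebraMap ℚ k)).toAlgebra
  have h5 : f = 1 := eq_of_derivative_eq_mul (c := 0) (by rw [h4, zero_mul])
    (by rw [PowerSeries.derivative_one, zero_mul]) (by rw [hf0, map_one])
  rw [h5, one_smul]

/-! ### Trivial line bundles -/

section Standard

variable {n : ℕ} {A : Type u} [CommRing A] [Algebra k A] {g β : A⟦X⟧}
  (h : PowerSeries.X ^ n * PowerSeries.derivative A g = g * β)

/-- The operator `tⁿ ∇` on `A[[t]]`, where `∇ = d - t⁻ⁿ β dt`. -/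
def standardOperator (n : ℕ) (β : A⟦X⟧) : A⟦X⟧ →+ A⟦X⟧ :=
  AddMonoidHom.mk' (fun v => PowerSeries.X ^ n * PowerSeries.derivative A v - v * β) fun v w => by
    rw [map_add]
    ring

theorem standardOperator_smul (f v : A⟦X⟧) : standardOperator n β (f • v) =
    (PowerSeries.X ^ n * PowerSeries.derivative A f) • v + f • standardOperator n β v := by
  simp only [standardOperator, AddMonoidHom.mk'_apply, smul_eq_mul, Derivation.leibniz]
  ring

variable (k) in
/-- The point of `𝒵^{≤ n}` given by the trivial line bundle with `∇ = d - t⁻ⁿ β dt` and `s = g`,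
where `dg = t⁻ⁿ g β dt`. -/
abbrev standard : FlatSection.{u} k :=
  ofLattice k (standardOperator n β) standardOperator_smul g (sub_eq_zero.2 h)

theorem standard_poleLE : PoleLE n (standard k h) := ofLattice_poleLE _ _ _ _

variable (k) in
/-- The basis of the trivial line bundle. -/
def standardBasis : (standard k h).V := latticeIncl A A⟦X⟧ 1

theorem smul_standardBasis (f : A⟦X⟧) :
    f • standardBasis k h = latticeIncl A A⟦X⟧ f := by
  rw [standardBasis, ← map_smul, smul_eq_mul, mul_one]

theorem isFrame_standardBasis : IsFrame n (standard k h) (standardBasis k h) β where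
  span_eq := by
    apply le_antisymm
    · rw [Submodule.span_singleton_le_iff_mem]
      exact ⟨1, rfl⟩
    · rintro _ ⟨f, rfl⟩
      rw [← smul_standardBasis h]
      exact Submodule.smul_mem _ _ (Submodule.mem_span_singleton_self _)
  nabla_eq := by
    rw [smul_standardBasis, ← map_neg]
    refine (X_pow_smul_tensorNabla _ standardOperator_smul (1 : A⟦X⟧)).trans ?_
    congr 1
    simp [standardOperator]

theorem standard_s : (standard k h).s = g • standardBasis k h := (smul_standardBasis h g).symm

/-- Arrows out of the standard points are given by frames. -/
theorem exists_standard_hom {Q : FlatSection.{u} k} (φ : A →ₐ[k] Q.A) {e : Q.V}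
    (he : IsFrame n Q e (PowerSeries.map (φ : A →+* Q.A) β))
    (hs : Q.s = PowerSeries.map (φ : A →+* Q.A) g • e) :
    ∃ F : standard k h ⟶ Q, F.base = φ ∧ F.map (standardBasis k h) = e := by
  let f : A⟦X⟧ →+ Q.V :=
    AddMonoidHom.mk' (fun v => PowerSeries.map (φ : A →+* Q.A) v • e) fun v w => by
      rw [map_add, add_smul]
  have hf : ∀ v, f v = PowerSeries.map (φ : A →+* Q.A) v • e := fun v => rfl
  have hf1 : f 1 = e := by rw [hf, map_one, one_smul]
  obtain ⟨F, hF, hF'⟩ := exists_hom_ofLattice (n := n) (standardOperator n β)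
    standardOperator_smul g (sub_eq_zero.2 h) φ f (fun v w => by
      rw [hf, hf, smul_eq_mul, map_mul, mul_smul]) (by
      apply le_antisymm
      · rw [Submodule.span_le]
        rintro _ ⟨v, rfl⟩
        exact Q.L.smul_mem _ he.mem
      · rw [← he.span_eq, Submodule.span_singleton_le_iff_mem]
        exact Submodule.subset_span ⟨1, hf1⟩) (fun v => by
      rw [hf, hf, he.X_pow_smul_nabla_smul, standardOperator, AddMonoidHom.mk'_apply, map_sub,
        map_mul, map_mul, map_pow, PowerSeries.map_X, map_derivative]) hs.symm
  exact ⟨F, hF, (hF' 1).trans hf1⟩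

end Standard

/-- The point of `𝒵^{≤ n}` over the universal ring. -/
abbrev universal (k : Type u) [Field k] (n : ℕ) (N : ℕ∞) : FlatSection.{u} k :=
  standard k (universal_equation (k := k) n N)

/-- The universal trivialization. -/
def universalBasis (k : Type u) [Field k] (n : ℕ) (N : ℕ∞) : (universal k n N).V :=
  standardBasis k (universal_equation (k := k) n N)

theorem isFrame_universalBasis (n : ℕ) (N : ℕ∞) : IsFrame n (universal k n N)
    (universalBasis k n N) (PowerSeries.mk (universalB n N)) :=
  isFrame_standardBasis _

theorem exists_universal_hom {n : ℕ} {N : ℕ∞} {Q : FlatSection.{u} k} {e : Q.V} {β : Q.A⟦X⟧}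
    (he : IsFrame n Q e β) (hN : ∀ i : ℕ, N ≤ i → PowerSeries.coeff i β = 0) :
    ∃ F : universal k n N ⟶ Q, F.map (universalBasis k n N) = e := by
  obtain ⟨g, hg⟩ := he.exists_smul_eq Q.s_mem
  have heq := he.equation hg.symm
  obtain ⟨F, -, hF⟩ := exists_standard_hom (universal_equation (k := k) n N)
    (universalLift g β heq hN) (Q := Q) (e := e) (by rwa [map_universalLift_universalB])
    (by rw [map_universalLift_universalA, hg])
  exact ⟨F, hF⟩

theorem universal_hom_ext {n : ℕ} {N : ℕ∞} {Q : FlatSection.{u} k} {F G : universal k n N ⟶ Q}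
    (h : F.map (universalBasis k n N) = G.map (universalBasis k n N)) : F = G := by
  have hF := (isFrame_universalBasis (k := k) n N).map F
  have hG := (isFrame_universalBasis (k := k) n N).map G
  rw [← h] at hG
  have hs : ∀ H : universal k n N ⟶ Q, Q.s =
      PowerSeries.map (H.base : UniversalRing k n N →+* Q.A) (PowerSeries.mk (universalA n N)) •
        H.map (universalBasis k n N) := fun H => by
    rw [← H.map_s, standard_s, H.map_smul]
    rfl
  have hs' := (hs F).symm.trans (hs G)
  rw [← h] at hs'
  exact (isFrame_universalBasis n N).hom_ext
    (universalRing_hom_ext (hF.smul_injective hs') (hF.base_unique hG)) h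

end FlatSection

end FlatAxes

end

noncomputable section

namespace FlatAxes

/-! ### The universal `𝔏⁺𝔾_m`-torsor -/

section Torsor

variable {k : Type u} [Field k]

namespace DiscLine

/-- The trivial line bundle on the disc (`DiscLine.trivial`, unfolded). -/
abbrev trivialLine (k : Type u) [Field k] : DiscLine.{u} k where
  A := k
  N := k⟦X⟧

variable {Q : DiscLine.{u} k}

/-- A trivialization of a line bundle on the disc is an arrow from the base point of `𝔹 𝔏⁺𝔾_m`. -/
theorem exists_trivialLine_hom {e : Q.N} (he : Submodule.span Q.A⟦X⟧ {e} = ⊤) :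
    ∃ f : trivialLine k ⟶ Q, f.map (1 : k⟦X⟧) = e := by
  have h1 : (PowerSeries.map (algebraMap k Q.A) (1 : k⟦X⟧)) • e = e := by rw [map_one, one_smul]
  let μ : k⟦X⟧ →+ Q.N := AddMonoidHom.mk' (fun p => PowerSeries.map (algebraMap k Q.A) p • e)
    fun p q => by rw [map_add, add_smul]
  let f : Hom (trivialLine k) Q :=
    { base := Algebra.ofId k Q.A
      map := μ
      map_smul := fun p (q : k⟦X⟧) => by
        change PowerSeries.map (algebraMap k Q.A) (p * q) • e =
          PowerSeries.map (algebraMap k Q.A) p • PowerSeries.map (algebraMap k Q.A) q • e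
        rw [map_mul, mul_smul]
      span_range := top_le_iff.1 (he.ge.trans ((Submodule.span_singleton_le_iff_mem _ _).2
        (Submodule.subset_span ⟨(1 : k⟦X⟧), h1⟩))) }
  exact ⟨f, h1⟩

theorem trivialLine_hom_map (f : trivialLine k ⟶ Q) (p : k⟦X⟧) :
    f.map p = PowerSeries.map (f.base : k →+* Q.A) p • f.map (1 : k⟦X⟧) := by
  rw [← f.map_smul]
  congr 1
  exact (mul_one p).symm

theorem trivialLine_hom_ext {f g : trivialLine k ⟶ Q}
    (h : f.map (1 : k⟦X⟧) = g.map (1 : k⟦X⟧)) : f = g := by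
  have hb : f.base = g.base := Subsingleton.elim (α := k →ₐ[k] Q.A) _ _
  refine DiscLine.Hom.ext hb (AddMonoidHom.ext fun p => ?_)
  rw [trivialLine_hom_map f p, trivialLine_hom_map g p, h, hb]

theorem span_map_one (f : trivialLine k ⟶ Q) :
    Submodule.span Q.A⟦X⟧ {f.map (1 : k⟦X⟧)} = ⊤ := by
  refine top_le_iff.1 (f.span_range.ge.trans (Submodule.span_le.2 ?_))
  rintro _ ⟨p, rfl⟩
  exact Submodule.mem_span_singleton.2 ⟨_, (trivialLine_hom_map f p).symm⟩

end DiscLine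

namespace FlatSection

/-- The line bundle on the disc (`FlatSection.toDiscLine` on objects, unfolded). -/
abbrev discLine (P : FlatSection.{u} k) : DiscLine.{u} k where
  A := P.A
  N := P.L

theorem span_coe_eq_iff {P : FlatSection.{u} k} {e : P.L} :
    Submodule.span P.A⟦X⟧ {(e : P.V)} = P.L ↔ Submodule.span P.A⟦X⟧ {e} = ⊤ := by
  rw [← (Submodule.map_injective_of_injective P.L.injective_subtype).eq_iff,
    Submodule.map_span, Set.image_singleton, Submodule.map_top, Submodule.range_subtype]
  rfl

end FlatSection

open FlatSection

theorem isTorsor (n : ℕ) : DerivedEqualizer.IsTorsor k n := by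
  let R : ZLE.{u} k n := ⟨universal k n ⊤, standard_poleLE _⟩
  have hframe := isFrame_universalBasis (k := k) n ⊤
  obtain ⟨f, hf⟩ := DiscLine.exists_trivialLine_hom (Q := (universal k n ⊤).discLine)
    (e := ⟨universalBasis k n ⊤, hframe.mem⟩) hframe.span_mk
  let T : StructuredArrow (DiscLine.trivial.{u} k) (ZLE.toDiscLine k n) :=
    StructuredArrow.mk (Y := R) f
  have hinit : ∀ U : StructuredArrow (DiscLine.trivial.{u} k) (ZLE.toDiscLine k n),
      ∃ F : T ⟶ U, ∀ G : T ⟶ U, G = F := by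
    intro U
    let g : DiscLine.trivialLine k ⟶ U.right.obj.discLine := U.hom
    obtain ⟨β, hβ⟩ := exists_isFrame U.right.property
      (span_coe_eq_iff.2 (DiscLine.span_map_one g))
    obtain ⟨F, hF⟩ := exists_universal_hom (N := ⊤) hβ fun i hi => absurd hi (by simp)
    have hval : ∀ F : universal k n ⊤ ⟶ U.right.obj,
        DiscLine.Hom.map (P := DiscLine.trivialLine k) (Q := U.right.obj.discLine)
          (f ≫ (toDiscLine k).map F) (1 : k⟦X⟧) =
            (⟨F.map (universalBasis k n ⊤), F.map_mem hframe.mem⟩ : U.right.obj.L) := fun F => by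
      change ((toDiscLine k).map F).map (f.map (1 : k⟦X⟧)) = _
      rw [hf]
      rfl
    refine ⟨StructuredArrow.homMk ⟨F⟩ (DiscLine.trivialLine_hom_ext
      (Q := U.right.obj.discLine) ((hval F).trans (Subtype.ext hF))),
      fun G => ?_⟩
    ext1
    apply InducedCategory.Hom.ext
    refine universal_hom_ext ?_
    have h2 : f ≫ (toDiscLine k).map G.right.hom = g := StructuredArrow.w G
    have h1 := (congrArg (fun F : DiscLine.trivialLine k ⟶ U.right.obj.discLine =>
      F.map (1 : k⟦X⟧)) h2).symm.trans (hval G.right.hom)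
    exact (congrArg Subtype.val h1).symm.trans hF.symm
  choose F hF using hinit
  refine ⟨T, ⟨IsInitial.ofUniqueHom F hF⟩, Ideal.Quotient.mkₐ k _,
    Ideal.Quotient.mkₐ_surjective k _, ?_, _, hf,
    standard_s (universal_equation (k := k) n ⊤), hframe.nabla_eq⟩
  refine Ideal.mk_ker.trans ?_
  rw [universalIdeal, tailIdeal_top, bot_sup_eq]
  rfl

end Torsor

/-! ### Trivialized points of `C / 𝔾_m` -/

section Axes

variable {k : Type u} [Field k]

namespace AxesModGm

/-- The point of `C / 𝔾_m` given by a point `(x, y)` of `C`. -/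
abbrev ofPoint (k : Type u) [Field k] {A : Type u} [CommRing A] [Algebra k A] (x y : A)
    (h : y * x = 0) : AxesModGm.{u} k where
  A := A
  M := A
  m := x
  y := y
  smul_eq_zero := h

variable {A : Type u} [CommRing A] [Algebra k A] {x y : A} (h : y * x = 0)

/-- Arrows from a trivialized point are given by trivializations. -/
theorem exists_ofPoint_hom {Q : AxesModGm.{u} k} (φ : A →ₐ[k] Q.A) {e : Q.M}
    (he : Submodule.span Q.A {e} = ⊤) (hx : φ x • e = Q.m) (hy : φ y = Q.y) :
    ∃ f : ofPoint k x y h ⟶ Q, f.base = φ ∧ f.map (1 : A) = e := by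
  have h1 : φ (1 : A) • e = e := by rw [map_one, one_smul]
  let f : Hom (ofPoint k x y h) Q :=
    { base := φ
      map := AddMonoidHom.mk' (fun a : A => φ a • e) fun a b => by rw [map_add, add_smul]
      map_smul := fun a b => by
        change φ (a * b) • e = φ a • φ b • e
        rw [map_mul, mul_smul]
      span_range := top_le_iff.1 (he.ge.trans ((Submodule.span_singleton_le_iff_mem _ _).2
        (Submodule.subset_span ⟨(1 : A), h1⟩)))
      map_m := hx
      map_y := hy }
  exact ⟨f, rfl, h1⟩

variable {Q : AxesModGm.{u} k} (f : ofPoint k x y h ⟶ Q)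

theorem ofPoint_hom_map (a : A) : f.map a = f.base a • f.map (1 : A) := by
  rw [← f.map_smul]
  congr 1
  exact (mul_one a).symm

theorem base_smul_eq_m : f.base x • f.map (1 : A) = Q.m := by
  rw [← ofPoint_hom_map h f, ← f.map_m]

theorem span_map_one : Submodule.span Q.A {f.map (1 : A)} = ⊤ := by
  refine top_le_iff.1 (f.span_range.ge.trans (Submodule.span_le.2 ?_))
  rintro _ ⟨a, rfl⟩
  exact Submodule.mem_span_singleton.2 ⟨_, (ofPoint_hom_map h f a).symm⟩

variable {f} in
theorem ofPoint_hom_ext {g : ofPoint k x y h ⟶ Q} (hb : f.base = g.base)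
    (h1 : f.map (1 : A) = g.map (1 : A)) : f = g := by
  refine hom_ext hb (AddMonoidHom.ext fun a => ?_)
  rw [ofPoint_hom_map h f, ofPoint_hom_map h g, hb, h1]

variable (k) in
/-- The cover `C → C / 𝔾_m` (`AxesModGm.cover`, unfolded). -/
abbrev coverPoint : AxesModGm.{u} k := ofPoint k (coordX k) (coordY k) (coordY_mul_coordX k)

theorem cover_hom_ext {Q : AxesModGm.{u} k} {f g : coverPoint k ⟶ Q}
    (h1 : f.map (1 : CoordRing k) = g.map (1 : CoordRing k)) : f = g := by
  have h := coordY_mul_coordX k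
  refine ofPoint_hom_ext h (coordRing_hom_ext ?_ (f.map_y.trans g.map_y.symm)) h1
  refine (bijective_smul_of_span (span_map_one h f)).1 ?_
  change f.base (coordX k) • f.map (1 : CoordRing k) = g.base (coordX k) • f.map (1 : CoordRing k)
  rw [base_smul_eq_m h f, h1, base_smul_eq_m h g]

/-- A trivialization of the line bundle is an arrow from the cover `C → C / 𝔾_m`. -/
theorem exists_cover_hom {Q : AxesModGm.{u} k} {e : Q.M} (he : Submodule.span Q.A {e} = ⊤) :
    ∃ f : coverPoint k ⟶ Q, f.map (1 : CoordRing k) = e := by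
  have hm : Q.m ∈ Submodule.span Q.A {e} := he ▸ trivial
  obtain ⟨a, ha⟩ := Submodule.mem_span_singleton.1 hm
  have h0 : Q.y * a = 0 := by
    refine (bijective_smul_of_span he).1 ?_
    change (Q.y * a) • e = (0 : Q.A) • e
    rw [mul_smul, ha, zero_smul, Q.smul_eq_zero]
  obtain ⟨f, -, hf⟩ := exists_ofPoint_hom (coordY_mul_coordX k) (coordLift a Q.y h0) he
    (by rw [coordLift_coordX, ha]) (coordLift_coordY _ _ _)
  exact ⟨f, hf⟩

variable (k) in
/-- For `z = y` and `z = x`, the base change along `C → C / 𝔾_m` of the axis `{z = 0}`, given as a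
full subcategory, is the closed subscheme `{z = 0}` of `C`. -/
theorem exists_initial_axis (z : CoordRing k) (p : ObjectProperty (AxesModGm.{u} k))
    (hp : ∀ (P : AxesModGm.{u} k) (f : coverPoint k ⟶ P), p P ↔ f.base z = 0) :
    ∃ T : StructuredArrow (coverPoint k) p.ι, Nonempty (IsInitial T) ∧
      ∀ (P : Type u) [CommRing P] (f : CoordRing k →+* P),
        TorIndependent f (Ideal.Quotient.mk (Ideal.span {z})) →
          TorIndependent f (baseHom (toRing k) T.hom) := by
  let I : Ideal (CoordRing k) := Ideal.span {z}
  let π : CoordRing k →ₐ[k] CoordRing k ⧸ I := Ideal.Quotient.mkₐ k I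
  have h0 : π (coordY k) * π (coordX k) = 0 := by rw [← map_mul, coordY_mul_coordX, map_zero]
  obtain ⟨f, hf, hf1⟩ := exists_ofPoint_hom (coordY_mul_coordX k)
    (Q := ofPoint k (π (coordX k)) (π (coordY k)) h0) π
    (e := (1 : CoordRing k ⧸ I)) Ideal.span_singleton_one (mul_one _) rfl
  let Q : p.FullSubcategory := ⟨ofPoint k (π (coordX k)) (π (coordY k)) h0, (hp _ f).2 (by
    rw [hf]
    exact Ideal.Quotient.eq_zero_iff_mem.2 (Ideal.mem_span_singleton_self _))⟩
  let T : StructuredArrow (coverPoint k) p.ι := StructuredArrow.mk (Y := Q) f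
  have hinit : ∀ U : StructuredArrow (coverPoint k) p.ι, ∃ F : T ⟶ U, ∀ G : T ⟶ U, G = F := by
    intro U
    let g : coverPoint k ⟶ U.right.obj := U.hom
    have hI : ∀ a ∈ I, g.base a = 0 := by
      intro a ha
      obtain ⟨c, rfl⟩ := Ideal.mem_span_singleton'.1 ha
      rw [map_mul, (hp _ g).1 U.right.property, mul_zero]
    let ψ : CoordRing k ⧸ I →ₐ[k] U.right.obj.A := Ideal.Quotient.liftₐ I g.base hI
    have hψ : ∀ a, ψ (π a) = g.base a := fun a => rfl
    obtain ⟨F, hF, hF1⟩ := exists_ofPoint_hom h0 (Q := U.right.obj) ψ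
      (span_map_one (coordY_mul_coordX k) g)
      (by rw [hψ]; exact base_smul_eq_m (coordY_mul_coordX k) g) (by rw [hψ]; exact g.map_y)
    refine ⟨StructuredArrow.homMk ⟨F⟩ (cover_hom_ext ?_), fun G => ?_⟩
    · change F.map (f.map (1 : CoordRing k)) = _
      rw [hf1]
      exact hF1
    · ext1
      apply InducedCategory.Hom.ext
      have hw : f ≫ G.right.hom = g := StructuredArrow.w G
      refine ofPoint_hom_ext h0 (Ideal.Quotient.algHom_ext k (AlgHom.ext fun a => ?_)) ?_
      · have h1 : G.right.hom.base (f.base a) = g.base a := by rw [← hw]; rfl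
        rw [hf] at h1
        refine h1.trans ?_
        change g.base a = F.base (π a)
        rw [hF, hψ]
      · have h1 : G.right.hom.map (f.map (1 : CoordRing k)) = g.map (1 : CoordRing k) := by
          rw [← hw]; rfl
        rw [hf1] at h1
        exact h1.trans hF1.symm
  choose F hF using hinit
  refine ⟨T, ⟨IsInitial.ofUniqueHom F hF⟩, fun P _ φ hφ => ?_⟩
  have : baseHom (toRing k) T.hom = Ideal.Quotient.mk I := by
    change (f.base : CoordRing k →+* CoordRing k ⧸ I) = _
    rw [hf]
    rfl
  rw [this]
  exact hφ

end AxesModGm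

end Axes

end FlatAxes

end

noncomputable section

namespace FlatAxes

/-! ### The base change of `𝒵^{≤ n}` to `C` -/

namespace FlatSection

variable {k : Type u} [Field k] {n : ℕ} (hn : 0 < n)

/-- The value of the evaluation map on a point of `𝒵^{≤ n}`: `ZLE.evalAxes` on objects, unfolded. -/
abbrev evalPoint (P : FlatSection.{u} k) (hP : PoleLE n P) : AxesModGm.{u} k where
  A := P.A
  M := Fiber P.A P.L
  m := Submodule.Quotient.mk ⟨P.s, P.s_mem⟩
  y := leadingCoeff hn P hP
  smul_eq_zero := leadingCoeff_smul_s hn P hP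

end FlatSection

open FlatSection AxesModGm

namespace FlatSection.IsFrame

variable {k : Type u} [Field k] {n : ℕ} {P : FlatSection.{u} k} {e : P.V} {g β : P.A⟦X⟧}

/-- In a frame, the evaluation map sends `(g, ω)` to the leading coefficients of `g` and `ω`. -/
theorem base_coordX (h : IsFrame n P e β) (hn : 0 < n) (hP : PoleLE n P) (hs : P.s = g • e)
    (f : coverPoint k ⟶ P.evalPoint hn hP)
    (hf : f.map (1 : CoordRing k) = Submodule.Quotient.mk ⟨e, h.mem⟩) :
    f.base (coordX k) = PowerSeries.constantCoeff g := by
  refine (bijective_smul_of_span h.fiber_span).1 ?_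
  have h1 := base_smul_eq_m (coordY_mul_coordX k) f
  rw [hf] at h1
  refine h1.trans (Eq.trans ?_ (h.mk_smul g))
  exact congrArg Submodule.Quotient.mk (Subtype.ext hs : (⟨P.s, P.s_mem⟩ : P.L) =
    ⟨g • e, P.L.smul_mem g h.mem⟩)

theorem base_coordY (h : IsFrame n P e β) (hn : 0 < n) (hP : PoleLE n P)
    (f : coverPoint k ⟶ P.evalPoint hn hP) : f.base (coordY k) = PowerSeries.constantCoeff β :=
  f.map_y.trans (h.leadingCoeff_eq hn hP)

end FlatSection.IsFrame

variable (k : Type u) [Field k] {n : ℕ} (hn : 0 < n)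

/-- The scheme of pairs `(g, ω)` such that `dg = gω` and `ω` is a combination of
`t⁻ⁿ dt, …, t⁻¹ dt`, as a point of `𝒵^{≤ n}`. -/
abbrev normalizedPoint (n : ℕ) : ZLE.{u} k n := ⟨universal k n n, standard_poleLE _⟩

/-- The base change of `𝒵^{≤ n}` to `C` is the scheme of pairs `(g, ω)` such that `dg = gω` and `ω`
is a combination of `t⁻ⁿ dt, …, t⁻¹ dt`, as the gauge can be normalized in a unique way. -/
theorem exists_initial_evalAxes [CharZero k] :
    ∃ f : coverPoint k ⟶ (universal k n n).evalPoint hn (standard_poleLE _),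
      f.map (1 : CoordRing k) =
          Submodule.Quotient.mk ⟨universalBasis k n n, (isFrame_universalBasis n n).mem⟩ ∧
        f.base (coordX k) = universalA n n 0 ∧ f.base (coordY k) = universalB n n 0 ∧
        Nonempty (IsInitial (StructuredArrow.mk (Y := normalizedPoint k n) f :
          StructuredArrow (coverPoint k) (ZLE.evalAxes k hn))) := by
  have hframe := isFrame_universalBasis (k := k) n n
  have hs : (universal k n n).s = PowerSeries.mk (universalA n n) • universalBasis k n n :=
    standard_s (universal_equation (k := k) n n)
  obtain ⟨f, hf⟩ := exists_cover_hom (k := k)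
    (Q := (universal k n n).evalPoint hn (standard_poleLE _)) hframe.fiber_span
  have hx : f.base (coordX k) = universalA n n 0 := by
    refine (hframe.base_coordX hn (standard_poleLE _) hs f hf).trans ?_
    rw [← PowerSeries.coeff_zero_eq_constantCoeff_apply, PowerSeries.coeff_mk]
  have hy : f.base (coordY k) = universalB n n 0 := by
    refine (hframe.base_coordY hn (standard_poleLE _) f).trans ?_
    rw [← PowerSeries.coeff_zero_eq_constantCoeff_apply, PowerSeries.coeff_mk]
  have hinit : ∀ U : StructuredArrow (coverPoint k) (ZLE.evalAxes k hn),
      ∃ F : (StructuredArrow.mk (Y := normalizedPoint k n) f :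
        StructuredArrow (coverPoint k) (ZLE.evalAxes k hn)) ⟶ U, ∀ G, G = F := by
    intro U
    let g : coverPoint k ⟶ U.right.obj.evalPoint hn U.right.property := U.hom
    obtain ⟨e, β, hβ, he, hβn⟩ := exists_normalized_frame U.right.property
      (span_map_one (coordY_mul_coordX k) g)
    obtain ⟨F, hF⟩ := exists_universal_hom (N := n) hβ fun i hi => hβn i (by exact_mod_cast hi)
    have hval : ∀ F : universal k n n ⟶ U.right.obj,
        Hom.map (P := coverPoint k) (Q := U.right.obj.evalPoint hn U.right.property)
          (f ≫ (ZLE.evalAxes k hn).map (X := normalizedPoint k n) (Y := U.right) ⟨F⟩)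
          (1 : CoordRing k) =
            (Submodule.Quotient.mk ⟨F.map (universalBasis k n n), F.map_mem hframe.mem⟩ :
              Fiber U.right.obj.A U.right.obj.L) := fun F => by
      change fiberMap F (f.map (1 : CoordRing k)) = _
      rw [hf, fiberMap_mk]
    refine ⟨StructuredArrow.homMk ⟨F⟩ (cover_hom_ext
      (Q := U.right.obj.evalPoint hn U.right.property) ((hval F).trans ?_)), fun G => ?_⟩
    · rw [← he]
      congr 1
      exact Subtype.ext hF
    · ext1
      apply InducedCategory.Hom.ext
      refine universal_hom_ext ?_
      have h2 : f ≫ (ZLE.evalAxes k hn).map G.right = g := StructuredArrow.w G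
      have h1 := (congrArg (fun F : coverPoint k ⟶ U.right.obj.evalPoint hn U.right.property =>
        F.map (1 : CoordRing k)) h2).symm.trans (hval G.right.hom)
      refine Eq.trans ?_ hF.symm
      refine normalized_frame_unique (hframe.map G.right.hom) hβ (h1.symm.trans he.symm)
        (fun i hi => ?_) hβn
      rw [PowerSeries.coeff_map, PowerSeries.coeff_mk, universalB_eq_zero (by exact_mod_cast hi),
        map_zero]
  choose F hF using hinit
  exact ⟨f, hf, hx, hy, ⟨IsInitial.ofUniqueHom F hF⟩⟩

theorem stackFlatAlongAxes [CharZero k] : StackFlatAlongAxes (ZLE.evalAxes k hn) := by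
  obtain ⟨f, -, hx, hy, hinit⟩ := exists_initial_evalAxes k hn
  refine ⟨_, hinit, flatAlongAxes_of_isExactPair _ ?_⟩
  change IsExactPair (f.base (coordX k)) (f.base (coordY k)) (UniversalRing k n n)
  rw [hx, hy]
  exact isExactPair_universal hn le_rfl

end FlatAxes

end

noncomputable section

namespace FlatAxes

/-! ### The universal trivialization of a line bundle -/

section Flat

variable {A : Type*} [CommRing A]

/-- The cokernel of an injective endomorphism `T` of a flat module is flat if `T` stays injective
modulo all ideals. -/
theorem flat_of_ker_eq_range {P B : Type*} [AddCommGroup P] [Module A P] [AddCommGroup B]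
    [Module A B] [Module.Flat A P] (T : P →ₗ[A] P) (π : P →ₗ[A] B) (hπ : Function.Surjective π)
    (hker : LinearMap.ker π = LinearMap.range T)
    (hT : ∀ (I : Ideal A) (q : P), T q ∈ I • (⊤ : Submodule A P) → q ∈ I • (⊤ : Submodule A P)) :
    Module.Flat A B := by
  rw [Module.Flat.iff_lift_lsmul_comp_subtype_injective]
  intro I hI
  rw [injective_iff_map_eq_zero]
  intro x hx
  let ΛP : I ⊗[A] P →ₗ[A] P := TensorProduct.lift ((LinearMap.lsmul A P).comp I.subtype)
  let ΛB : I ⊗[A] B →ₗ[A] B := TensorProduct.lift ((LinearMap.lsmul A B).comp I.subtype)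
  have hP : Function.Injective ΛP :=
    Module.Flat.iff_lift_lsmul_comp_subtype_injective.1 inferInstance hI
  obtain ⟨x, rfl⟩ := LinearMap.lTensor_surjective I hπ x
  have h1 : ΛB ∘ₗ π.lTensor I = π ∘ₗ ΛP := by
    ext
    simp [ΛB, ΛP]
  have h2 : ΛP ∘ₗ T.lTensor I = T ∘ₗ ΛP := by
    ext
    simp [ΛP]
  have h3 : π (ΛP x) = 0 := (LinearMap.congr_fun h1 x).symm.trans hx
  rw [← LinearMap.mem_ker, hker] at h3
  obtain ⟨q, hq⟩ := h3
  have hmem : ∀ x, ΛP x ∈ I • (⊤ : Submodule A P) := fun x => by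
    induction x with
    | zero => simp
    | tmul i p => exact Submodule.smul_mem_smul i.2 trivial
    | add x y hx hy => rw [map_add]; exact add_mem hx hy
  have hlift : ∀ p ∈ I • (⊤ : Submodule A P), ∃ y, ΛP y = p := fun p hp => by
    refine Submodule.smul_induction_on hp (fun i hi p _ => ⟨⟨i, hi⟩ ⊗ₜ p, rfl⟩) ?_
    rintro _ _ ⟨x, rfl⟩ ⟨y, rfl⟩
    exact ⟨x + y, map_add _ _ _⟩
  obtain ⟨y, rfl⟩ := hlift q (hT I q (hq ▸ hmem x))
  have h4 : T.lTensor I y = x := hP ((LinearMap.congr_fun h2 y).trans hq)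
  have h5 : π ∘ₗ T = 0 := by
    ext p
    exact LinearMap.mem_ker.1 (hker.ge ⟨p, rfl⟩)
  rw [← h4, ← LinearMap.comp_apply, ← LinearMap.lTensor_comp, h5, LinearMap.lTensor_zero,
    LinearMap.zero_apply]

/-- If `c` has no constant term, then `c - 1` is a non-zero-divisor modulo every ideal of the base,
being invertible as a power series. -/
theorem MvPolynomial.mem_of_sub_one_mul_mem {σ : Type*} {c q : MvPolynomial σ A}
    (hc : MvPolynomial.constantCoeff c = 0) (I : Ideal A)
    (h : (c - 1) * q ∈ I.map (MvPolynomial.C : A →+* MvPolynomial σ A)) :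
    q ∈ I.map (MvPolynomial.C : A →+* MvPolynomial σ A) := by
  have key : ∀ p : MvPolynomial σ A, p ∈ I.map (MvPolynomial.C : A →+* MvPolynomial σ A) ↔
      MvPolynomial.map (Ideal.Quotient.mk I) p = 0 := fun p => by
    rw [MvPolynomial.mem_map_C_iff, MvPolynomial.ext_iff]
    simp [MvPolynomial.coeff_map, Ideal.Quotient.eq_zero_iff_mem]
  rw [key, map_mul, map_sub, map_one] at h
  rw [key]
  have hu : IsUnit ((MvPolynomial.map (Ideal.Quotient.mk I) c - 1 : MvPolynomial σ (A ⧸ I)) :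
      MvPowerSeries σ (A ⧸ I)) := by
    rw [MvPowerSeries.isUnit_iff_constantCoeff]
    have : MvPolynomial.coeff 0 (MvPolynomial.map (Ideal.Quotient.mk I) c) = 0 := by
      rw [MvPolynomial.coeff_map, ← MvPolynomial.constantCoeff_eq, hc, map_zero]
    rw [← MvPowerSeries.coeff_zero_eq_constantCoeff_apply, MvPolynomial.coeff_coe,
      MvPolynomial.coeff_sub, this, zero_sub, MvPolynomial.coeff_zero_one]
    exact isUnit_one.neg
  apply MvPolynomial.coe_injective
  rw [MvPolynomial.coe_zero]
  refine (hu.mul_right_eq_zero).1 ?_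
  rw [← MvPolynomial.coe_mul, h, MvPolynomial.coe_zero]

section Sym

variable (E : Type*) [AddCommGroup E] [Module A E] [Module.Projective A E]

/-- The symmetric algebra of a projective module is a retract of a polynomial ring. -/
theorem exists_symmetricAlgebra_retract : ∃ (Φ : SymmetricAlgebra A E →ₐ[A] MvPolynomial E A)
    (Ψ : MvPolynomial E A →ₐ[A] SymmetricAlgebra A E), (∀ p, Ψ (Φ p) = p) ∧
      ∀ e, MvPolynomial.constantCoeff (Φ (SymmetricAlgebra.ι A E e)) = 0 := by
  obtain ⟨s, hs⟩ := Module.projective_def'.1 (inferInstance : Module.Projective A E)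
  let Ψ : MvPolynomial E A →ₐ[A] SymmetricAlgebra A E := MvPolynomial.aeval (SymmetricAlgebra.ι A E)
  let Φ : SymmetricAlgebra A E →ₐ[A] MvPolynomial E A :=
    SymmetricAlgebra.lift (Finsupp.linearCombination A MvPolynomial.X ∘ₗ s)
  have hΦ : ∀ e, Φ (SymmetricAlgebra.ι A E e) = Finsupp.linearCombination A MvPolynomial.X (s e) :=
    fun e => SymmetricAlgebra.lift_ι_apply _ e
  refine ⟨Φ, Ψ, fun p => ?_, fun e => ?_⟩
  · have : Ψ.comp Φ = AlgHom.id A _ := by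
      refine SymmetricAlgebra.algHom_ext (LinearMap.ext fun e => ?_)
      change Ψ (Φ (SymmetricAlgebra.ι A E e)) = SymmetricAlgebra.ι A E e
      have h1 : Ψ.toLinearMap ∘ₗ Finsupp.linearCombination A MvPolynomial.X =
          SymmetricAlgebra.ι A E ∘ₗ Finsupp.linearCombination A id := by
        ext
        simp [Ψ]
      rw [hΦ]
      refine (LinearMap.congr_fun h1 (s e)).trans ?_
      exact congrArg (SymmetricAlgebra.ι A E) (LinearMap.congr_fun hs e)
    exact DFunLike.congr_fun this p
  · rw [hΦ, Finsupp.linearCombination_apply, Finsupp.sum, map_sum]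
    refine Finset.sum_eq_zero fun i _ => ?_
    rw [MvPolynomial.smul_eq_C_mul, map_mul, MvPolynomial.constantCoeff_X, mul_zero]

variable {E}

/-- Setting an element `c` of the symmetric algebra without constant term equal to `1` gives a flat
algebra.  The absence of a constant term is expressed through maps to polynomial rings. -/
theorem flat_symmetricAlgebra_quotient {c : SymmetricAlgebra A E}
    (hc : ∀ Φ : SymmetricAlgebra A E →ₐ[A] MvPolynomial E A,
      (∀ e, MvPolynomial.constantCoeff (Φ (SymmetricAlgebra.ι A E e)) = 0) →
        MvPolynomial.constantCoeff (Φ c) = 0) :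
    Module.Flat A (SymmetricAlgebra A E ⧸ Ideal.span {c - 1}) := by
  obtain ⟨Φ, Ψ, hΨΦ, hΦ⟩ := exists_symmetricAlgebra_retract (A := A) E
  have : Module.Flat A (SymmetricAlgebra A E) :=
    Module.Flat.of_retract Φ.toLinearMap Ψ.toLinearMap (LinearMap.ext hΨΦ)
  refine flat_of_ker_eq_range (LinearMap.mulLeft A (c - 1))
    (Ideal.Quotient.mkₐ A (Ideal.span {c - 1})).toLinearMap Ideal.Quotient.mk_surjective ?_ ?_
  · ext p
    rw [LinearMap.mem_ker, LinearMap.mem_range]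
    refine Ideal.Quotient.eq_zero_iff_mem.trans (Ideal.mem_span_singleton.trans ?_)
    exact ⟨fun ⟨q, hq⟩ => ⟨q, hq.symm⟩, fun ⟨q, hq⟩ => ⟨q, hq.symm⟩⟩
  · intro I q hq
    rw [Ideal.smul_top_eq_map, Submodule.restrictScalars_mem] at hq ⊢
    have h1 : Φ q ∈ I.map (MvPolynomial.C : A →+* MvPolynomial E A) := by
      refine MvPolynomial.mem_of_sub_one_mul_mem (hc Φ hΦ) I ?_
      have h2 := Ideal.mem_map_of_mem (Φ : SymmetricAlgebra A E →+* MvPolynomial E A) hq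
      rw [Ideal.map_map] at h2
      have h3 : (Φ : SymmetricAlgebra A E →+* MvPolynomial E A).comp
          (algebraMap A (SymmetricAlgebra A E)) = MvPolynomial.C := Φ.comp_algebraMap
      rw [h3] at h2
      have h4 : Φ ((c - 1) * q) = (Φ c - 1) * Φ q := by rw [map_mul, map_sub, map_one]
      rw [← h4]
      exact h2
    have h2 := Ideal.mem_map_of_mem (Ψ : MvPolynomial E A →+* SymmetricAlgebra A E) h1
    rw [Ideal.map_map] at h2
    have h3 : (Ψ : MvPolynomial E A →+* SymmetricAlgebra A E).comp MvPolynomial.C =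
        algebraMap A (SymmetricAlgebra A E) := Ψ.comp_algebraMap
    rw [h3] at h2
    have h4 := hΨΦ q
    rw [← h4]
    exact h2

end Sym

end Flat

section Trivialization

variable {A : Type u} [CommRing A]

theorem eq_of_mul_eq_of_span {M C : Type*} [CommRing C] {μ : M → C}
    (hμ : Submodule.span C (Set.range μ) = ⊤) {z z' : C} (h : ∀ m, z * μ m = z' * μ m) :
    z = z' := by
  have h1 : (1 : C) ∈ Submodule.span C (Set.range μ) := hμ ▸ trivial
  have key : ∀ x ∈ Submodule.span C (Set.range μ), z * x = z' * x := by
    intro x hx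
    induction hx using Submodule.span_induction with
    | mem x hx => obtain ⟨m, rfl⟩ := hx; exact h m
    | zero => simp
    | add x y _ _ hx hy => rw [mul_add, mul_add, hx, hy]
    | smul r x _ hx => rw [smul_eq_mul, mul_left_comm, hx, mul_left_comm]
  simpa using key 1 h1

/-- A map `μ` from an invertible module to an algebra whose image generates the unit ideal has an
inverse `ν`, defined on the dual module. -/
theorem exists_dual_map {M : Type*} [AddCommGroup M] [Module A M] [Module.Invertible A M]
    {C : Type*} [CommRing C] [Algebra A C] (μ : M →ₗ[A] C)
    (hμ : Submodule.span C (Set.range μ) = ⊤) :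
    ∃ ν : Module.Dual A M →ₗ[A] C, ∀ φ m, ν φ * μ m = algebraMap A C (φ m) := by
  have hex : ∀ φ : Module.Dual A M, ∃ z : C, ∀ m, z * μ m = algebraMap A C (φ m) := by
    intro φ
    obtain ⟨h, hh, hh'⟩ := exists_semilinear_lift (algebraMap A C) (RingHom.id C)
      μ.toAddMonoidHom (fun r x => by
        change μ (r • x) = _
        rw [map_smul, Algebra.smul_def]
        rfl) hμ ((algebraMap A C).toAddMonoidHom.comp φ.toAddMonoidHom) (fun r x => by
        change algebraMap A C (φ (r • x)) = _
        rw [map_smul, smul_eq_mul, map_mul]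
        rfl)
    refine ⟨h 1, fun m => ?_⟩
    refine Eq.trans ?_ (hh' m)
    have := hh (μ m) 1
    rw [smul_eq_mul, mul_one, RingHom.id_apply, smul_eq_mul] at this
    rw [mul_comm, ← this]
    rfl
  choose ν hν using hex
  refine ⟨{ toFun := ν, map_add' := fun φ ψ => eq_of_mul_eq_of_span hμ fun m => ?_,
            map_smul' := fun a φ => eq_of_mul_eq_of_span hμ fun m => ?_ }, hν⟩
  · rw [hν, add_mul, hν, hν, LinearMap.add_apply, map_add]
  · rw [hν, RingHom.id_apply, smul_mul_assoc, hν, LinearMap.smul_apply, smul_eq_mul, map_mul,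
      Algebra.smul_def]

/-- The scheme of trivializations of a line bundle is affine and faithfully flat over the base:
there is a universal algebra `B` with a map `τ : M → B` that induces an isomorphism `B ⊗ M ≅ B`.
It is the quotient of `Sym (M ⊕ M*)` by the relation `c = 1`, where `c` is the canonical element of
`M ⊗ M*`. -/
theorem exists_trivialization (M : Type u) [AddCommGroup M] [Module A M] [Module.Invertible A M] :
    ∃ (B : Type u) (_ : CommRing B) (_ : Algebra A B) (τ : M →ₗ[A] B),
      Module.FaithfullyFlat A B ∧ Submodule.span B (Set.range τ) = ⊤ ∧
      ∀ (C : Type u) [CommRing C] [Algebra A C] (μ : M →ₗ[A] C),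
        Submodule.span C (Set.range μ) = ⊤ → ∃ θ : B →ₐ[A] C, (∀ m, θ (τ m) = μ m) ∧
          ∀ θ' : B →ₐ[A] C, (∀ m, θ' (τ m) = μ m) → θ' = θ := by
  let E := M × Module.Dual A M
  let P := SymmetricAlgebra A E
  let x : M →ₗ[A] P := SymmetricAlgebra.ι A E ∘ₗ LinearMap.inl A M (Module.Dual A M)
  let ξ : Module.Dual A M →ₗ[A] P := SymmetricAlgebra.ι A E ∘ₗ LinearMap.inr A M (Module.Dual A M)
  -- the canonical element `c` of degree two, such that `x m * ξ φ = φ m • c`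
  let pair : Module.Dual A M ⊗[A] M →ₗ[A] P :=
    TensorProduct.lift (((LinearMap.mul A P).compl₂ x).comp ξ)
  have hpair : ∀ φ m, pair (φ ⊗ₜ m) = ξ φ * x m := fun φ m => rfl
  let ev := Module.Invertible.linearEquiv A M
  have hev : ∀ φ m, ev (φ ⊗ₜ m) = φ m := fun φ m => rfl
  let c : P := pair (ev.symm 1)
  have hc : ∀ φ m, ξ φ * x m = φ m • c := by
    intro φ m
    rw [← hpair, ← map_smul, ← map_smul, smul_eq_mul, mul_one, ← hev, ev.symm_apply_apply]
  let J : Ideal P := Ideal.span {c - 1}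
  let π : P →ₐ[A] P ⧸ J := Ideal.Quotient.mkₐ A J
  have hπc : π c = 1 := by
    rw [← sub_eq_zero, ← map_one π, ← map_sub]
    exact Ideal.Quotient.eq_zero_iff_mem.2 (Ideal.mem_span_singleton_self _)
  let τ : M →ₗ[A] P ⧸ J := π.toLinearMap ∘ₗ x
  have hτ : ∀ m, τ m = π (x m) := fun m => rfl
  have hspan : Submodule.span (P ⧸ J) (Set.range τ) = ⊤ := by
    refine (Ideal.eq_top_iff_one _).2 ?_
    rw [← hπc]
    change π (pair (ev.symm 1)) ∈ _
    induction ev.symm 1 with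
    | zero => simp
    | add x y hx hy => rw [map_add, map_add]; exact add_mem hx hy
    | tmul φ m =>
      rw [hpair, map_mul]
      exact Submodule.smul_mem _ _ (Submodule.subset_span ⟨m, rfl⟩)
  have huniv : ∀ (C : Type u) [CommRing C] [Algebra A C] (μ : M →ₗ[A] C),
      Submodule.span C (Set.range μ) = ⊤ → ∃ θ : (P ⧸ J) →ₐ[A] C, (∀ m, θ (τ m) = μ m) ∧
        ∀ θ' : (P ⧸ J) →ₐ[A] C, (∀ m, θ' (τ m) = μ m) → θ' = θ := by
    intro C _ _ μ hμ
    obtain ⟨ν, hν⟩ := exists_dual_map μ hμ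
    let θ₀ : P →ₐ[A] C := SymmetricAlgebra.lift (μ.coprod ν)
    have hx : ∀ m, θ₀ (x m) = μ m := fun m =>
      (SymmetricAlgebra.lift_ι_apply _ _).trans (LinearMap.congr_fun (LinearMap.coprod_inl μ ν) m)
    have hξ : ∀ φ, θ₀ (ξ φ) = ν φ := fun φ =>
      (SymmetricAlgebra.lift_ι_apply _ _).trans (LinearMap.congr_fun (LinearMap.coprod_inr μ ν) φ)
    have hθc : θ₀ c = 1 := by
      have : ∀ z, θ₀ (pair z) = algebraMap A C (ev z) := fun z => by
        induction z with
        | zero => simp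
        | add x y hx hy => simp only [map_add, hx, hy]
        | tmul φ m => rw [hpair, map_mul, hx, hξ, hν, hev]
      rw [this, ev.apply_symm_apply, map_one]
    let θ : (P ⧸ J) →ₐ[A] C := Ideal.Quotient.liftₐ J θ₀ fun p hp => by
      obtain ⟨q, rfl⟩ := Ideal.mem_span_singleton'.1 hp
      rw [map_mul, map_sub, hθc, map_one, sub_self, mul_zero]
    have hθ : ∀ p, θ (π p) = θ₀ p := fun p => rfl
    refine ⟨θ, fun m => (hθ _).trans (hx m), fun θ' hθ' => ?_⟩
    refine Ideal.Quotient.algHom_ext A (SymmetricAlgebra.algHom_ext (LinearMap.ext ?_))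
    rintro ⟨m, φ⟩
    have h1 : SymmetricAlgebra.ι A E (m, φ) = x m + ξ φ := by
      change _ = SymmetricAlgebra.ι A E (m, 0) + SymmetricAlgebra.ι A E (0, φ)
      rw [← map_add, Prod.mk_add_mk, add_zero, zero_add]
    change θ' (π (SymmetricAlgebra.ι A E (m, φ))) = θ (π (SymmetricAlgebra.ι A E (m, φ)))
    rw [h1, map_add, map_add, map_add, ← hτ, hθ', hτ, hθ, hx, hθ, hξ]
    congr 1
    refine eq_of_mul_eq_of_span hμ fun m => ?_
    rw [hν, ← hθ' m, hτ, ← map_mul, ← map_mul, hc, map_smul, map_smul, hπc, map_one,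
      Algebra.smul_def, mul_one]
  refine ⟨P ⧸ J, inferInstance, inferInstance, τ, ?_, hspan, huniv⟩
  have hflat : Module.Flat A (P ⧸ J) := flat_symmetricAlgebra_quotient fun Φ hΦ => by
    change MvPolynomial.constantCoeff (Φ (pair (ev.symm 1))) = 0
    induction ev.symm 1 with
    | zero => simp
    | add x y hx hy => rw [map_add, map_add, map_add, hx, hy, add_zero]
    | tmul φ m =>
      rw [hpair, map_mul, map_mul]
      exact mul_eq_zero_of_left (hΦ _) _
  refine { hflat with submodule_ne_top := fun 𝔪 h𝔪 htop => ?_ }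
  -- a line bundle over the residue field `A ⧸ 𝔪` is trivial, which gives a point of `B` over it
  let _ : Field (A ⧸ 𝔪) := Ideal.Quotient.field 𝔪
  have hfree : Module.Free (A ⧸ 𝔪) ((A ⧸ 𝔪) ⊗[A] M) := inferInstance
  obtain ⟨e⟩ := Module.Invertible.free_iff_linearEquiv.1 hfree
  let μ : M →ₗ[A] A ⧸ 𝔪 := (e.restrictScalars A).toLinearMap ∘ₗ TensorProduct.mk A (A ⧸ 𝔪) M 1
  have hμ : Submodule.span (A ⧸ 𝔪) (Set.range μ) = ⊤ := by
    rw [eq_top_iff]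
    rintro z -
    obtain ⟨y, rfl⟩ := e.surjective z
    induction y with
    | zero => simp
    | add x y hx hy => rw [map_add]; exact add_mem hx hy
    | tmul a m =>
      have : e (a ⊗ₜ m) = a • μ m := by
        change _ = a • e (1 ⊗ₜ m)
        rw [← map_smul, TensorProduct.smul_tmul', smul_eq_mul, mul_one]
      rw [this]
      exact Submodule.smul_mem _ _ (Submodule.subset_span ⟨m, rfl⟩)
  obtain ⟨θ, -, -⟩ := huniv (A ⧸ 𝔪) μ hμ
  have h1 : (1 : P ⧸ J) ∈ 𝔪 • (⊤ : Submodule A (P ⧸ J)) := htop.ge trivial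
  have h2 : ∀ y ∈ 𝔪 • (⊤ : Submodule A (P ⧸ J)), θ y = 0 := fun y hy => by
    refine Submodule.smul_induction_on hy (fun a ha p _ => ?_) fun x y hx hy => ?_
    · rw [map_smul, Algebra.smul_def]
      exact mul_eq_zero_of_left (Ideal.Quotient.eq_zero_iff_mem.2 ha) _
    · rw [map_add, hx, hy, add_zero]
  have h3 := h2 1 h1
  rw [map_one] at h3
  exact one_ne_zero h3

end Trivialization

end FlatAxes

end

noncomputable section

namespace FlatAxes

/-! ### Flat covers -/

variable {k : Type u} [Field k]

namespace AxesModGm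

/-- Every arrow of `C / 𝔾_m` is cocartesian. -/
theorem exists_comp_eq {P Q R : AxesModGm.{u} k} (F : P ⟶ Q) (G : P ⟶ R) (ρ : Q.A →ₐ[k] R.A)
    (h : ρ.comp F.base = G.base) : ∃ H : Q ⟶ R, H.base = ρ ∧ F ≫ H = G := by
  have hb : ∀ a, ρ (F.base a) = G.base a := fun a => DFunLike.congr_fun h a
  obtain ⟨H, hH, hH'⟩ := exists_semilinear_lift (F.base : P.A →+* Q.A) (ρ : Q.A →+* R.A) F.map
    F.map_smul F.span_range G.map (fun r x => (G.map_smul r x).trans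
      (congrArg (· • G.map x) (hb r).symm))
  refine ⟨{ base := ρ, map := H, map_smul := hH, span_range := ?_, map_m := ?_, map_y := ?_ },
    rfl, hom_ext h (AddMonoidHom.ext hH')⟩
  · refine top_le_iff.1 (G.span_range.ge.trans (Submodule.span_mono ?_))
    rintro _ ⟨x, rfl⟩
    exact ⟨F.map x, hH' x⟩
  · rw [← F.map_m, hH', G.map_m]
  · rw [← F.map_y, hb, G.map_y]

theorem comp_left_cancel {P Q R : AxesModGm.{u} k} (F : P ⟶ Q) {H K : Q ⟶ R}
    (hbase : H.base = K.base) (h : F ≫ H = F ≫ K) : H = K :=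
  hom_ext hbase (semilinear_ext (H.base : Q.A →+* R.A) F.span_range H.map_smul
    (fun r x => by rw [K.map_smul, hbase]; rfl)
    fun x => DFunLike.congr_fun (congrArg Hom.map h) x)

/-- `C → C / 𝔾_m` is a flat cover. -/
theorem isFlatCover_cover : IsFlatCover (toRing k) (coverPoint k) := by
  intro P
  obtain ⟨B, _, _, τ, hflat, hspan, huniv⟩ := exists_trivialization (A := P.A) P.M
  let _ : Algebra k B := ((algebraMap P.A B).comp (algebraMap k P.A)).toAlgebra
  have tower : IsScalarTower k P.A B := IsScalarTower.of_algebraMap_eq fun _ => rfl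
  have h0 : algebraMap P.A B P.y * τ P.m = 0 := by
    rw [← Algebra.smul_def, ← map_smul, P.smul_eq_zero, map_zero]
  let Q : AxesModGm.{u} k := ofPoint k (τ P.m) (algebraMap P.A B P.y) h0
  let i : Hom P Q :=
    { base := IsScalarTower.toAlgHom k P.A B
      map := τ.toAddMonoidHom
      map_smul := fun a x => (map_smul τ a x).trans (Algebra.smul_def _ _)
      span_range := hspan
      map_m := rfl
      map_y := rfl }
  have he : Submodule.span B {(1 : B)} = ⊤ := Ideal.span_singleton_one
  obtain ⟨j, hj⟩ := exists_cover_hom (Q := Q) he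
  let i' : P ⟶ Q := i
  have hflat' : (baseHom (toRing k) i').FaithfullyFlat :=
    (RingHom.faithfullyFlat_algebraMap_iff (R := P.A) (S := B)).2 hflat
  have hdesc : ∀ (R : AxesModGm.{u} k) (f : P ⟶ R) (g : coverPoint k ⟶ R),
      ∃ d : Q ⟶ R, (i' ≫ d = f ∧ j ≫ d = g) ∧
        ∀ d' : Q ⟶ R, i' ≫ d' = f → j ≫ d' = g → d' = d := by
    intro R f g
    let _ : Algebra P.A R.A := (f.base : P.A →+* R.A).toAlgebra
    have hbij := bijective_smul_of_span (span_map_one (coordY_mul_coordX k) g)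
    let ε : R.A ≃ₗ[R.A] R.M := LinearEquiv.ofBijective
      (LinearMap.toSpanSingleton R.A R.M (g.map (1 : CoordRing k))) hbij
    have hε : ∀ a, ε a = a • g.map (1 : CoordRing k) := fun a => rfl
    let μ : P.M →ₗ[P.A] R.A :=
      { toFun := fun x => ε.symm (f.map x)
        map_add' := fun x y => by rw [map_add, map_add]
        map_smul' := fun a x => by
          rw [f.map_smul, map_smul]
          rfl }
    have hμ : ∀ x, μ x • g.map (1 : CoordRing k) = f.map x := fun x => by
      rw [← hε]
      exact ε.apply_symm_apply _
    have hμspan : Submodule.span R.A (Set.range μ) = ⊤ := by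
      have h1 : Set.range μ = ε.symm.toLinearMap '' Set.range f.map := by
        rw [← Set.range_comp]
        rfl
      rw [h1, ← Submodule.map_span, f.span_range, Submodule.map_top, LinearEquiv.range]
    obtain ⟨θ, hθ, hθu⟩ := huniv R.A μ hμspan
    let θk : B →ₐ[k] R.A := { θ with
      commutes' := fun r => (θ.commutes (algebraMap k P.A r)).trans (f.base.commutes r) }
    have hθk : ∀ b, θk b = θ b := fun b => rfl
    obtain ⟨d, hd, hd1⟩ := exists_ofPoint_hom h0 (Q := R) θk
      (span_map_one (coordY_mul_coordX k) g) (by rw [hθk, hθ, hμ, f.map_m])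
      ((θ.commutes P.y).trans f.map_y)
    refine ⟨d, ⟨?_, ?_⟩, fun d' h1 h2 => ?_⟩
    · refine hom_ext (AlgHom.ext fun a => ?_) (AddMonoidHom.ext fun x => ?_)
      · change d.base (algebraMap P.A B a) = f.base a
        rw [hd]
        exact θ.commutes a
      · change d.map (τ x) = f.map x
        rw [ofPoint_hom_map h0 d, hd, hd1, hθk, hθ, hμ]
    · refine cover_hom_ext ?_
      change d.map (j.map (1 : CoordRing k)) = _
      rw [hj]
      exact hd1
    · have h1' : d'.map (1 : B) = g.map (1 : CoordRing k) := by
        rw [← h2, ← hj]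
        rfl
      refine ofPoint_hom_ext h0 ?_ (h1'.trans hd1.symm)
      let θ' : B →ₐ[P.A] R.A := { (d'.base : B →+* R.A) with
        commutes' := fun a => DFunLike.congr_fun (congrArg Hom.base h1) a }
      have h3 : θ' = θ := hθu θ' fun m => by
        refine hbij.1 ?_
        change d'.base (τ m) • g.map (1 : CoordRing k) = μ m • g.map (1 : CoordRing k)
        rw [hμ, ← h1', ← ofPoint_hom_map h0 d', ← h1]
        rfl
      rw [hd]
      exact AlgHom.ext fun b => DFunLike.congr_fun h3 b
  choose d hd hu using hdesc
  exact ⟨Q, i', j, ⟨BinaryCofan.IsColimit.mk _ (fun f g => d _ f g)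
    (fun f g => (hd _ f g).1) (fun f g => (hd _ f g).2) fun f g m => hu _ f g m⟩, hflat'⟩

end AxesModGm

open FlatSection AxesModGm

/-- A flat cover of `C / 𝔾_m` pulls back to a flat cover of `𝒵^{≤ n}`. -/
theorem isFlatCover_right {n : ℕ} (hn : 0 < n) {v : AxesModGm.{u} k}
    (hv : IsFlatCover (AxesModGm.toRing k) v) (T : StructuredArrow v (ZLE.evalAxes k hn))
    (hT : IsInitial T) : IsFlatCover (ZLE.toRing k n) T.right := by
  intro z
  let F := ZLE.evalAxes k hn
  obtain ⟨w, i, j, ⟨hw⟩, hflat⟩ := hv (F.obj z)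
  obtain ⟨Q, hQ, f, e, hf⟩ := exists_baseChange z.obj z.property (B := w.A) i.base
  let q : ZLE.{u} k n := ⟨Q, hQ⟩
  let f' : z ⟶ q := ⟨f⟩
  obtain ⟨θ, hθ, hiθ⟩ := AxesModGm.exists_comp_eq (R := F.obj q) i (F.map f') e.toAlgHom
    (AlgHom.ext fun a => (hf a).symm)
  let g : T.right ⟶ q := (hT.to (StructuredArrow.mk (j ≫ θ))).right
  have hg : T.hom ≫ F.map g = j ≫ θ := StructuredArrow.w (hT.to (StructuredArrow.mk (j ≫ θ)))
  have hdesc : ∀ (y : ZLE.{u} k n) (a : z ⟶ y) (b : T.right ⟶ y),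
      ∃ d : q ⟶ y, (f' ≫ d = a ∧ g ≫ d = b) ∧
        ∀ d' : q ⟶ y, f' ≫ d' = a → g ≫ d' = b → d' = d := by
    intro y a b
    let δ : w ⟶ F.obj y := hw.desc (BinaryCofan.mk (F.map a) (T.hom ≫ F.map b))
    have hδ₁ : i ≫ δ = F.map a := hw.fac _ ⟨WalkingPair.left⟩
    have hδ₂ : j ≫ δ = T.hom ≫ F.map b := hw.fac _ ⟨WalkingPair.right⟩
    have hδb : ∀ c, δ.base (i.base c) = a.hom.base c := fun c =>
      DFunLike.congr_fun (congrArg AxesModGm.Hom.base hδ₁) c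
    -- as arrows of `𝒵^{≤ n}` are cocartesian, `d` only has to be found on base rings
    obtain ⟨D, hD, hfD⟩ := FlatSection.exists_comp_eq hQ f a.hom
      (δ.base.comp e.symm.toAlgHom) (AlgHom.ext fun c => by
        change δ.base (e.symm (f.base c)) = a.hom.base c
        rw [hf, e.symm_apply_apply]
        exact hδb c)
    let d : q ⟶ y := ⟨D⟩
    have hd₁ : f' ≫ d = a := InducedCategory.Hom.ext hfD
    have hθd : θ ≫ F.map d = δ := by
      refine AxesModGm.comp_left_cancel i (AlgHom.ext fun c => ?_) ?_
      · change D.base (θ.base c) = δ.base c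
        rw [hθ, hD]
        change δ.base (e.symm (e c)) = δ.base c
        rw [e.symm_apply_apply]
      · rw [← Category.assoc, hiθ, ← F.map_comp, hd₁, hδ₁]
    have hd₂ : g ≫ d = b := by
      have h1 : T.hom ≫ F.map (g ≫ d) = T.hom ≫ F.map b := by
        rw [F.map_comp, ← Category.assoc, hg, Category.assoc, hθd, hδ₂]
      exact congrArg (fun m : T ⟶ StructuredArrow.mk (T.hom ≫ F.map b) => m.right)
        (hT.hom_ext (StructuredArrow.homMk (g ≫ d) h1) (StructuredArrow.homMk b rfl))
    refine ⟨d, ⟨hd₁, hd₂⟩, fun d' h₁ h₂ => ?_⟩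
    have hθd' : θ ≫ F.map d' = θ ≫ F.map d := by
      refine BinaryCofan.IsColimit.hom_ext hw ?_ ?_
      · change i ≫ θ ≫ F.map d' = i ≫ θ ≫ F.map d
        rw [← Category.assoc, hiθ, ← F.map_comp, h₁, ← Category.assoc, hiθ, ← F.map_comp, hd₁]
      · change j ≫ θ ≫ F.map d' = j ≫ θ ≫ F.map d
        rw [← Category.assoc, ← hg, Category.assoc, ← F.map_comp, h₂, ← Category.assoc, ← hg,
          Category.assoc, ← F.map_comp, hd₂]
    apply InducedCategory.Hom.ext
    refine FlatSection.comp_left_cancel f (AlgHom.ext fun c => ?_)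
      (congrArg InducedCategory.Hom.hom (h₁.trans hd₁.symm))
    have h3 := DFunLike.congr_fun (congrArg AxesModGm.Hom.base hθd') (e.symm c)
    change d'.hom.base (θ.base (e.symm c)) = d.hom.base (θ.base (e.symm c)) at h3
    rw [hθ] at h3
    change d'.hom.base (e (e.symm c)) = d.hom.base (e (e.symm c)) at h3
    rwa [e.apply_symm_apply] at h3
  choose d hd hu using hdesc
  refine ⟨q, f', g, ⟨BinaryCofan.IsColimit.mk _ (fun f g => d _ f g)
    (fun f g => (hd _ f g).1) (fun f g => (hd _ f g).2) fun f g m => hu _ f g m⟩, ?_⟩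
  have h1 : baseHom (ZLE.toRing k n) f' = (e.toRingEquiv : w.A →+* Q.A).comp
    (baseHom (AxesModGm.toRing k) i) := RingHom.ext hf
  rw [h1]
  exact RingHom.FaithfullyFlat.stableUnderComposition _ _ hflat
    (RingHom.FaithfullyFlat.of_bijective e.bijective)

end FlatAxes

end

noncomputable section

namespace FlatAxes

/-! ### Cartesian squares of full subcategories -/

section Cartesian

open CategoricalPullback

variable {W X Y S : Type*} [Category* W] [Category* X] [Category* Y] [Category* S]

/-- A square whose horizontal functors are fully faithful is Cartesian if every object of `X` that
lands in the subcategory `Y` comes from `W`. -/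
theorem isEquivalence_toCategoricalPullback (T : W ⥤ X) (L : W ⥤ Y) (F : X ⥤ S) (G : Y ⥤ S)
    (e : T ⋙ F ≅ L ⋙ G) [T.Full] [T.Faithful] [G.Full] [G.Faithful]
    (h : ∀ (x : X) (y : Y), (F.obj x ≅ G.obj y) → ∃ w : W, Nonempty (T.obj w ≅ x)) :
    ((CatCommSqOver.toFunctorToCategoricalPullback F G W).obj ⟨T, L, e⟩).IsEquivalence := by
  have hw : ∀ {w w' : W} (f : w ⟶ w'),
      F.map (T.map f) ≫ e.hom.app w' = e.hom.app w ≫ G.map (L.map f) :=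
    fun f => e.hom.naturality f
  refine { faithful := ⟨fun {w w'} f g hfg => ?_⟩, full := ⟨fun {w w'} f => ?_⟩,
           essSurj := ⟨fun P => ?_⟩ }
  · exact T.map_injective (congrArg CategoricalPullback.Hom.fst hfg)
  · obtain ⟨a, ha⟩ := T.map_surjective f.fst
    refine ⟨a, CategoricalPullback.hom_ext ha (G.map_injective ?_)⟩
    have h1 := f.w
    rw [← ha] at h1
    exact (cancel_epi (e.hom.app w)).1 ((hw a).symm.trans h1)
  · obtain ⟨w, ⟨θ⟩⟩ := h P.fst P.snd P.iso
    let η : G.obj (L.obj w) ≅ G.obj P.snd := (e.app w).symm ≪≫ F.mapIso θ ≪≫ P.iso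
    refine ⟨w, ⟨CategoricalPullback.mkIso θ (G.preimageIso η) ?_⟩⟩
    change F.map θ.hom ≫ P.iso.hom = e.hom.app w ≫ G.map (G.preimageIso η).hom
    rw [Functor.preimageIso_hom, Functor.map_preimage]
    simp [η]

end Cartesian

/-! ### Pseudo-coherence of the quotient by an element with periodic annihilators -/

section PseudoCoherent

variable {R : Type*} [CommRing R]

/-- If the annihilators of `x` and `y` are generated by `y` and `x`, then `R / x` has the periodic
resolution with differentials `x, y, x, y, …`. -/
theorem pseudoCoherentModule_of_isExactPair {x y : R} (h : IsExactPair x y R) (hxy : x * y = 0)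
    {M : Type*} [AddCommGroup M] [Module R M] (ε : R →ₗ[R] M) (hε : Function.Surjective ε)
    (hker : LinearMap.ker ε = Ideal.span {x}) : PseudoCoherentModule R M := by
  have key : ∀ z w : R, z * w = 0 → (∀ m : R, z • m = 0 → ∃ m', m = w • m') →
      Function.Exact (w • (LinearMap.id : (Fin 1 → R) →ₗ[R] (Fin 1 → R)))
        (z • (LinearMap.id : (Fin 1 → R) →ₗ[R] (Fin 1 → R))) := by
    intro z w hzw H v
    constructor
    · intro hv
      obtain ⟨m, hm⟩ := H (v 0) (congrFun hv 0)
      refine ⟨fun _ => m, funext fun i => ?_⟩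
      rw [Subsingleton.elim i 0, hm]
      rfl
    · rintro ⟨v, rfl⟩
      funext i
      change z * (w * v i) = 0
      rw [← mul_assoc, hzw, zero_mul]
  refine ⟨fun _ => 1, fun i => (if Even i then x else y) • LinearMap.id,
    ε ∘ₗ LinearMap.proj 0, fun m => ?_, fun v => ?_, fun i => ?_⟩
  · obtain ⟨r, rfl⟩ := hε m
    exact ⟨fun _ => r, rfl⟩
  · beta_reduce
    rw [if_pos Even.zero]
    change v 0 ∈ LinearMap.ker ε ↔ _
    rw [hker, Ideal.mem_span_singleton']
    constructor
    · rintro ⟨a, ha⟩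
      refine ⟨fun _ => a, funext fun i => ?_⟩
      rw [Subsingleton.elim i 0, ← ha]
      exact mul_comm _ _
    · rintro ⟨v, rfl⟩
      exact ⟨v 0, mul_comm _ _⟩
  · beta_reduce
    by_cases hi : Even i
    · rw [if_pos hi, if_neg (by rwa [Nat.even_add_one, not_not])]
      exact key x y hxy h.1
    · rw [if_neg hi, if_pos (by rwa [Nat.even_add_one])]
      exact key y x (by rw [mul_comm, hxy]) h.2

theorem almostFinitelyPresented_of_isExactPair {P : Type*} [CommRing P] (f : R →+* P)
    (hf : Function.Surjective f) {x y : R} (hker : RingHom.ker f = Ideal.span {x})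
    (h : IsExactPair x y R) (hxy : x * y = 0) : AlmostFinitelyPresented f := by
  let C : R →+* MvPolynomial (Fin 0) R := MvPolynomial.C
  have hCs : Function.Surjective C := MvPolynomial.C_surjective (Fin 0)
  have hCi : Function.Injective C := MvPolynomial.C_injective (Fin 0) R
  let g : MvPolynomial (Fin 0) R →+* P := MvPolynomial.eval₂Hom f Fin.elim0
  have hg : ∀ r, g (C r) = f r := fun r => MvPolynomial.eval₂_C _ _ _
  have key : ∀ z w : R, (∀ m : R, z • m = 0 → ∃ m', m = w • m') →
      ∀ m : MvPolynomial (Fin 0) R, C z • m = 0 → ∃ m', m = C w • m' := by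
    intro z w H m hm
    obtain ⟨m, rfl⟩ := hCs m
    rw [smul_eq_mul, ← map_mul, ← map_zero C] at hm
    obtain ⟨m', rfl⟩ := H m (hCi hm)
    exact ⟨C m', by rw [smul_eq_mul, smul_eq_mul, map_mul]⟩
  refine ⟨0, g, fun p => ?_, RingHom.ext hg, ?_⟩
  · obtain ⟨r, rfl⟩ := hf p
    exact ⟨C r, hg r⟩
  · let _ : Module (MvPolynomial (Fin 0) R) P := Module.compHom P g
    let ε : MvPolynomial (Fin 0) R →ₗ[MvPolynomial (Fin 0) R] P :=
      { toFun := g, map_add' := map_add g, map_smul' := map_mul g }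
    refine pseudoCoherentModule_of_isExactPair (x := C x) (y := C y)
      ⟨key x y h.1, key y x h.2⟩ (by rw [← map_mul, hxy, map_zero]) ε (fun p => ?_) ?_
    · obtain ⟨r, rfl⟩ := hf p
      exact ⟨C r, hg r⟩
    · ext m
      obtain ⟨m, rfl⟩ := hCs m
      have h1 : C m ∈ LinearMap.ker ε ↔ m ∈ RingHom.ker f := by
        rw [LinearMap.mem_ker, RingHom.mem_ker, ← hg]
        rfl
      rw [h1, hker, Ideal.mem_span_singleton, Ideal.mem_span_singleton]
      constructor
      · rintro ⟨a, rfl⟩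
        exact ⟨C a, map_mul _ _ _⟩
      · rintro ⟨a, ha⟩
        obtain ⟨a, rfl⟩ := hCs a
        rw [← map_mul] at ha
        exact ⟨a, hCi ha⟩

end PseudoCoherent

variable {k : Type u} [Field k]

/-! ### The vanishing locus of the section -/

namespace AxesModGm

/-- The ideal of the locus `{m = 0}`, generated by the values of linear forms at `m`. -/
def sectionIdeal (P : AxesModGm.{u} k) : Ideal P.A :=
  Ideal.span (Set.range fun φ : Module.Dual P.A P.M => φ P.m)

theorem base_eq_zero_of_mem_sectionIdeal {P Q : AxesModGm.{u} k} (F : P ⟶ Q) (hQ : Q.m = 0)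
    {a : P.A} (ha : a ∈ P.sectionIdeal) : F.base a = 0 := by
  have h : P.sectionIdeal ≤ RingHom.ker (F.base : P.A →+* Q.A) := by
    refine Ideal.span_le.2 ?_
    rintro _ ⟨φ, rfl⟩
    obtain ⟨h, -, hh⟩ := exists_semilinear_lift (F.base : P.A →+* Q.A) (RingHom.id Q.A) F.map
      F.map_smul F.span_range ((F.base : P.A →+* Q.A).toAddMonoidHom.comp φ.toAddMonoidHom)
      fun r x => by
        change F.base (φ (r • x)) = F.base r • F.base (φ x)
        rw [map_smul, smul_eq_mul, map_mul, smul_eq_mul]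
    have h1 := hh P.m
    rw [F.map_m, hQ, map_zero] at h1
    exact h1.symm
  exact h ha

theorem m_eq_zero_of_sectionIdeal {P Q : AxesModGm.{u} k} (F : P ⟶ Q)
    (h : ∀ a ∈ P.sectionIdeal, F.base a = 0) : Q.m = 0 := by
  obtain ⟨σ, hσ⟩ := Module.projective_def'.1 (inferInstance : Module.Projective P.A P.M)
  have h1 : Finsupp.linearCombination P.A id (σ P.m) = P.m := LinearMap.congr_fun hσ P.m
  rw [← F.map_m, ← h1, Finsupp.linearCombination_apply, Finsupp.sum, map_sum]
  refine Finset.sum_eq_zero fun i _ => ?_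
  have h2 : F.base (σ P.m i) = 0 := h _ (Ideal.subset_span ⟨Finsupp.lapply i ∘ₗ σ, rfl⟩)
  rw [F.map_smul, h2, zero_smul]

theorem sectionIdeal_eq_span {P : AxesModGm.{u} k} (f : coverPoint k ⟶ P) :
    P.sectionIdeal = Ideal.span {f.base (coordX k)} := by
  have hspan := span_map_one (coordY_mul_coordX k) f
  have hm := base_smul_eq_m (coordY_mul_coordX k) f
  let ε : P.A ≃ₗ[P.A] P.M := LinearEquiv.ofBijective
    (LinearMap.toSpanSingleton P.A P.M (f.map (1 : CoordRing k))) (bijective_smul_of_span hspan)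
  apply le_antisymm
  · refine Ideal.span_le.2 ?_
    rintro _ ⟨φ, rfl⟩
    refine Ideal.mem_span_singleton'.2 ⟨φ (f.map (1 : CoordRing k)), ?_⟩
    change _ = φ P.m
    rw [← hm, map_smul, smul_eq_mul, mul_comm]
  · rw [Ideal.span_singleton_le_iff_mem]
    refine Ideal.subset_span ⟨ε.symm.toLinearMap, ?_⟩
    change ε.symm P.m = _
    rw [LinearEquiv.symm_apply_eq]
    exact hm.symm

end AxesModGm

namespace FlatSection

/-! ### Untwisting -/

/-- If the section vanishes at `t = 0`, it is a section of `L(-1) = tL`. -/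
abbrev untwist (P : FlatSection.{u} k) (hs : ∃ w ∈ P.L, (PowerSeries.X : P.A⟦X⟧) • w = P.s) :
    FlatSection.{u} k where
  A := P.A
  V := P.V
  L := P.L.map (LinearMap.lsmul P.A⟦X⟧ P.V PowerSeries.X)
  invertible := Module.Invertible.congr
    (Submodule.equivMapOfInjective (LinearMap.lsmul P.A⟦X⟧ P.V PowerSeries.X) P.X_smul_injective
      P.L)
  exists_pow_smul_mem v := by
    obtain ⟨i, hi⟩ := P.exists_pow_smul_mem v
    exact ⟨i + 1, _, hi, by rw [LinearMap.lsmul_apply, smul_smul, ← pow_succ']⟩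
  nabla := P.nabla
  leibniz := P.leibniz
  s := P.s
  s_mem := hs
  nabla_s := P.nabla_s

theorem twistLattice_untwist (P : FlatSection.{u} k)
    (hs : ∃ w ∈ P.L, (PowerSeries.X : P.A⟦X⟧) • w = P.s) :
    (P.untwist hs).twistLattice = P.L := by
  ext v
  rw [mem_twistLattice]
  constructor
  · rintro ⟨w, hw, h⟩
    rwa [← P.X_smul_injective h]
  · exact fun hv => ⟨v, hv, rfl⟩

theorem untwist_poleLE {n : ℕ} (hn : 0 < n) {P : FlatSection.{u} k} (hP : PoleLE n P)
    (hs : ∃ w ∈ P.L, (PowerSeries.X : P.A⟦X⟧) • w = P.s) : PoleLE n (P.untwist hs) := by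
  rintro _ ⟨v, hv, rfl⟩
  obtain ⟨m, rfl⟩ : ∃ m, n = m + 1 := ⟨n - 1, by omega⟩
  refine ⟨(PowerSeries.X ^ m : P.A⟦X⟧) • v + (PowerSeries.X ^ (m + 1) : P.A⟦X⟧) • P.nabla v,
    add_mem (P.L.smul_mem _ hv) (hP v hv), ?_⟩
  change (PowerSeries.X : P.A⟦X⟧) • _ =
    (PowerSeries.X ^ (m + 1) : P.A⟦X⟧) • P.nabla ((PowerSeries.X : P.A⟦X⟧) • v)
  rw [nabla_smul, PowerSeries.derivative_X, one_smul, smul_add, smul_add, smul_smul, ← pow_succ',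
    smul_comm (PowerSeries.X : P.A⟦X⟧)]

/-- The identity, as an arrow between two points that only differ by the presentation of the
lattice. -/
theorem exists_iso_twist_untwist (P : FlatSection.{u} k)
    (hs : ∃ w ∈ P.L, (PowerSeries.X : P.A⟦X⟧) • w = P.s) :
    ∃ θ : P ≅ (P.untwist hs).twistObj, θ.hom.base = AlgHom.id k P.A := by
  have hid : ∀ (g : P.A⟦X⟧), PowerSeries.map ((AlgHom.id k P.A : P.A →ₐ[k] P.A) : P.A →+* P.A) g =
      g := fun g => by
    ext
    simp
  let f : Hom P (P.untwist hs).twistObj :=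
    { base := AlgHom.id k P.A
      map := AddMonoidHom.id P.V
      map_smul := fun g v => by
        rw [hid]
        rfl
      span_map := by
        change Submodule.span P.A⟦X⟧ (id '' (P.L : Set P.V)) = (P.untwist hs).twistLattice
        rw [Set.image_id, Submodule.span_eq, twistLattice_untwist]
      map_nabla := fun _ => rfl
      map_s := rfl }
  let g : Hom (P.untwist hs).twistObj P :=
    { base := AlgHom.id k P.A
      map := AddMonoidHom.id P.V
      map_smul := fun g v => by
        rw [hid]
        rfl
      span_map := by
        change Submodule.span P.A⟦X⟧ (id '' ((P.untwist hs).twistLattice : Set P.V)) = P.L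
        rw [Set.image_id, twistLattice_untwist, Submodule.span_eq]
      map_nabla := fun _ => rfl
      map_s := rfl }
  exact ⟨⟨f, g, hom_ext rfl rfl, hom_ext rfl rfl⟩, rfl⟩

end FlatSection

open FlatSection AxesModGm

namespace ZLE

variable (k) {n : ℕ} (hn : 0 < n)

instance : (incl k n).Full := ObjectProperty.full_ιOfLE _

instance : (incl k n).Faithful := ObjectProperty.faithful_ιOfLE _

instance : (shift k hn).Faithful where
  map_injective {P Q} f g h := by
    have h1 : (twist k).map f.hom = (twist k).map g.hom :=
      congrArg (fun φ : (shift k hn).obj P ⟶ (shift k hn).obj Q => φ.hom) h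
    apply InducedCategory.Hom.ext
    exact FlatSection.hom_ext
      (congrArg (fun φ : P.obj.twistObj ⟶ Q.obj.twistObj => φ.base) h1)
      (congrArg (fun φ : P.obj.twistObj ⟶ Q.obj.twistObj => φ.map) h1)

instance : (shift k hn).Full where
  map_surjective {P Q} f := by
    let F : FlatSection.Hom P.obj.twistObj Q.obj.twistObj := f.hom
    have hle : ∀ {v : P.obj.V}, v ∈ P.obj.L → F.map v ∈ Q.obj.L := by
      -- every vector is `t w` for some `w`, and `t w` is in `L` if and only if `w` is in `t⁻¹ L`
      intro v hv
      obtain ⟨w, rfl⟩ := P.obj.exists_X_smul v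
      have h1 : (PowerSeries.X : Q.obj.A⟦X⟧) • F.map w ∈ Q.obj.L := F.map_mem (v := w) hv
      rw [F.map_smul, PowerSeries.map_X]
      exact h1
    let G : FlatSection.Hom P.obj Q.obj :=
      { base := F.base
        map := F.map
        map_smul := F.map_smul
        span_map := by
          apply le_antisymm
          · rw [Submodule.span_le]
            rintro _ ⟨v, hv, rfl⟩
            exact hle hv
          · intro v hv
            obtain ⟨w, rfl⟩ := Q.obj.exists_X_smul v
            have hw : w ∈ Submodule.span Q.obj.A⟦X⟧
                (F.map '' (P.obj.twistLattice : Set P.obj.V)) := by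
              have h2 : w ∈ Q.obj.twistLattice := hv
              have h3 : _ = Q.obj.twistLattice := F.span_map
              rwa [← h3] at h2
            have hmap : ∀ w ∈ Submodule.span Q.obj.A⟦X⟧
                (F.map '' (P.obj.twistLattice : Set P.obj.V)), (PowerSeries.X : Q.obj.A⟦X⟧) • w ∈
                  Submodule.span Q.obj.A⟦X⟧ (F.map '' (P.obj.L : Set P.obj.V)) := by
              intro w hw
              induction hw using Submodule.span_induction with
              | mem x hx =>
                obtain ⟨x, hx, rfl⟩ := hx
                have h4 : F.map ((PowerSeries.X : P.obj.A⟦X⟧) • x) =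
                    (PowerSeries.X : Q.obj.A⟦X⟧) • F.map x := by
                  refine (F.map_smul _ _).trans ?_
                  rw [PowerSeries.map_X]
                rw [← h4]
                exact Submodule.subset_span ⟨_, hx, rfl⟩
              | zero => rw [smul_zero]; exact zero_mem _
              | add x y _ _ hx hy => rw [smul_add]; exact add_mem hx hy
              | smul r x _ hx => rw [smul_comm]; exact Submodule.smul_mem _ _ hx
            exact hmap w hw
        map_nabla := F.map_nabla
        map_s := F.map_s }
    exact ⟨⟨G⟩, rfl⟩

/-- The points in the image of `ι` are those whose section vanishes at `t = 0`. -/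
theorem exists_shift_iso (z : ZLE.{u} k n) (hz : ((evalAxes k hn).obj z).m = 0) :
    ∃ (u : ZLE.{u} k n) (θ : z ≅ (shift k hn).obj u), Function.Bijective θ.hom.hom.base := by
  obtain ⟨w, hw⟩ := (fiber_mk_eq_zero z.obj.A z.obj.L).1 hz
  have hs : ∃ w ∈ z.obj.L, (PowerSeries.X : z.obj.A⟦X⟧) • w = z.obj.s :=
    ⟨w, w.2, congrArg Subtype.val hw⟩
  obtain ⟨θ, hθ⟩ := exists_iso_twist_untwist z.obj hs
  let u : ZLE.{u} k n := ⟨z.obj.untwist hs, untwist_poleLE hn z.property hs⟩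
  refine ⟨u, ⟨⟨θ.hom⟩, ⟨θ.inv⟩, InducedCategory.Hom.ext θ.hom_inv_id,
    InducedCategory.Hom.ext θ.inv_hom_id⟩, ?_⟩
  change Function.Bijective θ.hom.base
  rw [hθ]
  exact Function.bijective_id

/-- The points of `𝒵^{≤ n}` whose leading coefficient vanishes are points of `𝒵^{≤ n - 1}`. -/
theorem poleLE_pred {P : FlatSection.{u} k} (hP : PoleLE n P) (h : leadingCoeff hn P hP = 0) :
    PoleLE (n - 1) P := by
  intro v hv
  obtain ⟨w, hw, h1⟩ := isLeadingCoeff_leadingCoeff hn P hP v hv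
  rw [h, zero_smul, zero_add] at h1
  obtain ⟨m, rfl⟩ : ∃ m, n = m + 1 := ⟨n - 1, by omega⟩
  have h2 : -w = (PowerSeries.X ^ m : P.A⟦X⟧) • P.nabla v := by
    apply P.X_smul_injective
    change (PowerSeries.X : P.A⟦X⟧) • (-w) = (PowerSeries.X : P.A⟦X⟧) • _
    rw [smul_neg, ← h1, neg_neg, smul_smul, ← pow_succ']
  change (PowerSeries.X ^ m : P.A⟦X⟧) • P.nabla v ∈ P.L
  rw [← h2]
  exact P.L.neg_mem hw

end ZLE

end FlatAxes

end

noncomputable section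

namespace FlatAxes

/-! ### The derived Cartesian squares and the closed embedding -/

open FlatSection AxesModGm

variable (k : Type u) [Field k] {n : ℕ} (hn : 0 < n)

theorem isDerivedCartesian_incl [CharZero k] :
    IsDerivedCartesian (AxesModGm.toRing k) (ZLE.incl k n) (ZLE.toXAxis k hn)
      (ZLE.evalAxes k hn) (AxesModGm.xAxisIncl k) (Iso.refl _) where
  cartesian := isEquivalence_toCategoricalPullback _ _ _ _ _ fun z s θ => by
    have h1 : leadingCoeff hn z.obj z.property = 0 := by
      have h3 : s.obj.y = 0 := s.property
      have h2 : θ.inv.base s.obj.y = leadingCoeff hn z.obj z.property := θ.inv.map_y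
      exact h2.symm.trans ((congrArg θ.inv.base h3).trans (map_zero θ.inv.base))
    exact ⟨⟨z.obj, ZLE.poleLE_pred k hn z.property h1⟩, ⟨Iso.refl _⟩⟩
  tor := by
    obtain ⟨f, -, hx, hy, hinit⟩ := exists_initial_evalAxes k hn
    obtain ⟨Q, hQ, htor⟩ := exists_initial_axis k (coordY k) (fun P => P.y = 0)
      fun P g => by rw [g.map_y]
    refine ⟨coverPoint k, isFlatCover_cover, _, Q, hinit, hQ, htor _ _ ?_⟩
    refine (flatAlongAxes_of_isExactPair _ ?_).1
    change IsExactPair (f.base (coordX k)) (f.base (coordY k)) (UniversalRing k n n)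
    rw [hx, hy]
    exact isExactPair_universal hn le_rfl

theorem isDerivedCartesian_shift [CharZero k] :
    IsDerivedCartesian (AxesModGm.toRing k) (ZLE.shift k hn) (ZLE.toYAxis k hn)
      (ZLE.evalAxes k hn) (AxesModGm.yAxisIncl k) (Iso.refl _) where
  cartesian := isEquivalence_toCategoricalPullback _ _ _ _ _ fun z s θ => by
    have h1 : ((ZLE.evalAxes k hn).obj z).m = 0 := by
      have h3 : s.obj.m = 0 := s.property
      have h2 : θ.inv.map s.obj.m = ((ZLE.evalAxes k hn).obj z).m := θ.inv.map_m
      rw [← h2, h3, map_zero]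
    obtain ⟨u, θ, -⟩ := ZLE.exists_shift_iso k hn z h1
    exact ⟨u, ⟨θ.symm⟩⟩
  tor := by
    obtain ⟨f, -, hx, hy, hinit⟩ := exists_initial_evalAxes k hn
    obtain ⟨Q, hQ, htor⟩ := exists_initial_axis k (coordX k) (fun P => P.m = 0) fun P g => by
      rw [← base_smul_eq_m (coordY_mul_coordX k) g]
      constructor
      · intro h
        refine (bijective_smul_of_span (span_map_one (coordY_mul_coordX k) g)).1 ?_
        exact h.trans (zero_smul _ _).symm
      · intro h
        rw [h, zero_smul]
    refine ⟨coverPoint k, isFlatCover_cover, _, Q, hinit, hQ, htor _ _ ?_⟩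
    refine (flatAlongAxes_of_isExactPair _ ?_).2
    change IsExactPair (f.base (coordX k)) (f.base (coordY k)) (UniversalRing k n n)
    rw [hx, hy]
    exact isExactPair_universal hn le_rfl

/-- The base change of `ι` to a point of `𝒵^{≤ n}` is the locus where the section vanishes at
`t = 0`. -/
theorem exists_initial_shift (y : ZLE.{u} k n) :
    ∃ T : StructuredArrow y (ZLE.shift k hn), Nonempty (IsInitial T) ∧
      Function.Surjective (baseHom (ZLE.toRing k n) T.hom) ∧
      RingHom.ker (baseHom (ZLE.toRing k n) T.hom) =
        (y.obj.evalPoint hn y.property).sectionIdeal := by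
  let F := ZLE.evalAxes k hn
  let I : Ideal y.obj.A := (y.obj.evalPoint hn y.property).sectionIdeal
  obtain ⟨Q, hQ, f, e, hf⟩ := exists_baseChange y.obj y.property (Ideal.Quotient.mkₐ k I)
  have hker : ∀ a, f.base a = 0 ↔ a ∈ I := fun a => by
    rw [hf, map_eq_zero_iff e e.injective]
    exact Ideal.Quotient.eq_zero_iff_mem
  have hsurj : Function.Surjective f.base := fun b => by
    obtain ⟨a, ha⟩ := Ideal.Quotient.mk_surjective (e.symm b)
    refine ⟨a, (hf a).trans ?_⟩
    exact (congrArg e ha).trans (e.apply_symm_apply b)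
  let q : ZLE.{u} k n := ⟨Q, hQ⟩
  let f' : y ⟶ q := ⟨f⟩
  have hm : (F.obj q).m = 0 := m_eq_zero_of_sectionIdeal
    (P := y.obj.evalPoint hn y.property) (F.map f') fun a ha => (hker a).2 ha
  obtain ⟨u, θ, hθ⟩ := ZLE.exists_shift_iso k hn q hm
  let T : StructuredArrow y (ZLE.shift k hn) := StructuredArrow.mk (Y := u) (f' ≫ θ.hom)
  have hinit : ∀ U : StructuredArrow y (ZLE.shift k hn), ∃ G : T ⟶ U, ∀ G' : T ⟶ U, G' = G := by
    intro U
    let g : y ⟶ (ZLE.shift k hn).obj U.right := U.hom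
    have hgI : ∀ a ∈ I, g.hom.base a = 0 := fun a ha =>
      base_eq_zero_of_mem_sectionIdeal (P := y.obj.evalPoint hn y.property) (F.map g)
        (ZLE.eval_shift_m k hn U.right) ha
    let ρ : Q.A →ₐ[k] U.right.obj.A :=
      (Ideal.Quotient.liftₐ I g.hom.base hgI).comp e.symm.toAlgHom
    obtain ⟨H, -, hH⟩ := FlatSection.exists_comp_eq hQ f g.hom ρ (AlgHom.ext fun a => by
      change Ideal.Quotient.liftₐ I g.hom.base hgI (e.symm (f.base a)) = g.hom.base a
      rw [hf, e.symm_apply_apply]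
      rfl)
    let H' : q ⟶ (ZLE.shift k hn).obj U.right := ⟨H⟩
    have hH' : f' ≫ H' = g := InducedCategory.Hom.ext hH
    refine ⟨StructuredArrow.homMk ((ZLE.shift k hn).preimage (θ.inv ≫ H')) ?_, fun G' => ?_⟩
    · rw [Functor.map_preimage]
      change (f' ≫ θ.hom) ≫ θ.inv ≫ H' = g
      rw [Category.assoc, θ.hom_inv_id_assoc, hH']
    · ext1
      apply (ZLE.shift k hn).map_injective
      refine Eq.trans ?_ ((ZLE.shift k hn).map_preimage (θ.inv ≫ H')).symm
      rw [← cancel_epi θ.hom, θ.hom_inv_id_assoc]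
      have h1 : f' ≫ θ.hom ≫ (ZLE.shift k hn).map G'.right = f' ≫ H' := by
        rw [← Category.assoc, hH']
        exact StructuredArrow.w G'
      have h2 : f ≫ (θ.hom ≫ (ZLE.shift k hn).map G'.right).hom = f ≫ H :=
        congrArg (fun φ : y ⟶ (ZLE.shift k hn).obj U.right => φ.hom) h1
      apply InducedCategory.Hom.ext
      refine FlatSection.comp_left_cancel f (AlgHom.ext fun b => ?_) h2
      obtain ⟨a, rfl⟩ := hsurj b
      exact DFunLike.congr_fun
        (congrArg (fun φ : y.obj ⟶ ((ZLE.shift k hn).obj U.right).obj => φ.base) h2) a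
  choose G hG using hinit
  have hbase : ∀ a, baseHom (ZLE.toRing k n) T.hom a = θ.hom.hom.base (f.base a) := fun a => rfl
  refine ⟨T, ⟨IsInitial.ofUniqueHom G hG⟩, fun b => ?_, ?_⟩
  · obtain ⟨b, rfl⟩ := hθ.2 b
    obtain ⟨a, rfl⟩ := hsurj b
    exact ⟨a, hbase a⟩
  · ext a
    rw [RingHom.mem_ker, hbase]
    refine Iff.trans ?_ (hker a)
    exact map_eq_zero_iff θ.hom.hom.base hθ.1

theorem isClosedEmbedding_shift : IsClosedEmbedding (ZLE.toRing k n) (ZLE.shift k hn) := fun y =>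
  (exists_initial_shift k hn y).imp fun _ h => ⟨h.1, h.2.1⟩

theorem isAlmostFinitelyPresented_shift [CharZero k] :
    IsAlmostFinitelyPresented (ZLE.toRing k n) (ZLE.shift k hn) := by
  obtain ⟨f, -, hx, hy, ⟨hinit⟩⟩ := exists_initial_evalAxes k hn
  obtain ⟨T, hT, hsurj, hker⟩ := exists_initial_shift k hn (normalizedPoint k n)
  refine ⟨normalizedPoint k n, isFlatCover_right hn isFlatCover_cover _ hinit, T, hT, ?_⟩
  rw [sectionIdeal_eq_span f, hx] at hker
  refine almostFinitelyPresented_of_isExactPair (R := UniversalRing k n n) _ hsurj hker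
    (isExactPair_universal hn le_rfl) ?_
  rw [← hx, ← hy, ← map_mul, mul_comm, coordY_mul_coordX, map_zero]

end FlatAxes

end

theorem proposition2p18 (k : Type u) [Field k] [CharZero k] :
    -- `𝒵^{≤ m}` is the quotient by `𝔏⁺𝔾_m` of the derived equalizer, which is classical
    (∀ m : ℕ, FlatAxes.DerivedEqualizer.IsClassical k m ∧ FlatAxes.DerivedEqualizer.IsTorsor k m) ∧
    ∀ (n : ℕ) (hn : 0 < n),
      -- the map to `C / 𝔾_m` is flat along the axes
      FlatAxes.StackFlatAlongAxes (FlatAxes.ZLE.evalAxes k hn) ∧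
      -- its (derived) fibre over the `x`-axis is `𝒵^{≤ n - 1}`
      FlatAxes.IsDerivedCartesian (FlatAxes.AxesModGm.toRing k)
        (FlatAxes.ZLE.incl k n) (FlatAxes.ZLE.toXAxis k hn)
        (FlatAxes.ZLE.evalAxes k hn) (FlatAxes.AxesModGm.xAxisIncl k)
        (CategoryTheory.Iso.refl _) ∧
      -- the derived Cartesian square of `ι`, over the `y`-axis
      FlatAxes.IsDerivedCartesian (FlatAxes.AxesModGm.toRing k)
        (FlatAxes.ZLE.shift k hn) (FlatAxes.ZLE.toYAxis k hn)
        (FlatAxes.ZLE.evalAxes k hn) (FlatAxes.AxesModGm.yAxisIncl k)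
        (CategoryTheory.Iso.refl _) ∧
      -- `ι` is an almost finitely presented closed embedding
      FlatAxes.IsClosedEmbedding (FlatAxes.ZLE.toRing k n) (FlatAxes.ZLE.shift k hn) ∧
      FlatAxes.IsAlmostFinitelyPresented (FlatAxes.ZLE.toRing k n) (FlatAxes.ZLE.shift k hn) := by
  exact ⟨fun m => ⟨FlatAxes.isClassical k m, FlatAxes.isTorsor m⟩, fun n hn =>
    ⟨FlatAxes.stackFlatAlongAxes k hn, FlatAxes.isDerivedCartesian_incl k hn,
      FlatAxes.isDerivedCartesian_shift k hn, FlatAxes.isClosedEmbedding_shift k hn,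
      FlatAxes.isAlmostFinitelyPresented_shift k hn⟩⟩
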